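/- Let $p_1\equiv 1 \pmod 8$ and $p_2\equiv 5\pmod 8$ be prime numbers and let $L=\mathbb{Q}(\sqrt{-1},\sqrt2,\sqrt{p_1},\sqrt{p_2})$. For a number field $k$ let $E_k$ be the group of units of its ring of integers, and let $q(L)=(E_L:\prod_i E_{k_i})$ be the unit index of $L$, where $k_i$ runs over the quadratic subfields of $L$. For a positive non-square integer $d$ let $\varepsilon_d>1$ be the fundamental unit of $\mathbb{Q}(\sqrt d)$, and let $n_1,n_2,n_3,n_4$ be the norms over $\mathbb{Q}$ of $\varepsilon_{2p_1},\varepsilon_{2p_2},\varepsilon_{p_1p_2},\varepsilon_{2p_1p_2}$ respectively. Write $\varepsilon_{2p_1p_2}=x+y\sqrt{2p_1p_2}$ with integers $x,y$. Then $$q(L)=2^{5+\delta}\quad\text{with } \delta\in\{0,1\}.$$ Furthermore, $\delta=0$ if none of the following conditions C1, C2, C3 holds, neither as written nor after interchanging the roles of $p_1$ and $p_2$ (that is, of $n_1$ and $n_2$): - C1: $n_1=n_2=n_3=n_4$; - C2: $n_1=n_2=-n_3=n_4=1$ and $x+1$ or $x-1$ is the square of a natural number; - C3: $-n_1=n_2=n_3=n_4=1$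 and neither $x+1$ nor $x-1$ is the square of a natural number. (C1 and C2 are symmetric in $p_1,p_2$; the interchanged form of C3 is $n_1=-n_2=n_3=n_4=1$ and neither $x+1$ nor $x-1$ is the square of a natural number.) -/

import Mathlib

open scoped NumberField

namespace Multiquadratic

/-- The unit index `q(L) = (E_L : ∏ᵢ E_{kᵢ})` of a multiquadratic field `L`, where the `kᵢ` are the
quadratic subfields of `L` and `E` denotes the unit group of the ring of integers. The product of
the unit groups is the subgroup of `E_L` that they generate (`E_L` is commutative).
`Subgroup.index` takes the value `0` when the index is infinite. -/
noncomputable def unitIndex (L : Type*) [Field L] [Algebra ℚ L] : ℕ :=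
  (⨆ k : {k : IntermediateField ℚ L // Module.finrank ℚ k = 2},
    (Units.map (algebraMap (𝓞 k.1) (𝓞 L)).toMonoidHom).range).index

/-- The field `L = ℚ(i, √2, √p₁, √p₂)`, as a subfield of `ℂ`. -/
noncomputable abbrev fieldL (p₁ p₂ : ℕ) : IntermediateField ℚ ℂ :=
  IntermediateField.adjoin ℚ
    {Complex.I, ((√2 : ℝ) : ℂ), ((√(p₁ : ℝ) : ℝ) : ℂ), ((√(p₂ : ℝ) : ℝ) : ℂ)}

/-- The real quadratic field `ℚ(√d)`, as a subfield of `ℝ`. -/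
noncomputable abbrev QSqrt (d : ℕ) : IntermediateField ℚ ℝ :=
  IntermediateField.adjoin ℚ {√(d : ℝ)}

/-- A unit of the ring of integers of `ℚ(√d)`, viewed as a real number. -/
noncomputable def toReal {d : ℕ} (u : (𝓞 (QSqrt d))ˣ) : ℝ :=
  (((u : 𝓞 (QSqrt d)) : QSqrt d) : ℝ)

/-- `ε` is the fundamental unit `ε_d` of the real quadratic field `ℚ(√d)`: the smallest unit of its
ring of integers that is greater than `1`. -/
def IsFundamentalUnit (d : ℕ) (ε : (𝓞 (QSqrt d))ˣ) : Prop :=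
  1 < toReal ε ∧ ∀ η : (𝓞 (QSqrt d))ˣ, 1 < toReal η → toReal ε ≤ toReal η

/-- The norm of a unit of `ℚ(√d)` in the extension `ℚ(√d)/ℚ`. -/
noncomputable def unitNorm {d : ℕ} (u : (𝓞 (QSqrt d))ˣ) : ℚ :=
  Algebra.norm ℚ ((u : 𝓞 (QSqrt d)) : QSqrt d)

/-- `x ± 1` is a square in `ℕ`: at least one of `x + 1`, `x - 1` is. -/
def PMOneSquare (x : ℤ) : Prop :=
  (∃ m : ℕ, x + 1 = (m : ℤ) ^ 2) ∨ (∃ m : ℕ, x - 1 = (m : ℤ) ^ 2)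

/-- Condition C1: `n₁ = n₂ = n₃ = n₄`. -/
def C1 (n₁ n₂ n₃ n₄ : ℚ) : Prop := n₁ = n₂ ∧ n₂ = n₃ ∧ n₃ = n₄

/-- Condition C2: `n₁ = n₂ = -n₃ = n₄ = 1` and `x ± 1` is a square in `ℕ`, where `x`, `y` are the
integers with `ε = x + y√d`. -/
def C2 (n₁ n₂ n₃ n₄ : ℚ) (d : ℕ) (ε : (𝓞 (QSqrt d))ˣ) : Prop :=
  n₁ = 1 ∧ n₂ = 1 ∧ -n₃ = 1 ∧ n₄ = 1 ∧
    ∃ x y : ℤ, toReal ε = (x : ℝ) + (y : ℝ) * √(d : ℝ) ∧ PMOneSquare x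

/-- Condition C3: `-n₁ = n₂ = n₃ = n₄ = 1` and `x ± 1` is not a square in `ℕ`, where `x`, `y` are
the integers with `ε = x + y√d`. -/
def C3 (n₁ n₂ n₃ n₄ : ℚ) (d : ℕ) (ε : (𝓞 (QSqrt d))ˣ) : Prop :=
  -n₁ = 1 ∧ n₂ = 1 ∧ n₃ = 1 ∧ n₄ = 1 ∧
    ∃ x y : ℤ, toReal ε = (x : ℝ) + (y : ℝ) * √(d : ℝ) ∧ ¬ PMOneSquare x

end Multiquadratic

/-! Write p, q for p₁, p₂, L⁺ for the real subfield of L, P for the product of the unit groups of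
the quadratic subfields and g_v for the fundamental units of the seven real quadratic subfields.
Then P is generated by √-1 and the g_v, and its index is computed in three layers.

Roots of unity: if a unit u had u/ū equal to a primitive eighth root of unity, 2 would ramify in
ℚ(√p, √q) (`div_conj_ne_ζ`). Hence E_L is generated by an eighth root of unity ζ and E_{L⁺}
(`exists_real_unit`), and P·E_{L⁺} has index 2 in E_L (`index_sup`).

Parity: for k in E_{L⁺} let `expo v k` be the exponent of g_v in the norm of k to ℚ(√d_v). The seven
exponents determine k up to sign, and k lies in P exactly when 4 divides all of them. Signs of
conjugates (`even_line`) and square roots of fundamental units of norm 1 (`even_line_of_sqrt`) tie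
their parities together: if one exponent at 2p, pq or 2pq is even, all seven are
(`even_expo_of_even`). So the real units with even exponents have index 2^δ, δ ∈ {0, 1}.

Halved exponents: on those units, the halved exponents modulo 2 at the composite discriminants 2p,
2q, pq, 2pq give a map onto 𝔽₂⁴ with kernel P ∩ E_{L⁺}. It is onto because L⁺ contains a square root
of ±g_v (norm 1), or of ±g_v times the fundamental units at the primes dividing d_v (norm -1). The
index is therefore 2·16·2^δ.

For the vanishing of δ: the norms at 2, p, q and 2q are -1, the last because ±2 is a non-residue
modulo q. If the norms at 2p, pq, 2pq are not all equal, some exponent is always even and δ = 0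
(`index_parity_of_nrm`). If all are -1, C1 holds. If all are 1, the interchanged C3 holds, since a
square x ± 1 would make ±2 a residue modulo q (`exists_not_pmOneSquare`). -/

namespace Multiquadratic

/-! ### Index vectors over 𝔽₂ for square roots and automorphisms -/

/-- The index set of the square roots of, and of the automorphisms of, the multiquadratic field:
the coordinates refer to `-1`, `2`, `p₁`, `p₂`. -/
abbrev Vec : Type := ZMod 2 × ZMod 2 × ZMod 2 × ZMod 2

/-- The standard pairing on `Vec`. -/
def dot (a v : Vec) : ZMod 2 :=
  a.1 * v.1 + a.2.1 * v.2.1 + a.2.2.1 * v.2.2.1 + a.2.2.2 * v.2.2.2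

/-- The sign character of `ZMod 2`. -/
def sgn (x : ZMod 2) : ℤ := if x = 0 then 1 else -1

lemma dot_add_left (a b v : Vec) : dot (a + b) v = dot a v + dot b v := by
  simp only [dot, Prod.fst_add, Prod.snd_add]; ring

lemma zmod_two_cases (x : ZMod 2) : x = 0 ∨ x = 1 := by revert x; decide

lemma vec_add_self (a : Vec) : a + a = 0 := by
  have h : ∀ x : ZMod 2, x + x = 0 := by decide
  ext <;> simp [h]

@[simp] lemma sgn_zero : sgn 0 = 1 := rfl
@[simp] lemma sgn_one : sgn 1 = -1 := rfl

lemma sgn_mul_self (x : ZMod 2) : sgn x * sgn x = 1 := by revert x; decide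

lemma exists_dot_eq_one {v : Vec} (hv : v ≠ 0) : ∃ a, dot a v = 1 := by
  revert v; decide

/-- The integer `(-1)^a 2^b p^c q^d` attached to an index. -/
def disc (p q : ℕ) (v : Vec) : ℤ :=
  (-1) ^ v.1.val * 2 ^ v.2.1.val * (p : ℤ) ^ v.2.2.1.val * (q : ℤ) ^ v.2.2.2.val

/-- The index of complex conjugation and of `√-1`. -/
abbrev e₀ : Vec := (1, 0, 0, 0)
/-- The index of `√2`. -/
abbrev e₁ : Vec := (0, 1, 0, 0)
/-- The index of `√p`. -/
abbrev e₂ : Vec := (0, 0, 1, 0)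
/-- The index of `√q`. -/
abbrev e₃ : Vec := (0, 0, 0, 1)

lemma squarefree_two_mul_mul {p q : ℕ} (hp : p.Prime) (hq : q.Prime) (hp8 : p % 8 = 1)
    (hq8 : q % 8 = 5) : Squarefree (2 * p * q) := by
  have h2p : Nat.Coprime 2 p := (Nat.coprime_primes Nat.prime_two hp).2 (by omega)
  have h2q : Nat.Coprime 2 q := (Nat.coprime_primes Nat.prime_two hq).2 (by omega)
  have hpq : Nat.Coprime p q := (Nat.coprime_primes hp hq).2 (by omega)
  rw [Nat.squarefree_mul (h2q.mul_left hpq), Nat.squarefree_mul h2p]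
  exact ⟨⟨Nat.prime_two.prime.squarefree, hp.prime.squarefree⟩, hq.prime.squarefree⟩

/-- A field generated by `√-1, √2, √p, √q`, with its square roots and its automorphisms. -/
structure Frame (L : Type*) [Field L] [CharZero L] (p q : ℕ) where
  prime_p : p.Prime
  prime_q : q.Prime
  p_mod : p % 8 = 1
  q_mod : q % 8 = 5
  r : Vec → L
  σ : Vec → (L ≃+* L)
  σ_zero : ∀ x, σ 0 x = x
  σ_add : ∀ a b x, σ (a + b) x = σ a (σ b x)
  σ_r : ∀ a v, σ a (r v) = (sgn (dot a v) : L) * r v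
  r_sq : ∀ v, r v ^ 2 = (disc p q v : L)
  exists_rat : ∀ x, (∀ a, σ a x = x) → ∃ c : ℚ, x = c
  ι : L →+* ℂ
  ι_r : ∀ v : Vec, v.1 = 0 → ι (r v) = ((√(disc p q v : ℝ) : ℝ) : ℂ)

/-! ### Units as elements of the field -/

/-- Units of the ring of integers, as elements of the field. -/
def IsU {L : Type*} [Field L] (x : L) : Prop := x ≠ 0 ∧ IsIntegral ℤ x ∧ IsIntegral ℤ x⁻¹

section IsU

variable {L : Type*} [Field L] {x y : L}

lemma IsU.mul (hx : IsU x) (hy : IsU y) : IsU (x * y) :=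
  ⟨mul_ne_zero hx.1 hy.1, hx.2.1.mul hy.2.1, by rw [mul_inv]; exact hx.2.2.mul hy.2.2⟩

lemma IsU.inv (hx : IsU x) : IsU x⁻¹ :=
  ⟨inv_ne_zero hx.1, hx.2.2, by rw [inv_inv]; exact hx.2.1⟩

lemma IsU.one : IsU (1 : L) := ⟨one_ne_zero, isIntegral_one, by rw [inv_one]; exact isIntegral_one⟩

lemma IsU.neg (hx : IsU x) : IsU (-x) :=
  ⟨neg_ne_zero.2 hx.1, hx.2.1.neg, by rw [inv_neg]; exact hx.2.2.neg⟩

lemma IsU.pow (hx : IsU x) (n : ℕ) : IsU (x ^ n) :=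
  ⟨pow_ne_zero _ hx.1, hx.2.1.pow n, by rw [← inv_pow]; exact hx.2.2.pow n⟩

lemma IsU.zpow (hx : IsU x) (n : ℤ) : IsU (x ^ n) := by
  cases n with
  | ofNat n => simpa using hx.pow n
  | negSucc n => simpa using (hx.pow (n + 1)).inv

lemma IsU.map {F G : Type*} [Field F] [FunLike G L F] [RingHomClass G L F] (f : G) (hx : IsU x) :
    IsU (f x) :=
  ⟨(map_ne_zero f).2 hx.1, map_isIntegral_int f hx.2.1, by
    rw [← map_inv₀]; exact map_isIntegral_int f hx.2.2⟩

lemma IsU.prod {α : Type*} (s : Finset α) (f : α → L) (h : ∀ i ∈ s, IsU (f i)) :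
    IsU (∏ i ∈ s, f i) :=
  Finset.prod_induction f IsU (fun _ _ => IsU.mul) IsU.one h

/-- An integral element with a unit power is a unit. -/
lemma IsU.of_sq (hx : IsU (x ^ 2)) : IsU x := by
  have h0 : x ≠ 0 := fun h => hx.1 (by simp [h])
  refine ⟨h0, hx.2.1.of_pow two_pos, ?_⟩
  have := hx.2.2
  rw [← inv_pow] at this
  exact this.of_pow two_pos

end IsU

lemma isIntegral_rat {L : Type*} [Field L] [CharZero L] {c : ℚ} (h : IsIntegral ℤ (c : L)) :
    ∃ n : ℤ, c = n := by
  have h' : IsIntegral ℤ c := by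
    have : (algebraMap ℚ L) c = (c : L) := by simp
    rw [← this] at h
    exact (isIntegral_algebraMap_iff (algebraMap ℚ L).injective).1 h
  obtain ⟨n, hn⟩ := IsIntegrallyClosed.isIntegral_iff.1 h'
  exact ⟨n, by simpa using hn.symm⟩

lemma isU_rat {L : Type*} [Field L] [CharZero L] {c : ℚ} (h : IsU (c : L)) : c = 1 ∨ c = -1 := by
  obtain ⟨n, rfl⟩ := isIntegral_rat h.2.1
  have h2 := h.2.2
  rw [← Rat.cast_inv] at h2
  obtain ⟨m, hm⟩ := isIntegral_rat h2
  have h0 : (n : ℚ) ≠ 0 := fun h0 => h.1 (by rw [h0]; simp)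
  have h1 : n * m = 1 := by
    have : (n : ℚ) * m = 1 := by rw [← hm, mul_inv_cancel₀ h0]
    exact_mod_cast this
  rcases Int.eq_one_or_neg_one_of_mul_eq_one h1 with h | h
  · left; simp [h]
  · right; simp [h]

lemma rat_int_of_sq {c : ℚ} {n : ℤ} (h : c ^ 2 = n) : ∃ m : ℤ, c = m := by
  refine isIntegral_rat (L := ℚ) (IsIntegral.of_pow two_pos ?_)
  rw [Rat.cast_id, h]
  exact isIntegral_algebraMap (R := ℤ) (x := n)

lemma zpow_pm_one_cases {L : Type*} [Field L] {s : L} (hs : s = 1 ∨ s = -1) (n : ℤ) :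
    s ^ n = 1 ∨ s ^ n = -1 := by
  rcases hs with rfl | rfl
  · simp
  · rcases n.even_or_odd with h | h
    · exact Or.inl h.neg_one_zpow
    · exact Or.inr h.neg_one_zpow

lemma pm_one_mul {L : Type*} [Field L] {s t : L} (hs : s = 1 ∨ s = -1) (ht : t = 1 ∨ t = -1) :
    s * t = 1 ∨ s * t = -1 := by
  rcases hs with rfl | rfl <;> rcases ht with rfl | rfl <;> simp

lemma sq_pm_one {L : Type*} [Field L] {s : L} (hs : s = 1 ∨ s = -1) : s ^ 2 = 1 := by
  rcases hs with rfl | rfl <;> ring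

lemma pm_one_prod {L α : Type*} [Field L] (S : Finset α) (f : α → L)
    (h : ∀ i ∈ S, f i = 1 ∨ f i = -1) : ∏ i ∈ S, f i = 1 ∨ ∏ i ∈ S, f i = -1 :=
  Finset.prod_induction f (fun s => s = 1 ∨ s = -1) (fun _ _ => pm_one_mul) (Or.inl rfl) h

/-! ### Quadratic subfields and their units -/

namespace Frame

variable {L : Type*} [Field L] [CharZero L] {p q : ℕ}

lemma disc_ne_zero (M : Frame L p q) (v : Vec) : disc p q v ≠ 0 := by
  have := M.prime_p.ne_zero
  have := M.prime_q.ne_zero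
  unfold disc; positivity

lemma eq_of_prime_dvd_disc (M : Frame L p q) {l : ℕ} (hl : l.Prime) {v : Vec}
    (h : (l : ℤ) ∣ disc p q v) :
    (l = 2 ∧ v.2.1 = 1) ∨ (l = p ∧ v.2.2.1 = 1) ∨ (l = q ∧ v.2.2.2 = 1) := by
  have hl' : Prime (l : ℤ) := Nat.prime_iff_prime_int.1 hl
  have key : ∀ (m : ℕ) (x : ZMod 2), m.Prime → (l : ℤ) ∣ (m : ℤ) ^ x.val → l = m ∧ x = 1 := by
    intro m x hm hd
    rcases zmod_two_cases x with rfl | rfl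
    · exact absurd (isUnit_of_dvd_one (by simpa using hd)) hl'.not_isUnit
    · refine ⟨?_, rfl⟩
      rw [ZMod.val_one, pow_one] at hd
      exact (Nat.prime_dvd_prime_iff_eq hl hm).1 (by exact_mod_cast hd)
  unfold disc at h
  rcases hl'.dvd_mul.1 h with h | h
  · rcases hl'.dvd_mul.1 h with h | h
    · rcases hl'.dvd_mul.1 h with h | h
      · exact absurd (isUnit_of_dvd_unit (hl'.dvd_of_dvd_pow h) (by simp)) hl'.not_isUnit
      · exact Or.inl (key 2 _ Nat.prime_two h)
    · exact Or.inr (Or.inl (key p _ M.prime_p h))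
  · exact Or.inr (Or.inr (key q _ M.prime_q h))

end Frame
namespace Frame

variable {L : Type*} [Field L] [CharZero L] {p q : ℕ} (M : Frame L p q)

lemma r_ne_zero (v : Vec) : M.r v ≠ 0 := by
  intro h
  have := M.r_sq v
  rw [h] at this
  have h2 : ((disc p q v : ℤ) : L) = 0 := by rw [← this]; ring
  exact M.disc_ne_zero v (by exact_mod_cast h2)

lemma σ_comm (a b : Vec) (x : L) : M.σ a (M.σ b x) = M.σ b (M.σ a x) := by
  rw [← M.σ_add, ← M.σ_add, add_comm]

lemma σ_σ (a : Vec) (x : L) : M.σ a (M.σ a x) = x := by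
  rw [← M.σ_add, vec_add_self, M.σ_zero]

lemma σ_r_zero {a v : Vec} (h : dot a v = 0) : M.σ a (M.r v) = M.r v := by
  rw [M.σ_r, h]; simp

lemma σ_r_one {a v : Vec} (h : dot a v = 1) : M.σ a (M.r v) = -M.r v := by
  rw [M.σ_r, h]; simp

lemma isIntegral_r (v : Vec) : IsIntegral ℤ (M.r v) := by
  refine IsIntegral.of_pow two_pos ?_
  rw [M.r_sq]
  exact isIntegral_algebraMap (R := ℤ) (x := disc p q v)

lemma r_e₀_sq : M.r e₀ ^ 2 = -1 := by
  rw [M.r_sq]; simp [disc, ZMod.val_one]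

lemma r_e₁_sq : M.r e₁ ^ 2 = 2 := by
  rw [M.r_sq]; simp [disc, ZMod.val_one]

lemma isU_i : IsU (M.r e₀) := by
  apply IsU.of_sq
  rw [M.r_e₀_sq]
  exact IsU.one.neg

lemma eq_of_sq_eq_neg_one {x : L} (h : x ^ 2 = -1) : x = M.r e₀ ∨ x = -M.r e₀ := by
  rw [← M.r_e₀_sq] at h
  exact sq_eq_sq_iff_eq_or_eq_neg.1 h

/-- `-1` is not a square in the real subfield. -/
lemma not_sq_eq_neg_one {x : L} (hx : M.σ e₀ x = x) : x ^ 2 ≠ -1 := by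
  intro h
  have h1 : M.σ e₀ (M.r e₀) = -M.r e₀ := M.σ_r_one (by decide)
  have h2 : M.r e₀ ≠ 0 := M.r_ne_zero _
  rcases M.eq_of_sq_eq_neg_one h with rfl | rfl
  · rw [h1] at hx
    exact h2 (self_eq_neg.1 hx.symm)
  · rw [map_neg, h1, neg_neg] at hx
    exact h2 (self_eq_neg.1 hx)

/-- `x` is fixed by the automorphisms with index in `S`. -/
def FixBy (S : Set Vec) (x : L) : Prop := ∀ a ∈ S, M.σ a x = x

/-- The stabilizer of `r v`. -/
def stab (v : Vec) : Set Vec := {a | dot a v = 0}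

variable {M}

lemma FixBy.mul {S : Set Vec} {x y : L} (hx : M.FixBy S x) (hy : M.FixBy S y) :
    M.FixBy S (x * y) := fun a ha => by rw [map_mul, hx a ha, hy a ha]

lemma FixBy.add {S : Set Vec} {x y : L} (hx : M.FixBy S x) (hy : M.FixBy S y) :
    M.FixBy S (x + y) := fun a ha => by rw [map_add, hx a ha, hy a ha]

lemma FixBy.neg {S : Set Vec} {x : L} (hx : M.FixBy S x) : M.FixBy S (-x) :=
  fun a ha => by rw [map_neg, hx a ha]

lemma FixBy.inv {S : Set Vec} {x : L} (hx : M.FixBy S x) : M.FixBy S x⁻¹ :=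
  fun a ha => by rw [map_inv₀, hx a ha]

lemma FixBy.pow {S : Set Vec} {x : L} (hx : M.FixBy S x) (n : ℕ) : M.FixBy S (x ^ n) :=
  fun a ha => by rw [map_pow, hx a ha]

lemma FixBy.zpow {S : Set Vec} {x : L} (hx : M.FixBy S x) (n : ℤ) : M.FixBy S (x ^ n) :=
  fun a ha => by rw [map_zpow₀, hx a ha]

lemma FixBy.one {S : Set Vec} : M.FixBy S 1 := fun _ _ => map_one _

lemma FixBy.rat {S : Set Vec} (c : ℚ) : M.FixBy S (c : L) := fun _ _ => map_ratCast _ c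

lemma FixBy.σ {S : Set Vec} {x : L} (hx : M.FixBy S x) (b : Vec) : M.FixBy S (M.σ b x) :=
  fun a ha => by rw [M.σ_comm, hx a ha]

lemma FixBy.mono {S T : Set Vec} {x : L} (hx : M.FixBy S x) (h : T ⊆ S) : M.FixBy T x :=
  fun a ha => hx a (h ha)

variable (M)

lemma fixBy_r (v : Vec) : M.FixBy (stab v) (M.r v) := fun _ ha => M.σ_r_zero ha

lemma fixBy_int (S : Set Vec) (n : ℤ) : M.FixBy S (n : L) := fun _ _ => map_intCast _ n

/-- An element fixed by the stabilizer of `r v` is a rational combination of `1` and `r v`. -/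
lemma exists_coords {v π : Vec} (hπ : dot π v = 1) {x : L} (hx : M.FixBy (stab v) x) :
    ∃ c b : ℚ, x = c + b * M.r v ∧ M.σ π x = c - b * M.r v := by
  have hr := M.r_ne_zero v
  have hσr := M.σ_r_one hπ
  have key : ∀ y : L, M.FixBy (stab v) y → M.σ π y = y → ∃ c : ℚ, y = c := by
    intro y hy hy'
    refine M.exists_rat y fun a => ?_
    rcases zmod_two_cases (dot a v) with h | h
    · exact hy a h
    -- The stabilizer has index two, so every other automorphism lies in the coset of π.
    · have : a = (a + π) + π := by rw [add_assoc, vec_add_self, add_zero]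
      rw [this, M.σ_add, hy']
      exact hy _ (by simp only [stab, Set.mem_ofPred_eq, dot_add_left, h, hπ]; decide)
  -- The part of x even under π, and the odd part divided by `r v`, are fixed by everything, hence
  -- rational.
  obtain ⟨c, hc⟩ := key ((x + M.σ π x) / 2) (by
      have h := (hx.add (hx.σ π)).mul (FixBy.rat (M := M) (2 : ℚ)).inv
      simpa [div_eq_mul_inv] using h) (by
      rw [map_div₀, map_add, M.σ_σ, map_ofNat, add_comm])
  obtain ⟨b, hb⟩ := key ((x - M.σ π x) / (2 * M.r v)) (by
      have h := (hx.add (hx.σ π).neg).mul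
        ((FixBy.rat (M := M) (2 : ℚ)).mul (M.fixBy_r v)).inv
      simpa [div_eq_mul_inv, sub_eq_add_neg] using h) (by
      simp only [map_div₀, map_sub, map_mul, M.σ_σ, hσr, map_ofNat]
      rw [mul_neg, div_neg, ← neg_div, neg_sub])
  refine ⟨c, b, ?_, ?_⟩
  · rw [← hc, ← hb]; field_simp; ring
  · rw [← hc, ← hb]; field_simp; ring

/-- The norm of a unit of a quadratic subfield is `±1`. -/
lemma norm_pm_one {v π : Vec} (hπ : dot π v = 1) {x : L} (hx : M.FixBy (stab v) x) (hu : IsU x) :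
    x * M.σ π x = 1 ∨ x * M.σ π x = -1 := by
  obtain ⟨c, b, h1, h2⟩ := M.exists_coords hπ hx
  have h3 : x * M.σ π x = ((c ^ 2 - b ^ 2 * disc p q v : ℚ) : L) := by
    rw [h2, h1]; push_cast; rw [← M.r_sq v]; ring
  have h4 := hu.mul (hu.map (M.σ π))
  rw [h3] at h4 ⊢
  rcases isU_rat h4 with h | h <;> rw [h] <;> simp

lemma unit_rat_pm_one {x : L} (hx : ∀ a, M.σ a x = x) (hu : IsU x) : x = 1 ∨ x = -1 := by
  obtain ⟨c, rfl⟩ := M.exists_rat x hx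
  rcases isU_rat hu with h | h <;> rw [h] <;> simp

/-- Conjugation of an integral element of a quadratic subfield has integral trace. -/
lemma trace_int {v π : Vec} (hπ : dot π v = 1) {x : L} (hx : M.FixBy (stab v) x)
    (hu : IsIntegral ℤ x) : ∃ t : ℤ, x + M.σ π x = t := by
  obtain ⟨c, b, h1, h2⟩ := M.exists_coords hπ hx
  have h3 : x + M.σ π x = ((2 * c : ℚ) : L) := by
    rw [h2, h1]; push_cast; ring
  have h4 := hu.add (map_isIntegral_int (M.σ π) hu)
  rw [h3] at h4 ⊢
  obtain ⟨n, hn⟩ := isIntegral_rat h4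
  exact ⟨n, by rw [hn]; simp⟩

/-- The units of the imaginary quadratic subfields are fourth roots of unity. -/
lemma imaginary_unit {v : Vec} (hv : v.1 = 1) {x : L} (hx : M.FixBy (stab v) x) (hu : IsU x)
    (hn : x * M.σ e₀ x = 1) : x ^ 2 = 1 ∨ x ^ 2 = -1 := by
  have hπ : dot e₀ v = 1 := by simp [dot, hv]
  obtain ⟨c, b, h1, h2⟩ := M.exists_coords hπ hx
  obtain ⟨t, ht⟩ := M.trace_int hπ hx hu.2.1
  have hD : disc p q v < 0 := by
    have := M.prime_p.pos
    have := M.prime_q.pos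
    unfold disc
    rw [hv, ZMod.val_one, pow_one, mul_assoc, mul_assoc, neg_one_mul, neg_lt_zero]
    positivity
  have htc : 2 * c = t := by
    have : ((2 * c : ℚ) : L) = ((t : ℚ) : L) := by
      push_cast; rw [← ht, h2, h1]; ring
    exact_mod_cast this
  have hcb : c ^ 2 - b ^ 2 * disc p q v = 1 := by
    have : ((c ^ 2 - b ^ 2 * disc p q v : ℚ) : L) = ((1 : ℚ) : L) := by
      push_cast; rw [← hn, ← M.r_sq v, h2, h1]; ring
    exact_mod_cast this
  have hDq : (disc p q v : ℚ) < 0 := by exact_mod_cast hD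
  -- The discriminant is negative, so norm 1 bounds the trace: t² = 4c² ≤ 4.
  have ht2 : t ^ 2 ≤ 4 := by
    have : (t : ℚ) ^ 2 ≤ 4 := by
      rw [← htc]; nlinarith [mul_nonneg (sq_nonneg b) (neg_pos.2 hDq).le]
    exact_mod_cast this
  have ht3 : t ≤ 2 := by nlinarith
  have ht4 : -2 ≤ t := by nlinarith
  have hb0 : c ^ 2 = 1 → x ^ 2 = 1 := by
    intro hc
    have hb : b = 0 := by
      have : b ^ 2 * (disc p q v : ℚ) = 0 := by linarith
      rcases mul_eq_zero.1 this with h | h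
      · exact pow_eq_zero_iff two_ne_zero |>.1 h
      · exact absurd h hDq.ne
    rw [h1, hb]
    have : ((c ^ 2 : ℚ) : L) = 1 := by rw [hc]; simp
    simpa using this
  -- Trace ±1 belongs to ℚ(√-3): it makes -3·disc a square, so 3 divides disc. But 3 is none of 2,
  -- p, q, by the congruences modulo 8.
  have hb1 : (t : ℚ) ^ 2 = 1 → False := by
    intro ht1
    have h3 : (2 * b * disc p q v) ^ 2 = ((-3 * disc p q v : ℤ) : ℚ) := by
      push_cast
      have : (2 * c) ^ 2 = 1 := by rw [htc]; exact ht1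
      linear_combination (-4 * disc p q v : ℚ) * hcb + (disc p q v : ℚ) * this
    obtain ⟨m, hm⟩ := rat_int_of_sq h3
    rw [hm] at h3
    have h4 : m ^ 2 = -3 * disc p q v := by exact_mod_cast h3
    have h5 : (3 : ℤ) ∣ m := Int.prime_three.dvd_of_dvd_pow ⟨-disc p q v, by rw [h4]; ring⟩
    obtain ⟨k, rfl⟩ := h5
    have h6 : ((3 : ℕ) : ℤ) ∣ disc p q v := ⟨-k ^ 2, by push_cast; linarith⟩
    have := M.p_mod
    have := M.q_mod
    rcases M.eq_of_prime_dvd_disc Nat.prime_three h6 with ⟨h, -⟩ | ⟨h, -⟩ | ⟨h, -⟩ <;> omega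
  interval_cases t
  · exact Or.inl (hb0 (by norm_num at htc; nlinarith))
  · exact absurd (by norm_num) hb1
  · right
    have : M.σ e₀ x = -x := by rw [eq_neg_iff_add_eq_zero, add_comm, ht]; simp
    rw [this] at hn
    linear_combination -hn
  · exact absurd (by norm_num) hb1
  · exact Or.inl (hb0 (by norm_num at htc; nlinarith))

end Frame
-- Fundamental units of the real quadratic subfields
namespace Frame

variable {L : Type*} [Field L] [CharZero L] {p q : ℕ} (M : Frame L p q)

lemma disc_pos (M : Frame L p q) {v : Vec} (hv : v.1 = 0) : 0 < disc p q v := by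
  have := M.prime_p.pos
  have := M.prime_q.pos
  unfold disc
  rw [hv, ZMod.val_zero, pow_zero, one_mul]
  positivity

/-- A square discriminant would make `r v` an integer, while some automorphism negates it. The
sixteen automorphisms of a frame thus encode the independence of the square roots. -/
lemma not_isSquare_disc (M : Frame L p q) {v : Vec} (hv0 : v ≠ 0) : ¬ IsSquare (disc p q v) := by
  rintro ⟨m, hm⟩
  obtain ⟨π, hπ⟩ := exists_dot_eq_one hv0
  have h1 : M.r v ^ 2 = (m : L) ^ 2 := by rw [M.r_sq, hm]; push_cast; ring
  have h2 := M.σ_r_one hπ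
  have h3 : M.σ π (M.r v) = M.r v := by
    rcases sq_eq_sq_iff_eq_or_eq_neg.1 h1 with h | h <;> rw [h] <;> simp
  rw [h3] at h2
  exact M.r_ne_zero v (self_eq_neg.1 h2)

lemma ι_real {v : Vec} (hv : v.1 = 0) (hv0 : v ≠ 0) {x : L} (hx : M.FixBy (stab v) x) :
    ∃ y : ℝ, M.ι x = y := by
  obtain ⟨π, hπ⟩ := exists_dot_eq_one hv0
  obtain ⟨c, b, h, -⟩ := M.exists_coords hπ hx
  exact ⟨c + b * √(disc p q v), by rw [h]; simp [M.ι_r v hv]⟩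

/-- Units greater than `1` of real quadratic fields are greater than `3/2`. -/
lemma three_half_lt {v : Vec} (hv : v.1 = 0) (hv0 : v ≠ 0) {x : L} (hx : M.FixBy (stab v) x)
    (hu : IsU x) {y : ℝ} (hy : M.ι x = y) (h1 : 1 < y) : 3 / 2 < y := by
  obtain ⟨π, hπ⟩ := exists_dot_eq_one hv0
  obtain ⟨t, ht⟩ := M.trace_int hπ hx hu.2.1
  obtain ⟨z, hz⟩ := M.ι_real hv hv0 (hx.σ π)
  have hyz : y + z = t := by
    have := congrArg M.ι ht
    rw [map_add, hy, hz, map_intCast] at this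
    exact_mod_cast this
  have hprod : y * z = 1 ∨ y * z = -1 := by
    rcases M.norm_pm_one hπ hx hu with h | h
    · left
      have := congrArg M.ι h
      rw [map_mul, hy, hz, map_one] at this
      exact_mod_cast this
    · right
      have := congrArg M.ι h
      rw [map_mul, hy, hz, map_neg, map_one] at this
      exact_mod_cast this
  -- The conjugate of y is ±1/y, so y + 1/y is an integer above 2, or y - 1/y is an integer above 0.
  -- For 1 < y ≤ 3/2 these numbers are below 3 and below 1 respectively.
  by_contra hlt
  push Not at hlt
  rcases hprod with h | h
  · have h2 : (2 : ℝ) < t := by rw [← hyz]; nlinarith [sq_nonneg (y - 1)]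
    have h3 : (3 : ℝ) ≤ t := by
      have : 2 < t := by exact_mod_cast h2
      exact_mod_cast this
    rw [← hyz] at h3
    nlinarith
  · have h2 : (0 : ℝ) < t := by rw [← hyz]; nlinarith
    have h3 : (1 : ℝ) ≤ t := by
      have : 0 < t := by exact_mod_cast h2
      exact_mod_cast this
    rw [← hyz] at h3
    nlinarith

/-- Logarithms of the positive units of a real quadratic subfield. -/
def logUnits (v : Vec) : AddSubgroup ℝ where
  carrier := {t | ∃ x : L, M.FixBy (stab v) x ∧ IsU x ∧ M.ι x = (Real.exp t : ℝ)}
  add_mem' := by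
    rintro s t ⟨x, h1, h2, h3⟩ ⟨y, h4, h5, h6⟩
    exact ⟨x * y, h1.mul h4, h2.mul h5, by rw [map_mul, h3, h6, Real.exp_add]; push_cast; rfl⟩
  zero_mem' := ⟨1, FixBy.one, IsU.one, by simp⟩
  neg_mem' := by
    rintro t ⟨x, h1, h2, h3⟩
    exact ⟨x⁻¹, h1.inv, h2.inv, by rw [map_inv₀, h3, Real.exp_neg]; push_cast; rfl⟩

/-- Existence of a fundamental unit. -/
theorem exists_fundamental {v : Vec} (hv : v.1 = 0) (hv0 : v ≠ 0) :
    ∃ g : L, M.FixBy (stab v) g ∧ IsU g ∧ (∃ y : ℝ, 1 < y ∧ M.ι g = y) ∧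
      ∀ x, M.FixBy (stab v) x → IsU x → ∃ n : ℤ, x = g ^ n ∨ x = -g ^ n := by
  have hlog : (0 : ℝ) < Real.log (3 / 2) := Real.log_pos (by norm_num)
  -- No logarithm of a unit lies strictly between 0 and log(3/2), so the group of logarithms is
  -- cyclic.
  obtain ⟨t, ht⟩ := AddSubgroup.cyclic_of_isolated_zero (H := M.logUnits v) hlog (by
    rw [Set.disjoint_left]
    rintro s ⟨x, h1, h2, h3⟩ ⟨h4, h5⟩
    have := M.three_half_lt hv hv0 h1 h2 h3 (Real.one_lt_exp_iff.2 h4)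
    have h6 := Real.exp_lt_exp.2 h5
    rw [Real.exp_log (by norm_num)] at h6
    linarith)
  have hgen : ∀ x, M.FixBy (stab v) x → IsU x → ∃ n : ℤ, ∃ s : ℝ, (s = 1 ∨ s = -1) ∧
      M.ι x = s * (Real.exp t : ℝ) ^ n := by
    intro x hx hu
    obtain ⟨y, hy⟩ := M.ι_real hv hv0 hx
    have hy0 : y ≠ 0 := by
      rintro rfl
      exact hu.1 ((map_eq_zero M.ι).1 (by simpa using hy))
    have key : ∀ z : L, ∀ w : ℝ, M.FixBy (stab v) z → IsU z → M.ι z = w → 0 < w →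
        ∃ n : ℤ, M.ι z = (Real.exp t : ℝ) ^ n := by
      intro z w hz hz' hzw hw
      have : Real.log w ∈ M.logUnits v := ⟨z, hz, hz', by rw [Real.exp_log hw, hzw]⟩
      rw [ht, AddSubgroup.mem_closure_singleton] at this
      obtain ⟨n, hn⟩ := this
      refine ⟨n, ?_⟩
      rw [hzw, ← Real.exp_log hw, ← hn, zsmul_eq_mul, mul_comm, Real.exp_mul, Real.rpow_intCast]
      push_cast; rfl
    rcases lt_or_gt_of_ne hy0 with h | h
    · obtain ⟨n, hn⟩ := key (-x) (-y) hx.neg hu.neg (by rw [map_neg, hy]; simp) (by linarith)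
      refine ⟨n, -1, Or.inr rfl, ?_⟩
      rw [map_neg] at hn
      push_cast
      push_cast at hn
      rw [neg_one_mul, ← hn, neg_neg]
    · obtain ⟨n, hn⟩ := key x y hx hu hy h
      exact ⟨n, 1, Or.inl rfl, by rw [hn]; simp⟩
  -- A zero generator would leave only ±1 as units, but Pell's equation has a solution with b ≠ 0.
  have ht0 : t ≠ 0 := by
    rintro rfl
    obtain ⟨a, b, hab, hb⟩ := Pell.exists_of_not_isSquare (M.disc_pos hv) (M.not_isSquare_disc hv0)
    have hint : ∀ e : ℤ, IsIntegral ℤ ((a : L) + e * b * M.r v) := fun e =>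
      (isIntegral_algebraMap (R := ℤ) (x := a)).add
        (((isIntegral_algebraMap (R := ℤ) (x := e)).mul
          (isIntegral_algebraMap (R := ℤ) (x := b))).mul (M.isIntegral_r v))
    have hm : ((a : L) + (1 : ℤ) * b * M.r v) * ((a : L) + (-1 : ℤ) * b * M.r v) = 1 := by
      have h2 : ((a : L) ^ 2 - disc p q v * b ^ 2) = 1 := by exact_mod_cast hab
      rw [← M.r_sq v] at h2
      push_cast
      linear_combination h2
    have hu : IsU ((a : L) + (1 : ℤ) * b * M.r v) :=
      ⟨left_ne_zero_of_mul_eq_one hm, hint 1, by rw [inv_eq_of_mul_eq_one_right hm]; exact hint _⟩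
    have hf : M.FixBy (stab v) ((a : L) + (1 : ℤ) * b * M.r v) :=
      (M.fixBy_int _ _).add (((M.fixBy_int _ _).mul (M.fixBy_int _ _)).mul (M.fixBy_r v))
    obtain ⟨n, s, hs, h⟩ := hgen _ hf hu
    have h1 : (a : L) + (1 : ℤ) * b * M.r v = 1 ∨ (a : L) + (1 : ℤ) * b * M.r v = -1 := by
      rcases hs with rfl | rfl
      · left; apply M.ι.injective; rw [h]; simp
      · right; apply M.ι.injective; rw [h]; simp
    obtain ⟨π, hπ⟩ := exists_dot_eq_one hv0
    have h2 : M.σ π ((a : L) + (1 : ℤ) * b * M.r v) = (a : L) + (1 : ℤ) * b * M.r v := by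
      rcases h1 with h | h <;> rw [h] <;> simp
    simp only [map_add, map_mul, map_intCast, M.σ_r_one hπ] at h2
    have h3 : (b : L) * M.r v = 0 := by
      have : (2 : L) ≠ 0 := two_ne_zero
      apply mul_left_cancel₀ this
      push_cast at h2
      linear_combination -h2
    rcases mul_eq_zero.1 h3 with h | h
    · exact hb (by exact_mod_cast h)
    · exact M.r_ne_zero v h
  -- normalise the sign of the generator
  have hfin : ∀ t : ℝ, 0 < t → M.logUnits v = AddSubgroup.closure {t} →
      (∀ x, M.FixBy (stab v) x → IsU x → ∃ n : ℤ, ∃ s : ℝ, (s = 1 ∨ s = -1) ∧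
      M.ι x = s * (Real.exp t : ℝ) ^ n) → ∃ g : L, M.FixBy (stab v) g ∧ IsU g ∧
      (∃ y : ℝ, 1 < y ∧ M.ι g = y) ∧
      ∀ x, M.FixBy (stab v) x → IsU x → ∃ n : ℤ, x = g ^ n ∨ x = -g ^ n := by
    intro t ht0 ht hgen
    have : t ∈ M.logUnits v := by rw [ht]; exact AddSubgroup.mem_closure_of_mem rfl
    obtain ⟨g, h1, h2, h3⟩ := this
    refine ⟨g, h1, h2, ⟨_, Real.one_lt_exp_iff.2 ht0, h3⟩, fun x hx hu => ?_⟩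
    obtain ⟨n, s, hs, h⟩ := hgen x hx hu
    refine ⟨n, ?_⟩
    rw [← h3] at h
    rcases hs with rfl | rfl
    · left; apply M.ι.injective; rw [h]; simp
    · right; apply M.ι.injective; rw [h]; simp
  rcases lt_or_gt_of_ne ht0 with h | h
  · refine hfin (-t) (by linarith) ?_ fun x hx hu => ?_
    · rw [ht, ← AddSubgroup.zmultiples_eq_closure, ← AddSubgroup.zmultiples_eq_closure,
        AddSubgroup.zmultiples_neg]
    · obtain ⟨n, s, hs, h⟩ := hgen x hx hu
      refine ⟨-n, s, hs, ?_⟩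
      rw [h, Real.exp_neg]
      simp
  · exact hfin t h ht hgen

end Frame

/-! ### Unramified primes, through divisibility of squares -/

/-- `x ^ 2` is divisible by `l`. -/
def SqDvd {L : Type*} [Field L] (l : ℕ) (x : L) : Prop :=
  IsIntegral ℤ x ∧ IsIntegral ℤ (x ^ 2 / l)

/-- `x` is divisible by `l`, up to a factor prime to `l`. -/
def AlmostDvd {L : Type*} [Field L] (l : ℕ) (x : L) : Prop :=
  ∃ m : ℕ, m.Coprime l ∧ IsIntegral ℤ (m * x / l)

section Divisibility

variable {L : Type*} [Field L] {l : ℕ} {x y : L}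

lemma isIntegral_natCast (n : ℕ) : IsIntegral ℤ (n : L) := by
  simpa using isIntegral_algebraMap (R := ℤ) (A := L) (x := (n : ℤ))

lemma isIntegral_intCast (n : ℤ) : IsIntegral ℤ (n : L) :=
  isIntegral_algebraMap (R := ℤ) (A := L) (x := n)

lemma SqDvd.mul_integral (hx : SqDvd l x) (hy : IsIntegral ℤ y) : SqDvd l (x * y) := by
  refine ⟨hx.1.mul hy, ?_⟩
  have : (x * y) ^ 2 / l = x ^ 2 / l * y ^ 2 := by ring
  rw [this]
  exact hx.2.mul (hy.pow 2)

/-- The cross term xy/l is integral because its square is (x²/l)(y²/l). -/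
lemma SqDvd.add (hx : SqDvd l x) (hy : SqDvd l y) : SqDvd l (x + y) := by
  refine ⟨hx.1.add hy.1, ?_⟩
  have h : IsIntegral ℤ (x * y / l) := by
    apply IsIntegral.of_pow two_pos
    have : (x * y / l) ^ 2 = x ^ 2 / l * (y ^ 2 / l) := by ring
    rw [this]
    exact hx.2.mul hy.2
  have : (x + y) ^ 2 / l = x ^ 2 / l + (x * y / l + x * y / l) + y ^ 2 / l := by ring
  rw [this]
  exact (hx.2.add (h.add h)).add hy.2

lemma SqDvd.map (hx : SqDvd l x) (f : L ≃+* L) : SqDvd l (f x) := by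
  refine ⟨map_isIntegral_int f hx.1, ?_⟩
  have := map_isIntegral_int f hx.2
  simpa using this

lemma AlmostDvd.add (hx : AlmostDvd l x) (hy : AlmostDvd l y) : AlmostDvd l (x + y) := by
  obtain ⟨m, hm, h⟩ := hx
  obtain ⟨n, hn, h'⟩ := hy
  refine ⟨m * n, hm.mul_left hn, ?_⟩
  have : ((m * n : ℕ) : L) * (x + y) / l = n * (m * x / l) + m * (n * y / l) := by
    push_cast; ring
  rw [this]
  exact ((isIntegral_natCast n).mul h).add ((isIntegral_natCast m).mul h')

lemma AlmostDvd.mul_integral (hx : AlmostDvd l x) (hy : IsIntegral ℤ y) :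
    AlmostDvd l (x * y) := by
  obtain ⟨m, hm, h⟩ := hx
  refine ⟨m, hm, ?_⟩
  have : (m : L) * (x * y) / l = m * x / l * y := by ring
  rw [this]
  exact h.mul hy

lemma AlmostDvd.of_int_mul {D : ℤ} (hD : IsCoprime D l) (hx : AlmostDvd l (D * x)) :
    AlmostDvd l x := by
  obtain ⟨m, hm, h⟩ := hx
  refine ⟨m * D.natAbs, hm.mul_left ?_, ?_⟩
  · have := Int.isCoprime_iff_gcd_eq_one.1 hD
    simpa [Int.gcd] using this
  · have h2 := h.mul (isIntegral_intCast (L := L) D.sign)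
    have : (((m * D.natAbs : ℕ) : L)) = m * ((D.sign : ℤ) * (D : L)) := by
      have h3 : ((D.natAbs : ℤ)) = D.sign * D := by
        rw [Int.sign_mul_self_eq_natAbs]
      push_cast
      congr 1
      have h4 : ((D.natAbs : ℤ) : L) = ((D.sign * D : ℤ) : L) := by rw [h3]
      rwa [Int.cast_mul, Int.cast_natCast] at h4
    rw [this]
    have h5 : (m : L) * ((D.sign : ℤ) * (D : L)) * x / l = m * (D * x) / l * (D.sign : ℤ) := by
      ring
    rw [h5]
    exact h2

end Divisibility

namespace Frame

variable {L : Type*} [Field L] [CharZero L] {p q : ℕ} (M : Frame L p q)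

/-- The prime `l` is unramified in the fixed field of `S`, in the form needed here: the ring of
integers of that field is reduced modulo `l`, up to elements prime to `l`. -/
def Unram (S : Set Vec) (l : ℕ) : Prop := ∀ x, M.FixBy S x → SqDvd l x → AlmostDvd l x

lemma unram_of_rat {S : Set Vec} {l : ℕ} (hl : l.Prime)
    (hS : ∀ x, M.FixBy S x → ∃ c : ℚ, x = c) : M.Unram S l := by
  rintro x hx ⟨h1, h2⟩
  obtain ⟨c, rfl⟩ := hS x hx
  obtain ⟨n, rfl⟩ := isIntegral_rat h1
  have hl0 : (l : ℚ) ≠ 0 := by exact_mod_cast hl.ne_zero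
  have h3 : IsIntegral ℤ ((((n : ℚ) ^ 2 / l : ℚ)) : L) := by push_cast; simpa using h2
  obtain ⟨k, hk⟩ := isIntegral_rat h3
  have h4 : n ^ 2 = k * l := by
    rw [div_eq_iff hl0] at hk
    exact_mod_cast hk
  obtain ⟨j, rfl⟩ := (Nat.prime_iff_prime_int.1 hl).dvd_of_dvd_pow (a := n) ⟨k, by rw [h4]; ring⟩
  refine ⟨1, Nat.coprime_one_left l, ?_⟩
  have hl0' : (l : L) ≠ 0 := by exact_mod_cast hl.ne_zero
  have : ((1 : ℕ) : L) * (((((l : ℤ) * j : ℤ) : ℚ)) : L) / l = j := by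
    push_cast; field_simp
  rw [this]
  exact isIntegral_intCast j

/-- Trace argument. The traces of x and of xA lie in the smaller field and are almost divisible by
l. Since (xA + σ(xA)) - (x + σx)σA = x(A - σA), one more factor A - σA yields Dx, and D is prime to
l. -/
lemma unram_step {S : Set Vec} {l : ℕ} {b : Vec} (h : M.Unram (insert b S) l) {A : L}
    (hA : IsIntegral ℤ A) (hAS : M.FixBy S A) {D : ℤ} (hD : (A - M.σ b A) ^ 2 = D)
    (hDl : IsCoprime D l) : M.Unram S l := by
  intro x hx hr
  have trace_good : ∀ y, M.FixBy S y → SqDvd l y → AlmostDvd l (y + M.σ b y) := by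
    intro y hy hy'
    refine h _ ?_ (hy'.add (hy'.map _))
    intro a ha
    rcases ha with rfl | ha
    · rw [map_add, M.σ_σ, add_comm]
    · exact (hy.add (hy.σ b)) a ha
  have h1 := trace_good x hx hr
  have h2 := trace_good (x * A) (hx.mul hAS) (hr.mul_integral hA)
  have hσA : IsIntegral ℤ (M.σ b A) := map_isIntegral_int (M.σ b) hA
  have h3 := (h2.add (h1.mul_integral hσA.neg)).mul_integral (hA.sub hσA)
  apply AlmostDvd.of_int_mul hDl
  convert h3 using 1
  rw [← hD, map_mul]; ring

lemma eq_rat_of_insert_stab {v π : Vec} (hπ : dot π v = 1) {x : L}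
    (hx : M.FixBy (insert π (stab v)) x) : ∃ c : ℚ, x = c := by
  obtain ⟨c, b, h1, h2⟩ := M.exists_coords hπ (hx.mono (Set.subset_insert _ _))
  rw [hx π (Set.mem_insert _ _), h1] at h2
  refine ⟨c, ?_⟩
  have : (b : L) * M.r v = 0 := by
    apply mul_left_cancel₀ (two_ne_zero (α := L))
    linear_combination h2
  rw [h1, this, add_zero]

lemma isIntegral_half {v : Vec} {k : ℤ} (hk : disc p q v = 4 * k + 1) :
    IsIntegral ℤ ((1 + M.r v) / 2) := by
  refine ⟨Polynomial.X ^ 2 - Polynomial.X - Polynomial.C k, ?_, ?_⟩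
  · rw [sub_sub]
    refine Polynomial.monic_X_pow_sub ?_
    compute_degree!
  · have := M.r_sq v
    rw [hk] at this
    push_cast at this
    simp only [Polynomial.eval₂_sub, Polynomial.eval₂_pow, Polynomial.eval₂_X, Polynomial.eval₂_C]
    rw [eq_intCast]
    linear_combination this / 4

lemma half_sub {v b : Vec} (hb : dot b v = 1) :
    ((1 + M.r v) / 2 - M.σ b ((1 + M.r v) / 2)) ^ 2 = (disc p q v : L) := by
  rw [map_div₀, map_add, map_one, map_ofNat, M.σ_r_one hb, ← M.r_sq]; ring

lemma r_sub {v b : Vec} (hb : dot b v = 1) :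
    (M.r v - M.σ b (M.r v)) ^ 2 = ((4 * disc p q v : ℤ) : L) := by
  rw [M.σ_r_one hb]; push_cast; rw [← M.r_sq]; ring

lemma isCoprime_prime {l : ℕ} (hl : l.Prime) {D : ℤ} (h : ¬ (l : ℤ) ∣ D) : IsCoprime D l :=
  ((Nat.prime_iff_prime_int.1 hl).coprime_iff_not_dvd.2 h).symm

lemma not_dvd_four_mul {l : ℕ} (hl : l.Prime) (hl2 : l ≠ 2) {D : ℤ} (h : ¬ (l : ℤ) ∣ D) :
    ¬ (l : ℤ) ∣ 4 * D := by
  intro hd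
  rcases (Nat.prime_iff_prime_int.1 hl).dvd_mul.1 hd with h' | h'
  · have : (l : ℤ) ∣ 2 ^ 2 := by simpa using h'
    have := (Nat.prime_iff_prime_int.1 hl).dvd_of_dvd_pow this
    exact hl2 ((Nat.prime_dvd_prime_iff_eq hl Nat.prime_two).1 (by exact_mod_cast this))
  · exact h h'

/-- Odd primes not dividing `disc v` are unramified in `ℚ(r v)`. -/
lemma unram_stab {v : Vec} (hv0 : v ≠ 0) {l : ℕ} (hl : l.Prime) (hl2 : l ≠ 2)
    (hd : ¬ (l : ℤ) ∣ disc p q v) : M.Unram (stab v) l := by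
  obtain ⟨π, hπ⟩ := exists_dot_eq_one hv0
  exact M.unram_step (b := π) (M.unram_of_rat hl fun x hx => M.eq_rat_of_insert_stab hπ hx)
    (M.isIntegral_r v) (M.fixBy_r v) (M.r_sub hπ) (isCoprime_prime hl (not_dvd_four_mul hl hl2 hd))

/-- `2` is unramified in `ℚ(r v)` if `disc v` is `1` modulo `4`. -/
lemma unram_stab_two {v : Vec} (hv0 : v ≠ 0) {k : ℤ} (hk : disc p q v = 4 * k + 1) :
    M.Unram (stab v) 2 := by
  obtain ⟨π, hπ⟩ := exists_dot_eq_one hv0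
  refine M.unram_step (b := π)
    (M.unram_of_rat Nat.prime_two fun x hx => M.eq_rat_of_insert_stab hπ hx)
    (M.isIntegral_half hk) ?_ (M.half_sub hπ) (isCoprime_prime Nat.prime_two (by omega))
  intro a ha
  rw [map_div₀, map_add, map_one, map_ofNat, M.fixBy_r v a ha]

lemma fixBy_all {x : L} (h0 : M.σ e₀ x = x) (h1 : M.σ e₁ x = x) (h2 : M.σ e₂ x = x)
    (h3 : M.σ e₃ x = x) (a : Vec) : M.σ a x = x := by
  have key : ∀ b c, M.σ b x = x → M.σ c x = x → M.σ (b + c) x = x := fun b c hb hc => by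
    rw [M.σ_add, hc, hb]
  have hs : ∀ a : Vec, ∃ b c d e : Vec, (b = 0 ∨ b = e₀) ∧ (c = 0 ∨ c = e₁) ∧ (d = 0 ∨ d = e₂) ∧
      (e = 0 ∨ e = e₃) ∧ a = b + (c + (d + e)) := by
    rintro ⟨a, b, c, d⟩
    refine ⟨(a, 0, 0, 0), (0, b, 0, 0), (0, 0, c, 0), (0, 0, 0, d), ?_, ?_, ?_, ?_, by simp⟩
    · rcases zmod_two_cases a with rfl | rfl <;> decide
    · rcases zmod_two_cases b with rfl | rfl <;> decide
    · rcases zmod_two_cases c with rfl | rfl <;> decide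
    · rcases zmod_two_cases d with rfl | rfl <;> decide
  have hz := M.σ_zero x
  obtain ⟨b, c, d, e, hb, hc, hd, he, rfl⟩ := hs a
  refine key _ _ ?_ (key _ _ ?_ (key _ _ ?_ ?_))
  · rcases hb with rfl | rfl <;> assumption
  · rcases hc with rfl | rfl <;> assumption
  · rcases hd with rfl | rfl <;> assumption
  · rcases he with rfl | rfl <;> assumption

lemma disc_e₂ : disc p q e₂ = p := by simp [disc, ZMod.val_one]
lemma disc_e₃ : disc p q e₃ = q := by simp [disc, ZMod.val_one]
lemma disc_e₁ : disc p q e₁ = 2 := by simp [disc, ZMod.val_one]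

/-- `2` is unramified in `ℚ(√p, √q)`. -/
lemma unram_biquadratic : M.Unram {e₁, e₀} 2 := by
  have hp := M.p_mod
  have hq := M.q_mod
  have kp : disc p q e₂ = 4 * ((p / 4 : ℕ) : ℤ) + 1 := by rw [disc_e₂]; omega
  have kq : disc p q e₃ = 4 * ((q / 4 : ℕ) : ℤ) + 1 := by rw [disc_e₃]; omega
  have hfix : ∀ v a : Vec, dot a v = 0 → M.σ a ((1 + M.r v) / 2) = (1 + M.r v) / 2 := by
    intro v a ha
    rw [map_div₀, map_add, map_one, map_ofNat, M.σ_r_zero ha]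
  -- The generators (1 + √p)/2 and (1 + √q)/2 differ from their conjugates by √p and √q, whose
  -- squares are odd; √p and √q themselves would give the even numbers 4p and 4q.
  refine M.unram_step (b := e₂) ?_ (M.isIntegral_half kp) ?_ (M.half_sub (by decide))
    (isCoprime_prime Nat.prime_two (by omega))
  · refine M.unram_step (b := e₃) ?_ (M.isIntegral_half kq) ?_ (M.half_sub (by decide))
      (isCoprime_prime Nat.prime_two (by omega))
    · refine M.unram_of_rat Nat.prime_two fun x hx => M.exists_rat x ?_
      exact M.fixBy_all (hx _ (by simp)) (hx _ (by simp)) (hx _ (by simp)) (hx _ (by simp))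
    · rintro a (rfl | rfl | rfl) <;> exact hfix _ _ (by decide)
  · rintro a (rfl | rfl) <;> exact hfix _ _ (by decide)

/-- Primes other than `2`, `p`, `q` are unramified. -/
lemma unram_empty {l : ℕ} (hl : l.Prime) (hl2 : l ≠ 2) (hlp : l ≠ p) (hlq : l ≠ q) :
    M.Unram ∅ l := by
  have hc : ∀ v : Vec, IsCoprime (4 * disc p q v) l := fun v => by
    refine isCoprime_prime hl (not_dvd_four_mul hl hl2 fun h => ?_)
    rcases M.eq_of_prime_dvd_disc hl h with h | h | h
    · exact hl2 h.1
    · exact hlp h.1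
    · exact hlq h.1
  refine M.unram_step (b := e₀) ?_ (M.isIntegral_r e₀) ?_ (M.r_sub (by decide)) (hc _)
  · refine M.unram_step (b := e₁) ?_ (M.isIntegral_r e₁) ?_ (M.r_sub (by decide)) (hc _)
    · refine M.unram_step (b := e₂) ?_ (M.isIntegral_r e₂) ?_ (M.r_sub (by decide)) (hc _)
      · refine M.unram_step (b := e₃) ?_ (M.isIntegral_r e₃) ?_ (M.r_sub (by decide)) (hc _)
        · refine M.unram_of_rat hl fun x hx => M.exists_rat x ?_
          exact M.fixBy_all (hx _ (by simp)) (hx _ (by simp)) (hx _ (by simp)) (hx _ (by simp))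
        · rintro a (rfl | rfl | rfl | h) <;> first | exact M.σ_r_zero (by decide) | exact h.elim
      · rintro a (rfl | rfl | h) <;> first | exact M.σ_r_zero (by decide) | exact h.elim
    · rintro a (rfl | h) <;> first | exact M.σ_r_zero (by decide) | exact h.elim
  · rintro a h; exact h.elim

/-- If a unit is a rational number times a square, then the rational number can be taken to be a
squarefree integer all of whose prime factors ramify. -/
lemma exists_squarefree {S : Set Vec} {α β : L} {t : ℚ} (hα : IsU α) (hβ : M.FixBy S β)
    (h : α = t * β ^ 2) : ∃ n : ℤ, Squarefree n ∧ ∃ γ : L, M.FixBy S γ ∧ α = n * γ ^ 2 ∧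
      ∀ l : ℕ, l.Prime → M.Unram S l → ¬ (l : ℤ) ∣ n := by
  have ht0 : t ≠ 0 := by rintro rfl; exact hα.1 (by rw [h]; simp)
  -- As t = num·den/den², the signed squarefree part of num·den represents t modulo squares.
  obtain ⟨n, s, hn, hs, hts⟩ : ∃ (n : ℤ) (s : ℚ), Squarefree n ∧ s ≠ 0 ∧ t = n * s ^ 2 := by
    obtain ⟨a, b, hab, ha⟩ := Nat.sq_mul_squarefree (t.num * t.den).natAbs
    have hden : (t.den : ℚ) ≠ 0 := by exact_mod_cast t.den_nz
    have hb : (b : ℚ) ≠ 0 := by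
      rintro hb
      have hb : b = 0 := by exact_mod_cast hb
      rw [hb, zero_pow two_ne_zero, zero_mul] at hab
      have := Int.natAbs_eq_zero.1 hab.symm
      rcases mul_eq_zero.1 this with h | h
      · exact ht0 (Rat.num_eq_zero.1 h)
      · exact t.den_nz (by exact_mod_cast h)
    have key : ∃ e : ℤ, (e = 1 ∨ e = -1) ∧ t.num * t.den = e * (b ^ 2 * a) := by
      rcases Int.natAbs_eq (t.num * t.den) with h | h
      · exact ⟨1, Or.inl rfl, by rw [h, ← hab]; push_cast; ring⟩
      · exact ⟨-1, Or.inr rfl, by rw [h, ← hab]; push_cast; ring⟩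
    obtain ⟨e, he, hk⟩ := key
    refine ⟨e * a, b / t.den, ?_, div_ne_zero hb hden, ?_⟩
    · rw [← Int.squarefree_natAbs]
      rcases he with rfl | rfl <;> simpa using ha
    · have hk' : (t.num : ℚ) * t.den = e * (b ^ 2 * a) := by exact_mod_cast hk
      have : t = t.num / t.den := (Rat.num_div_den t).symm
      push_cast
      field_simp
      have h2 : t * t.den = t.num := Rat.mul_den_eq_num t
      rw [← h2] at hk'
      linear_combination hk'
  have hγ : M.FixBy S ((s : L) * β) := (FixBy.rat s).mul hβ
  have hαn : α = n * ((s : L) * β) ^ 2 := by rw [h, hts]; push_cast; ring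
  refine ⟨n, hn, (s : L) * β, hγ, hαn, fun l hl hU hd => ?_⟩
  set γ : L := (s : L) * β with hγdef
  have hl0 : (l : L) ≠ 0 := by exact_mod_cast hl.ne_zero
  obtain ⟨k, hk⟩ := hd
  -- If l divides n, then (nγ)² = nα is divisible by l, so mnγ/l is integral for some m prime to l.
  -- Its square divided by the unit α is the rational number m²n/l², so l² divides n, which is
  -- squarefree.
  have hsq : ((n : L) * γ) ^ 2 = n * α := by rw [hαn]; ring
  have hI : IsIntegral ℤ ((n : L) * γ) := by
    apply IsIntegral.of_pow two_pos
    rw [hsq]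
    exact (isIntegral_intCast n).mul hα.2.1
  have hdvd : SqDvd l ((n : L) * γ) := by
    refine ⟨hI, ?_⟩
    have : ((n : L) * γ) ^ 2 / l = k * α := by
      rw [hsq, hk]; push_cast; field_simp
    rw [this]
    exact (isIntegral_intCast k).mul hα.2.1
  obtain ⟨m, hm, hmi⟩ := hU _ ((M.fixBy_int S n).mul hγ) hdvd
  have h3 := (hmi.pow 2).mul hα.2.2
  have h4 : ((m : L) * (n * γ) / l) ^ 2 * α⁻¹ = (((m : ℚ) ^ 2 * n / l ^ 2 : ℚ) : L) := by
    rw [div_pow, mul_pow, hsq]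
    have := hα.1
    push_cast
    field_simp
  rw [h4] at h3
  obtain ⟨j, hj⟩ := isIntegral_rat h3
  have hl0' : (l : ℚ) ≠ 0 := by exact_mod_cast hl.ne_zero
  rw [div_eq_iff (pow_ne_zero 2 hl0')] at hj
  have hj' : (m : ℤ) ^ 2 * n = j * (l : ℤ) ^ 2 := by exact_mod_cast hj
  have hcop : IsCoprime ((l : ℤ) ^ 2) ((m : ℤ) ^ 2) := by
    apply IsCoprime.pow
    exact (Nat.isCoprime_iff_coprime.2 hm).symm
  have : (l : ℤ) ^ 2 ∣ n := hcop.dvd_of_dvd_mul_left ⟨j, by rw [hj']; ring⟩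
  have := hn _ (by rw [← sq]; exact this)
  exact (Nat.prime_iff_prime_int.1 hl).not_isUnit this

end Frame
-- Roots of unity: every unit is an eighth root of unity times a real unit
namespace Frame

variable {L : Type*} [Field L] [CharZero L] {p q : ℕ} (M : Frame L p q)

lemma σ_prod_eq (A : Finset Vec) (c : Vec) (hc : ∀ a ∈ A, c + a ∈ A) (x : L) :
    M.σ c (∏ a ∈ A, M.σ a x) = ∏ a ∈ A, M.σ a x := by
  rw [map_prod]
  have hcc : ∀ a : Vec, c + (c + a) = a := fun a => by rw [← add_assoc, vec_add_self, zero_add]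
  refine Finset.prod_nbij' (c + ·) (c + ·) hc hc (fun a _ => hcc a) (fun a _ => hcc a) ?_
  intro a _
  rw [M.σ_add]

/-- Interchange of products behind all the norm relations: the exponent of f a counts the v in T
orthogonal to a. -/
lemma prod_prod_filter {α : Type*} [CommMonoid α] (T A : Finset Vec) (f : Vec → α) :
    ∏ v ∈ T, ∏ a ∈ A.filter (fun a => dot a v = 0), f a =
      ∏ a ∈ A, f a ^ (T.filter (fun v => dot a v = 0)).card := by
  simp_rw [Finset.prod_filter]
  rw [Finset.prod_comm]
  refine Finset.prod_congr rfl fun a _ => ?_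
  rw [← Finset.prod_filter, Finset.prod_const]

/-- The norm to `ℚ(r v)`. -/
noncomputable def quadNorm (v : Vec) (x : L) : L :=
  ∏ a ∈ Finset.univ.filter (fun a => dot a v = 0), M.σ a x

lemma quadNorm_fixBy (v : Vec) (x : L) : M.FixBy (stab v) (M.quadNorm v x) := by
  intro c hc
  refine M.σ_prod_eq _ c (fun a ha => ?_) x
  have hc' : dot c v = 0 := hc
  simp only [Finset.mem_filter, Finset.mem_univ, true_and] at ha ⊢
  rw [dot_add_left, ha, hc', add_zero]

lemma isU_quadNorm (v : Vec) {x : L} (hx : IsU x) : IsU (M.quadNorm v x) :=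
  IsU.prod _ _ fun a _ => hx.map (M.σ a)

/-- The identity lies in all 15 = 8 + 7 stabilizers, every other automorphism in exactly 7 of them.
-/
lemma prod_quadNorm (x : L) :
    ∏ v ∈ Finset.univ.filter (fun v : Vec => v ≠ 0), M.quadNorm v x =
      x ^ 8 * (∏ a : Vec, M.σ a x) ^ 7 := by
  unfold quadNorm
  rw [prod_prod_filter]
  have hc : ∀ a : Vec, ((Finset.univ.filter (fun v : Vec => v ≠ 0)).filter
      (fun v => dot a v = 0)).card = (if a = 0 then 8 else 0) + 7 := by decide
  simp_rw [hc, pow_add]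
  rw [Finset.prod_mul_distrib, Finset.prod_pow]
  congr 1
  rw [Finset.prod_eq_single 0]
  · simp [M.σ_zero]
  · intro b _ hb; simp [hb]
  · simp

/-- A primitive eighth root of unity. -/
noncomputable def ζ : L := (1 + M.r e₀) * M.r e₁ / 2

lemma ζ_sq : M.ζ ^ 2 = M.r e₀ := by
  unfold ζ
  have h1 := M.r_e₁_sq
  have h2 := M.r_e₀_sq
  rw [div_pow, mul_pow, h1]
  linear_combination (1 / 2 : L) * h2

lemma σ_ζ : M.σ e₀ M.ζ = M.ζ⁻¹ := by
  apply eq_inv_of_mul_eq_one_left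
  unfold ζ
  have h1 := M.r_e₁_sq
  have h2 := M.r_e₀_sq
  rw [map_div₀, map_mul, map_add, map_one, map_ofNat, M.σ_r_one (a := e₀) (v := e₀) (by decide),
    M.σ_r_zero (a := e₀) (v := e₁) (by decide)]
  linear_combination (1 / 4 : L) * (1 - M.r e₀ ^ 2) * h1 - (1 / 2 : L) * h2

lemma ζ_pow_four : M.ζ ^ 4 = -1 := by
  rw [show 4 = 2 * 2 by norm_num, pow_mul, M.ζ_sq, M.r_e₀_sq]

lemma ζ_pow_eight : M.ζ ^ 8 = 1 := by
  rw [show 8 = 4 * 2 by norm_num, pow_mul, M.ζ_pow_four]; norm_num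

lemma ζ_ne_zero : M.ζ ≠ 0 := by
  intro h
  have := M.ζ_pow_eight
  rw [h] at this
  norm_num at this

lemma isU_ζ : IsU M.ζ := IsU.of_sq (by rw [M.ζ_sq]; exact M.isU_i)

lemma ζ_add_inv : M.ζ + M.ζ⁻¹ = M.r e₁ := by
  rw [← M.σ_ζ]
  unfold ζ
  rw [map_div₀, map_mul, map_add, map_one, map_ofNat, M.σ_r_one (a := e₀) (v := e₀) (by decide),
    M.σ_r_zero (a := e₀) (v := e₁) (by decide)]
  ring

lemma isPrimitiveRoot_ζ : IsPrimitiveRoot M.ζ 8 := by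
  rw [IsPrimitiveRoot.iff_orderOf]
  have := orderOf_eq_prime_pow (p := 2) (n := 2) (x := M.ζ) (by
    norm_num
    rw [M.ζ_pow_four]
    intro h
    have : (2 : L) = 0 := by linear_combination -h
    exact two_ne_zero this) (by norm_num; exact M.ζ_pow_eight)
  simpa using this

/-- There is no primitive sixteenth root of unity. -/
lemma pow_eight_ne_neg_one (M : Frame L p q) (x : L) : x ^ 8 ≠ -1 := by
  intro h
  have hx : x ≠ 0 := by rintro rfl; norm_num at h
  -- For a primitive sixteenth root of unity x, β = x + x⁻¹ satisfies β² = 2 ± √2. Then β·σβ has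
  -- square (2 + √2)(2 - √2) = 2, so it is ±√2; yet it is fixed by σ e₁, which negates √2.
  have h1 : (x ^ 2 + (x ^ 2)⁻¹) ^ 2 = M.r e₁ ^ 2 := by
    rw [M.r_e₁_sq]
    field_simp
    linear_combination h
  set β := x + x⁻¹ with hβ
  have h2 : β ^ 2 = 2 + (x ^ 2 + (x ^ 2)⁻¹) := by
    rw [hβ]; field_simp; ring
  have hσ : M.σ e₁ (M.r e₁) = -M.r e₁ := M.σ_r_one (by decide)
  have h3 : (β * M.σ e₁ β) ^ 2 = M.r e₁ ^ 2 := by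
    rw [mul_pow, ← map_pow, h2]
    have h4 := M.r_e₁_sq
    rcases sq_eq_sq_iff_eq_or_eq_neg.1 h1 with h | h <;> rw [h]
    · rw [map_add, map_ofNat, hσ]; linear_combination -2 * h4
    · rw [map_add, map_ofNat, map_neg, hσ]; linear_combination -2 * h4
  have h5 : M.σ e₁ (β * M.σ e₁ β) = β * M.σ e₁ β := by
    rw [map_mul, M.σ_σ, mul_comm]
  have h6 := M.r_ne_zero e₁
  rcases sq_eq_sq_iff_eq_or_eq_neg.1 h3 with h | h
  · rw [h, hσ] at h5
    exact h6 (self_eq_neg.1 h5.symm)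
  · rw [h, map_neg, hσ, neg_neg] at h5
    exact h6 (self_eq_neg.1 h5)

lemma pow_eight_eq_one (M : Frame L p q) {x : L} (h : x ^ 32 = 1) : x ^ 8 = 1 := by
  have h1 : (x ^ 16) ^ 2 = 1 ^ 2 := by rw [← pow_mul, h, one_pow]
  rcases sq_eq_sq_iff_eq_or_eq_neg.1 h1 with h2 | h2
  · have h3 : (x ^ 8) ^ 2 = 1 ^ 2 := by rw [← pow_mul, h2, one_pow]
    rcases sq_eq_sq_iff_eq_or_eq_neg.1 h3 with h4 | h4
    · exact h4
    · exact absurd h4 (M.pow_eight_ne_neg_one x)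
  · have : (x ^ 2) ^ 8 = -1 := by rw [← pow_mul, h2]
    exact absurd this (M.pow_eight_ne_neg_one _)

lemma norm_unit {x : L} (hx : IsU x) : (∏ a : Vec, M.σ a x) = 1 ∨ (∏ a : Vec, M.σ a x) = -1 :=
  M.unit_rat_pm_one (fun c => M.σ_prod_eq _ c (fun _ _ => Finset.mem_univ _) x)
    (IsU.prod _ _ fun a _ => hx.map (M.σ a))

/-- The quotient of a unit by its complex conjugate is an eighth root of unity. -/
lemma div_conj_pow_eight {u : L} (hu : IsU u) : (u * (M.σ e₀ u)⁻¹) ^ 8 = 1 := by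
  set z := u * (M.σ e₀ u)⁻¹ with hz
  have hzU : IsU z := hu.mul (hu.map (M.σ e₀)).inv
  have hzc : z * M.σ e₀ z = 1 := by
    have := hu.1
    have := (hu.map (M.σ e₀)).1
    rw [hz, map_mul, map_inv₀, M.σ_σ]; field_simp
  -- A quadratic norm of z times its complex conjugate is 1: it is ±1 in a real field and a fourth
  -- root of unity in an imaginary one. The fourth power of `prod_quadNorm` then gives z³² = 1.
  have hN : ∀ v : Vec, v ≠ 0 → M.quadNorm v z ^ 4 = 1 := by
    intro v hv
    have hmul : M.quadNorm v z * M.σ e₀ (M.quadNorm v z) = 1 := by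
      unfold quadNorm
      rw [map_prod, ← Finset.prod_mul_distrib]
      refine Finset.prod_eq_one fun a _ => ?_
      rw [M.σ_comm, ← map_mul, hzc, map_one]
    rcases zmod_two_cases v.1 with h | h
    · have h2 : M.σ e₀ (M.quadNorm v z) = M.quadNorm v z :=
        M.quadNorm_fixBy v z e₀ (by simp [stab, dot, h])
      rw [h2] at hmul
      rw [show 4 = 2 * 2 by norm_num, pow_mul, sq (M.quadNorm v z), hmul, one_pow]
    · rcases M.imaginary_unit h (M.quadNorm_fixBy v z) (M.isU_quadNorm v hzU) hmul with h | h <;>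
      rw [show 4 = 2 * 2 by norm_num, pow_mul, h] <;> norm_num
  have h1 := M.prod_quadNorm z
  have h2 := congrArg (· ^ 4) h1
  rw [← Finset.prod_pow, Finset.prod_eq_one (fun v hv => hN v (by simpa using hv)), mul_pow,
    ← pow_mul, ← pow_mul] at h2
  apply M.pow_eight_eq_one
  have h3 : (∏ a : Vec, M.σ a z) ^ (7 * 4) = 1 := by
    rcases M.norm_unit hzU with h | h <;> rw [h] <;> norm_num
  rw [h3, mul_one] at h2
  exact h2.symm

/-- The prime above `2` obstructs the existence of a unit whose quotient by its conjugate is a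
primitive eighth root of unity. -/
lemma div_conj_ne_ζ {u : L} (hu : IsU u) : u ≠ M.ζ * M.σ e₀ u := by
  intro h
  have hζ0 := M.ζ_ne_zero
  have hne : 1 + M.ζ ≠ 0 := by
    intro h0
    have h1 : M.ζ = -1 := by linear_combination h0
    have := M.ζ_pow_four
    rw [h1] at this
    have : (2 : L) = 0 := by linear_combination this
    exact two_ne_zero this
  -- The number 1 + ζ is also ζ times its conjugate, so a is real and uū = a²(2 + √2).
  set a := u / (1 + M.ζ) with ha
  have hne' : M.ζ + 1 ≠ 0 := by rwa [add_comm]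
  have haτ : M.σ e₀ a = a := by
    rw [ha, map_div₀, map_add, map_one, M.σ_ζ]
    rw [div_eq_div_iff (by intro h0; apply hne; field_simp at h0; linear_combination h0) hne]
    conv_rhs => rw [h]
    field_simp
    ring
  have hua : u = a * (1 + M.ζ) := by rw [ha]; field_simp
  have hw : u * M.σ e₀ u = a ^ 2 * (2 + M.r e₁) := by
    rw [hua, map_mul, haτ, map_add, map_one, M.σ_ζ, ← M.ζ_add_inv]
    field_simp
    ring
  -- Taking the norm of uū along √2 gives w = 2(a·σa)², hence c² = 2w with w a unit. But c lies in
  -- ℚ(√p, √q), where 2 is unramified, so a unit multiple of 2 is not a square.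
  set c := 2 * (a * M.σ e₁ a) with hc
  set w := (u * M.σ e₀ u) * M.σ e₁ (u * M.σ e₀ u) with hwdef
  have hwU : IsU w := (hu.mul (hu.map _)).mul ((hu.mul (hu.map _)).map _)
  have hcw : c ^ 2 = 2 * w := by
    rw [hwdef, hw, map_mul, map_pow, map_add, map_ofNat, M.σ_r_one (a := e₁) (v := e₁) (by decide)]
    have h4 := M.r_e₁_sq
    rw [hc]
    linear_combination 2 * a ^ 2 * (M.σ e₁ a) ^ 2 * h4
  have hcint : IsIntegral ℤ c := by
    apply IsIntegral.of_pow two_pos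
    rw [hcw]
    exact (by simpa using isIntegral_intCast (L := L) 2 : IsIntegral ℤ (2 : L)).mul hwU.2.1
  have hfix : M.FixBy {e₁, e₀} c := by
    rintro b (rfl | rfl)
    · rw [hc, map_mul, map_ofNat, map_mul, M.σ_σ, mul_comm a]
    · rw [hc, map_mul, map_ofNat, map_mul, M.σ_comm, haτ]
  obtain ⟨m, hm, hmi⟩ := M.unram_biquadratic c hfix ⟨hcint, by
    rw [hcw]; push_cast; rw [mul_div_cancel_left₀ _ two_ne_zero]; exact hwU.2.1⟩
  have h3 := (hmi.pow 2).mul hwU.2.2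
  have h4 : ((m : L) * c / (2 : ℕ)) ^ 2 * w⁻¹ = (((m : ℚ) ^ 2 / 2 : ℚ) : L) := by
    rw [div_pow, mul_pow, hcw]
    have := hwU.1
    push_cast
    field_simp
  rw [h4] at h3
  obtain ⟨j, hj⟩ := isIntegral_rat h3
  rw [div_eq_iff two_ne_zero] at hj
  have hj' : m ^ 2 = j.natAbs * 2 := by
    have h5 : (m : ℤ) ^ 2 = j * 2 := by exact_mod_cast hj
    have := congrArg Int.natAbs h5
    simpa [Int.natAbs_mul, Int.natAbs_pow] using this
  have h6 : 2 ∣ m := Nat.prime_two.dvd_of_dvd_pow (Dvd.intro_left _ hj'.symm)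
  have := Nat.dvd_gcd h6 (dvd_refl 2)
  rw [hm] at this
  norm_num at this

/-- Every unit is an eighth root of unity times a real unit. -/
theorem exists_real_unit {u : L} (hu : IsU u) :
    ∃ (j : ℕ) (k : L), IsU k ∧ M.σ e₀ k = k ∧ u = M.ζ ^ j * k := by
  obtain ⟨i, -, hi⟩ := M.isPrimitiveRoot_ζ.eq_pow_of_pow_eq_one (M.div_conj_pow_eight hu)
  have hσ0 := (hu.map (M.σ e₀)).1
  have hζ := M.ζ_ne_zero
  have hu' : u = M.ζ ^ i * M.σ e₀ u := by rw [hi]; field_simp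
  rcases Nat.even_or_odd' i with ⟨l, rfl | rfl⟩
  · refine ⟨l, (M.ζ ^ l)⁻¹ * u, (M.isU_ζ.pow l).inv.mul hu, ?_, by field_simp⟩
    rw [map_mul, map_inv₀, map_pow, M.σ_ζ, inv_pow]
    conv_rhs => rw [hu']
    rw [two_mul, pow_add]
    field_simp
  -- Dividing u by ζ^l turns the quotient ζ^(2l+1) by the conjugate into ζ, contrary to
  -- `div_conj_ne_ζ`.
  · exfalso
    refine M.div_conj_ne_ζ ((M.isU_ζ.pow l).inv.mul hu) ?_
    rw [map_mul, map_inv₀, map_pow, M.σ_ζ, inv_pow]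
    conv_lhs => rw [hu']
    rw [two_mul, pow_succ, pow_add]
    field_simp

end Frame

/-! ### Exponents of real units in the fundamental units -/

/-- The indices of the real quadratic subfields. -/
def realIdx : Finset Vec := Finset.univ.filter (fun v => v.1 = 0 ∧ v ≠ 0)

lemma mem_realIdx {v : Vec} : v ∈ realIdx ↔ v.1 = 0 ∧ v ≠ 0 := by simp [realIdx]

lemma neg_one_zpow_eq_one {L : Type*} [Field L] [CharZero L] {n : ℤ} (h : (-1 : L) ^ n = 1) :
    Even n := by
  by_contra hn
  rw [Int.not_even_iff_odd] at hn
  rw [hn.neg_one_zpow] at h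
  exact two_ne_zero (α := L) (by linear_combination -h)

lemma zpow_sum {L α : Type*} [Field L] {x : L} (hx : x ≠ 0) (S : Finset α) (f : α → ℤ) :
    x ^ (∑ i ∈ S, f i) = ∏ i ∈ S, x ^ f i := by
  classical
  induction S using Finset.induction_on with
  | empty => simp
  | insert a S ha ih => rw [Finset.sum_insert ha, Finset.prod_insert ha, zpow_add₀ hx, ih]

namespace Frame

variable {L : Type*} [Field L] [CharZero L] {p q : ℕ} (M : Frame L p q)

/-- The fundamental unit of the real quadratic subfield `ℚ(r v)`. -/
noncomputable def g (v : Vec) : L :=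
  if h : v.1 = 0 ∧ v ≠ 0 then (M.exists_fundamental h.1 h.2).choose else 1

lemma g_spec {v : Vec} (hv : v ∈ realIdx) :
    M.FixBy (stab v) (M.g v) ∧ IsU (M.g v) ∧ (∃ y : ℝ, 1 < y ∧ M.ι (M.g v) = y) ∧
      ∀ x, M.FixBy (stab v) x → IsU x → ∃ n : ℤ, x = M.g v ^ n ∨ x = -M.g v ^ n := by
  have h := mem_realIdx.1 hv
  unfold g
  rw [dif_pos h]
  exact (M.exists_fundamental h.1 h.2).choose_spec

lemma isU_g (v : Vec) : IsU (M.g v) := by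
  by_cases h : v.1 = 0 ∧ v ≠ 0
  · exact (M.g_spec (mem_realIdx.2 h)).2.1
  · unfold g; rw [dif_neg h]; exact IsU.one

lemma g_fixBy (v : Vec) : M.FixBy (stab v) (M.g v) := by
  by_cases h : v.1 = 0 ∧ v ≠ 0
  · exact (M.g_spec (mem_realIdx.2 h)).1
  · unfold g; rw [dif_neg h]; exact FixBy.one

lemma σ_g {a v : Vec} (h : dot a v = 0) : M.σ a (M.g v) = M.g v := M.g_fixBy v a h

lemma σ_e₀_g (v : Vec) : M.σ e₀ (M.g v) = M.g v := by
  by_cases h : v.1 = 0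
  · exact M.σ_g (by simp [dot, h])
  · unfold g; rw [dif_neg (by tauto), map_one]

lemma g_zpow_inj {v : Vec} (hv : v ∈ realIdx) {s : L} (hs : s = 1 ∨ s = -1) {n m : ℤ}
    (h : M.g v ^ n = s * M.g v ^ m) : n = m := by
  obtain ⟨-, -, ⟨y, hy, hgy⟩, -⟩ := M.g_spec hv
  have hpos : ∀ k : ℤ, 0 < y ^ k := fun k => zpow_pos (by linarith) k
  have h1 := congrArg M.ι h
  rw [map_mul, map_zpow₀, map_zpow₀, hgy] at h1
  rcases hs with rfl | rfl
  · rw [map_one, one_mul] at h1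
    have h2 : y ^ n = y ^ m := by exact_mod_cast h1
    exact zpow_right_injective₀ (by linarith) hy.ne' h2
  · rw [map_neg, map_one, neg_one_mul] at h1
    have h2 : y ^ n = -y ^ m := by exact_mod_cast h1
    have := hpos n
    have := hpos m
    linarith

/-- The norm of the fundamental unit of `ℚ(r v)`. -/
noncomputable def nrm (v : Vec) : ℤ :=
  open scoped Classical in
  if ∃ a, dot a v = 1 ∧ M.g v * M.σ a (M.g v) = -1 then -1 else 1

lemma nrm_pm_one (v : Vec) : M.nrm v = 1 ∨ M.nrm v = -1 := by
  unfold nrm; split_ifs <;> simp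

/-- All automorphisms moving `r v` restrict to the same conjugation of ℚ(r v), so the choice of a is
immaterial. -/
lemma g_mul_σ {a v : Vec} (h : dot a v = 1) : M.g v * M.σ a (M.g v) = M.nrm v := by
  unfold nrm
  split_ifs with h2
  · obtain ⟨b, hb, hb2⟩ := h2
    have : M.σ a (M.g v) = M.σ b (M.g v) := by
      have : a = b + (a + b) := by
        rw [add_comm a b, ← add_assoc, vec_add_self, zero_add]
      rw [this, M.σ_add, M.σ_g (a := a + b)]
      rw [dot_add_left, h, hb]; decide
    rw [this, hb2]; simp
  · rcases M.norm_pm_one h (M.g_fixBy v) (M.isU_g v) with h3 | h3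
    · rw [h3]; simp
    · exact absurd ⟨a, h, h3⟩ h2

/-- The indices of the automorphisms of the real subfield. -/
def realAut : Finset Vec := Finset.univ.filter (fun a => a.1 = 0)

/-- The norm from the real subfield to `ℚ(r v)`. -/
noncomputable def halfNorm (v : Vec) (x : L) : L :=
  ∏ a ∈ realAut.filter (fun a => dot a v = 0), M.σ a x

lemma σ_halfNorm {v c : Vec} (hc : c.1 = 0) (hcv : dot c v = 0) (x : L) :
    M.σ c (M.halfNorm v x) = M.halfNorm v x := by
  refine M.σ_prod_eq _ c (fun a ha => ?_) x
  simp only [realAut, Finset.mem_filter, Finset.mem_univ, true_and] at ha ⊢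
  rw [dot_add_left, ha.2, hcv, add_zero, Prod.fst_add, hc, ha.1, add_zero]
  exact ⟨rfl, rfl⟩

lemma σ_e₀_prod (A : Finset Vec) {x : L} (hx : M.σ e₀ x = x) :
    M.σ e₀ (∏ a ∈ A, M.σ a x) = ∏ a ∈ A, M.σ a x := by
  rw [map_prod]
  exact Finset.prod_congr rfl fun a _ => by rw [M.σ_comm, hx]

lemma halfNorm_fixBy {v : Vec} (hv : v ∈ realIdx) {x : L} (hx : M.σ e₀ x = x) :
    M.FixBy (stab v) (M.halfNorm v x) := by
  intro c hc
  have hv1 := (mem_realIdx.1 hv).1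
  have hc' : dot c v = 0 := hc
  rcases zmod_two_cases c.1 with h | h
  · exact M.σ_halfNorm h hc x
  · have : c = e₀ + (c + e₀) := by
      rw [add_comm c, ← add_assoc, vec_add_self, zero_add]
    rw [this, M.σ_add, M.σ_halfNorm]
    · exact M.σ_e₀_prod _ hx
    · rw [Prod.fst_add, h]; decide
    · rw [dot_add_left, hc']; simp [dot, hv1]

lemma halfNorm_mul (v : Vec) (x y : L) :
    M.halfNorm v (x * y) = M.halfNorm v x * M.halfNorm v y := by
  unfold halfNorm
  rw [← Finset.prod_mul_distrib]
  exact Finset.prod_congr rfl fun a _ => map_mul _ _ _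

lemma isU_halfNorm (v : Vec) {x : L} (hx : IsU x) : IsU (M.halfNorm v x) :=
  IsU.prod _ _ fun a _ => hx.map (M.σ a)

open scoped Classical in
/-- The exponent of the fundamental unit in the norm to `ℚ(r v)` of a real unit. -/
noncomputable def expo (v : Vec) (x : L) : ℤ :=
  -- By `expo_spec` the default 0 is never reached for real units at indices in `realIdx`.
  if h : ∃ n : ℤ, ∃ s : L, (s = 1 ∨ s = -1) ∧ M.halfNorm v x = s * M.g v ^ n then h.choose else 0

lemma expo_spec {v : Vec} (hv : v ∈ realIdx) {x : L} (hu : IsU x) (hx : M.σ e₀ x = x) :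
    ∃ s : L, (s = 1 ∨ s = -1) ∧ M.halfNorm v x = s * M.g v ^ M.expo v x := by
  have h : ∃ n : ℤ, ∃ s : L, (s = 1 ∨ s = -1) ∧ M.halfNorm v x = s * M.g v ^ n := by
    obtain ⟨n, hn⟩ := (M.g_spec hv).2.2.2 _ (M.halfNorm_fixBy hv hx) (M.isU_halfNorm v hu)
    rcases hn with hn | hn
    · exact ⟨n, 1, Or.inl rfl, by rw [hn, one_mul]⟩
    · exact ⟨n, -1, Or.inr rfl, by rw [hn, neg_one_mul]⟩
  unfold expo
  rw [dif_pos h]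
  exact h.choose_spec

lemma expo_eq {v : Vec} (hv : v ∈ realIdx) {x : L} {n : ℤ} {s : L} (hs : s = 1 ∨ s = -1)
    (h : M.halfNorm v x = s * M.g v ^ n) : M.expo v x = n := by
  have h' : ∃ n : ℤ, ∃ s : L, (s = 1 ∨ s = -1) ∧ M.halfNorm v x = s * M.g v ^ n := ⟨n, s, hs, h⟩
  unfold expo
  rw [dif_pos h']
  obtain ⟨t, ht, h2⟩ := h'.choose_spec
  have h2 := h.symm.trans h2
  have hss : s * s = 1 := by rcases hs with rfl | rfl <;> ring
  refine (M.g_zpow_inj hv (pm_one_mul hs ht) (n := n) ?_).symm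
  rw [mul_assoc, ← h2, ← mul_assoc, hss, one_mul]

lemma expo_mul {v : Vec} (hv : v ∈ realIdx) {x y : L} (hx : IsU x) (hx' : M.σ e₀ x = x)
    (hy : IsU y) (hy' : M.σ e₀ y = y) : M.expo v (x * y) = M.expo v x + M.expo v y := by
  obtain ⟨s, hs, h⟩ := M.expo_spec hv hx hx'
  obtain ⟨t, ht, h'⟩ := M.expo_spec hv hy hy'
  refine M.expo_eq hv (pm_one_mul hs ht) ?_
  rw [M.halfNorm_mul, h, h', zpow_add₀ (M.isU_g v).1]; ring

lemma expo_pm_one {v : Vec} (hv : v ∈ realIdx) {s : L} (hs : s = 1 ∨ s = -1) :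
    M.expo v s = 0 := by
  have : M.halfNorm v s = 1 ∨ M.halfNorm v s = -1 := by
    refine pm_one_prod _ _ fun a _ => ?_
    rcases hs with rfl | rfl <;> simp
  exact M.expo_eq hv this (by simp)

lemma expo_inv {v : Vec} (hv : v ∈ realIdx) {x : L} (hx : IsU x) (hx' : M.σ e₀ x = x) :
    M.expo v x⁻¹ = -M.expo v x := by
  have h := M.expo_mul hv hx hx' hx.inv (by rw [map_inv₀, hx'])
  rw [mul_inv_cancel₀ hx.1, M.expo_pm_one hv (Or.inl rfl)] at h
  linarith

lemma card_realStab {v : Vec} (hv : v ∈ realIdx) :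
    (realAut.filter (fun a => dot a v = 0)).card = 4 := by
  revert v; unfold realIdx realAut; decide

lemma exists_sep {v w : Vec} (hv : v ∈ realIdx) (hw : w ∈ realIdx) (hvw : v ≠ w) :
    ∃ c : Vec, c.1 = 0 ∧ dot c v = 0 ∧ dot c w = 1 := by
  have key : ∀ v ∈ realIdx, ∀ w ∈ realIdx, v ≠ w →
      ∃ c ∈ realAut, dot c v = 0 ∧ dot c w = 1 := by unfold realIdx realAut; decide
  obtain ⟨c, hc, h⟩ := key v hv w hw hvw
  exact ⟨c, (Finset.mem_filter.1 hc).2, h⟩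

/-- L⁺ has degree 4 over ℚ(r v), so the norm is a fourth power. -/
lemma expo_g_self {v : Vec} (hv : v ∈ realIdx) : M.expo v (M.g v) = 4 := by
  refine M.expo_eq hv (Or.inl rfl) ?_
  unfold halfNorm
  rw [Finset.prod_congr rfl (g := fun _ => M.g v), Finset.prod_const, card_realStab hv, one_mul]
  · norm_cast
  · intro a ha
    exact M.σ_g (Finset.mem_filter.1 ha).2

/-- Choose c fixing `r v` and moving `r w`. The norm to ℚ(r v) does not see the conjugation c, while
g w times its c-conjugate is ±1; so the square of the norm is (±1)⁴ = 1. -/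
lemma expo_g_of_ne {v w : Vec} (hv : v ∈ realIdx) (hw : w ∈ realIdx) (hvw : v ≠ w) :
    M.expo v (M.g w) = 0 := by
  obtain ⟨c, hc, hcv, hcw⟩ := exists_sep hv hw hvw
  have h1 : M.halfNorm v (M.g w) * M.halfNorm v (M.σ c (M.g w)) = 1 := by
    rw [← M.halfNorm_mul, M.g_mul_σ hcw]
    unfold halfNorm
    rw [Finset.prod_congr rfl (g := fun _ => ((M.nrm w : ℤ) : L)) (fun a _ => map_intCast _ _),
      Finset.prod_const, card_realStab hv]
    rcases M.nrm_pm_one w with h | h <;> rw [h] <;> norm_num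
  have h2 : M.halfNorm v (M.σ c (M.g w)) = M.halfNorm v (M.g w) := by
    rw [← M.σ_halfNorm hc hcv (M.g w)]
    unfold halfNorm
    rw [map_prod]
    exact Finset.prod_congr rfl fun a _ => M.σ_comm _ _ _
  rw [h2] at h1
  have : M.halfNorm v (M.g w) = 1 ∨ M.halfNorm v (M.g w) = -1 := mul_self_eq_one_iff.1 h1
  exact M.expo_eq hv this (by simp)

lemma expo_zpow {v : Vec} (hv : v ∈ realIdx) {x : L} (hx : IsU x) (hx' : M.σ e₀ x = x) (n : ℤ) :
    M.expo v (x ^ n) = n * M.expo v x := by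
  have hpow : ∀ m : ℕ, M.expo v (x ^ m) = m * M.expo v x := by
    intro m
    induction m with
    | zero => simp [M.expo_pm_one hv (Or.inl rfl)]
    | succ m ih =>
      rw [pow_succ, M.expo_mul hv (hx.pow m) (by rw [map_pow, hx']) hx hx', ih]
      push_cast; ring
  cases n with
  | ofNat m => simpa using hpow m
  | negSucc m =>
    rw [zpow_negSucc, M.expo_inv hv (hx.pow _) (by rw [map_pow, hx']), hpow]
    rw [Int.negSucc_eq]; push_cast; ring

/-- The product of powers of the fundamental units. -/
noncomputable def unitProd (S : Finset Vec) (b : Vec → ℤ) : L := ∏ v ∈ S, M.g v ^ b v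

lemma isU_unitProd (S : Finset Vec) (b : Vec → ℤ) : IsU (M.unitProd S b) :=
  IsU.prod _ _ fun v _ => (M.isU_g v).zpow _

lemma σ_e₀_unitProd (S : Finset Vec) (b : Vec → ℤ) :
    M.σ e₀ (M.unitProd S b) = M.unitProd S b := by
  unfold unitProd
  rw [map_prod]
  exact Finset.prod_congr rfl fun v _ => by rw [map_zpow₀, M.σ_e₀_g]

lemma expo_unitProd {v : Vec} (hv : v ∈ realIdx) {S : Finset Vec} (hS : S ⊆ realIdx)
    (b : Vec → ℤ) : M.expo v (M.unitProd S b) = if v ∈ S then 4 * b v else 0 := by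
  induction S using Finset.induction_on with
  | empty => simp [unitProd, M.expo_pm_one hv (Or.inl rfl)]
  | insert w S hw ih =>
    have hwR : w ∈ realIdx := hS (Finset.mem_insert_self _ _)
    have : M.unitProd (insert w S) b = M.g w ^ b w * M.unitProd S b := Finset.prod_insert hw
    rw [this, M.expo_mul hv ((M.isU_g w).zpow _) (by rw [map_zpow₀, M.σ_e₀_g])
      (M.isU_unitProd S b) (M.σ_e₀_unitProd S b),
      M.expo_zpow hv (M.isU_g w) (M.σ_e₀_g w),
      ih (fun x hx => hS (Finset.mem_insert_of_mem hx))]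
    by_cases h : v = w
    · subst h
      rw [M.expo_g_self hv, if_neg hw, if_pos (Finset.mem_insert_self _ _)]; ring
    · rw [M.expo_g_of_ne hv hwR h]
      simp [h]

lemma realNorm_pm_one {x : L} (hu : IsU x) (hx : M.σ e₀ x = x) :
    ∏ a ∈ realAut, M.σ a x = 1 ∨ ∏ a ∈ realAut, M.σ a x = -1 := by
  refine M.unit_rat_pm_one ?_ (IsU.prod _ _ fun a _ => hu.map (M.σ a))
  have hc : ∀ c : Vec, c.1 = 0 → M.σ c (∏ a ∈ realAut, M.σ a x) = ∏ a ∈ realAut, M.σ a x :=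
    fun c hc => M.σ_prod_eq _ c (fun a ha => by
      simp only [realAut, Finset.mem_filter, Finset.mem_univ, true_and] at ha ⊢
      rw [Prod.fst_add, hc, ha, add_zero]) x
  exact M.fixBy_all (M.σ_e₀_prod _ hx) (hc _ rfl) (hc _ rfl) (hc _ rfl)

/-- The product of the seven quadratic norms is x⁴ N(x)³. Vanishing exponents give x⁴ = ±1, and in a
real field this leaves ±1. -/
lemma eq_pm_one_of_expo {x : L} (hu : IsU x) (hx : M.σ e₀ x = x)
    (h : ∀ v ∈ realIdx, M.expo v x = 0) : x = 1 ∨ x = -1 := by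
  have h1 : ∏ v ∈ realIdx, M.halfNorm v x = x ^ 4 * (∏ a ∈ realAut, M.σ a x) ^ 3 := by
    unfold halfNorm
    rw [prod_prod_filter]
    have hc : ∀ a ∈ realAut, (realIdx.filter (fun v => dot a v = 0)).card =
        (if a = 0 then 4 else 0) + 3 := by unfold realIdx realAut; decide
    rw [Finset.prod_congr rfl fun a ha => by rw [hc a ha, pow_add]]
    rw [Finset.prod_mul_distrib, Finset.prod_pow]
    congr 1
    rw [Finset.prod_eq_single 0]
    · simp [M.σ_zero]
    · intro b _ hb; simp [hb]
    · intro h; exact absurd (by simp [realAut]) h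
  have h2 : ∏ v ∈ realIdx, M.halfNorm v x = 1 ∨ ∏ v ∈ realIdx, M.halfNorm v x = -1 := by
    refine pm_one_prod _ _ fun v hv => ?_
    obtain ⟨s, hs, h3⟩ := M.expo_spec hv hu hx
    rw [h3, h v hv, zpow_zero, mul_one]
    exact hs
  have h3 : x ^ 4 = 1 ∨ x ^ 4 = -1 := by
    rcases M.realNorm_pm_one hu hx with h4 | h4 <;> rw [h4] at h1 <;> rw [h1] at h2
    · simpa using h2
    · rcases h2 with h2 | h2
      · right; linear_combination -h2
      · left; linear_combination -h2
  have h4 : (x ^ 2) ^ 2 = 1 ^ 2 := by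
    rcases h3 with h3 | h3
    · rw [← pow_mul, h3, one_pow]
    · exact absurd (by rw [← pow_mul, h3]) (M.not_sq_eq_neg_one (x := x ^ 2) (by rw [map_pow, hx]))
  rcases sq_eq_sq_iff_eq_or_eq_neg.1 h4 with h5 | h5
  · exact sq_eq_one_iff.1 h5
  · exact absurd h5 (M.not_sq_eq_neg_one hx)

/-- A real unit with exponents divisible by `4` is a product of fundamental units up to sign. -/
lemma eq_unitProd {x : L} (hu : IsU x) (hx : M.σ e₀ x = x) {b : Vec → ℤ}
    (h : ∀ v ∈ realIdx, M.expo v x = 4 * b v) :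
    ∃ s : L, (s = 1 ∨ s = -1) ∧ x = s * M.unitProd realIdx b := by
  have hU := M.isU_unitProd realIdx b
  have hσ := M.σ_e₀_unitProd realIdx b
  refine ⟨x * (M.unitProd realIdx b)⁻¹, M.eq_pm_one_of_expo (hu.mul hU.inv)
    (by rw [map_mul, map_inv₀, hx, hσ]) fun v hv => ?_, ?_⟩
  · rw [M.expo_mul hv hu hx hU.inv (by rw [map_inv₀, hσ]), M.expo_inv hv hU hσ,
      M.expo_unitProd hv (Finset.Subset.refl _), if_pos hv, h v hv]
    ring
  · rw [inv_mul_cancel_right₀ hU.1]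

end Frame
-- Parity conditions on exponents and criteria for square roots
namespace Frame

variable {L : Type*} [Field L] [CharZero L] {p q : ℕ} (M : Frame L p q)

lemma pm_one_of_sq {x : L} (h : x ^ 2 = 1 ∨ x ^ 2 = -1) (hx : M.σ e₀ x = x) : x = 1 ∨ x = -1 := by
  rcases h with h | h
  · exact sq_eq_one_iff.1 h
  · exact absurd h (M.not_sq_eq_neg_one hx)

/-- A product of fundamental units which is a square in the real subfield, up to sign, satisfies
the parity conditions imposed by the signs of the conjugates. -/
theorem even_of_sq {x s : L} (hx : M.σ e₀ x = x) (hs : s = 1 ∨ s = -1) {b : Vec → ℤ}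
    (h : x ^ 2 = s * M.unitProd realIdx b) (a : Vec) :
    Even (∑ v ∈ realIdx.filter (fun v => dot a v = 1 ∧ M.nrm v = -1), b v) := by
  set P := M.unitProd (realIdx.filter (fun v => dot a v = 0)) b with hP
  have hPU : IsU P := M.isU_unitProd _ _
  set Q : L := (-1) ^ (∑ v ∈ realIdx.filter (fun v => dot a v = 1 ∧ M.nrm v = -1), b v) with hQ
  have hne : (-1 : L) ≠ 0 := neg_ne_zero.2 one_ne_zero
  -- Multiplied by their a-conjugates, the units fixed by a become squares and the others become
  -- their norms. Hence Q = ±1 is the square of a real element, so Q = 1.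
  have hσP : M.unitProd realIdx b * M.σ a (M.unitProd realIdx b) = P ^ 2 * Q := by
    rw [hP, hQ, zpow_sum hne]
    unfold unitProd
    rw [map_prod, ← Finset.prod_mul_distrib, ← Finset.prod_pow, Finset.prod_filter,
      Finset.prod_filter, ← Finset.prod_mul_distrib]
    refine Finset.prod_congr rfl fun v _ => ?_
    rw [map_zpow₀, ← mul_zpow]
    rcases zmod_two_cases (dot a v) with h0 | h0
    · rw [M.σ_g h0, if_pos h0, if_neg (by rw [h0]; simp), mul_one, mul_zpow]; ring
    · rw [M.g_mul_σ h0, if_neg (by rw [h0]; decide)]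
      rcases M.nrm_pm_one v with h1 | h1
      · rw [h1, if_neg (by norm_num)]; simp
      · rw [h1, if_pos ⟨h0, rfl⟩]; simp
  have hz : (x * M.σ a x * P⁻¹) ^ 2 = Q := by
    have h1 : (x * M.σ a x) ^ 2 = P ^ 2 * Q := by
      rw [mul_pow, ← map_pow, h, map_mul, ← hσP]
      have h2 : M.σ a s = s := by rcases hs with rfl | rfl <;> simp
      rw [h2]
      linear_combination (M.unitProd realIdx b * M.σ a (M.unitProd realIdx b)) * sq_pm_one hs
    rw [mul_pow, h1, inv_pow]
    have := hPU.1
    field_simp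
  have hzτ : M.σ e₀ (x * M.σ a x * P⁻¹) = x * M.σ a x * P⁻¹ := by
    rw [map_mul, map_mul, map_inv₀, M.σ_comm, hx, M.σ_e₀_unitProd]
  have hQ1 : Q = 1 ∨ Q = -1 := zpow_pm_one_cases (Or.inr rfl) _
  rcases hQ1 with h1 | h1
  · exact neg_one_zpow_eq_one h1
  · rw [h1] at hz
    exact absurd hz (M.not_sq_eq_neg_one hzτ)

/-- The three real indices orthogonal to a form a line. Both 0 and a are orthogonal to all three,
any other c to exactly one. This gives ∏ N_v(k) = N(k)·(k·σ_a k)² over the line. -/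
lemma real_line_card {a : Vec} (ha : a ∈ realIdx) (c : Vec) (hc : c ∈ realAut) :
    ((realIdx.filter (fun v => dot a v = 0)).filter (fun v => dot c v = 0)).card =
      1 + ((if c = 0 then 2 else 0) + (if c = a then 2 else 0)) := by
  have key : ∀ a ∈ realIdx, ∀ c ∈ realAut,
    ((realIdx.filter (fun v => dot a v = 0)).filter (fun v => dot c v = 0)).card =
      1 + ((if c = 0 then 2 else 0) + (if c = a then 2 else 0)) := by
    unfold realIdx realAut; decide
  exact key a ha c hc

/-- The square of the norm of a real unit to a biquadratic subfield. -/
lemma sq_biquadNorm {a : Vec} (ha : a ∈ realIdx) {k : L} (hu : IsU k) (hk : M.σ e₀ k = k) :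
    ∃ s : L, (s = 1 ∨ s = -1) ∧ (k * M.σ a k) ^ 2 =
      s * M.unitProd (realIdx.filter (fun v => dot a v = 0)) (fun v => M.expo v k) := by
  have ha' := mem_realIdx.1 ha
  have h1 : ∏ v ∈ realIdx.filter (fun v => dot a v = 0), M.halfNorm v k =
      (∏ c ∈ realAut, M.σ c k) * (k * M.σ a k) ^ 2 := by
    unfold halfNorm
    rw [prod_prod_filter]
    rw [Finset.prod_congr rfl fun c hc => by rw [real_line_card ha c hc, pow_add, pow_add]]
    rw [Finset.prod_mul_distrib, Finset.prod_mul_distrib, mul_pow]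
    congr 1
    · simp
    · congr 1
      · rw [Finset.prod_eq_single 0]
        · simp [M.σ_zero]
        · intro b _ hb; simp [hb]
        · intro h; exact absurd (by simp [realAut]) h
      · rw [Finset.prod_eq_single a]
        · simp
        · intro b _ hb; simp [hb]
        · intro h; exact absurd (by simp [realAut, ha'.1]) h
  have hsp : ∀ v : Vec, ∃ s : L, (s = 1 ∨ s = -1) ∧
      (v ∈ realIdx → M.halfNorm v k = s * M.g v ^ M.expo v k) := by
    intro v
    by_cases hv : v ∈ realIdx
    · obtain ⟨s, hs, h⟩ := M.expo_spec hv hu hk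
      exact ⟨s, hs, fun _ => h⟩
    · exact ⟨1, Or.inl rfl, fun h => absurd h hv⟩
  choose s hs hsk using hsp
  have h2 : ∏ v ∈ realIdx.filter (fun v => dot a v = 0), M.halfNorm v k =
      (∏ v ∈ realIdx.filter (fun v => dot a v = 0), s v) *
        M.unitProd (realIdx.filter (fun v => dot a v = 0)) (fun v => M.expo v k) := by
    unfold unitProd
    rw [← Finset.prod_mul_distrib]
    exact Finset.prod_congr rfl fun v hv => hsk v (Finset.mem_filter.1 hv).1
  have hn := M.realNorm_pm_one hu hk
  refine ⟨(∏ c ∈ realAut, M.σ c k) * ∏ v ∈ realIdx.filter (fun v => dot a v = 0), s v,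
    pm_one_mul hn (pm_one_prod _ _ fun v _ => hs v), ?_⟩
  rw [mul_assoc, ← h2, h1]
  linear_combination (-(k * M.σ a k) ^ 2) * sq_pm_one hn

/-- Parity conditions on the exponents of a real unit, from the signs of conjugates. -/
theorem even_line {a : Vec} (ha : a ∈ realIdx) {k : L} (hu : IsU k) (hk : M.σ e₀ k = k) (c : Vec) :
    Even (∑ v ∈ realIdx.filter (fun v => dot c v = 1 ∧ M.nrm v = -1),
      if dot a v = 0 then M.expo v k else 0) := by
  obtain ⟨s, hs, h⟩ := M.sq_biquadNorm ha hu hk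
  refine M.even_of_sq (x := k * M.σ a k) (by rw [map_mul, M.σ_comm, hk]) hs ?_ c
  rw [h]
  congr 1
  unfold unitProd
  rw [Finset.prod_filter]
  refine Finset.prod_congr rfl fun v _ => ?_
  by_cases hv : dot a v = 0 <;> simp [hv]

/-- Parity conditions on the exponents of a real unit, from square roots of units. -/
theorem even_line_of_sqrt {a : Vec} (ha : a ∈ realIdx) {k : L} (hu : IsU k) (hk : M.σ e₀ k = k)
    (φ : Vec → L) (hφ : ∀ v ∈ realIdx, dot a v = 0 → ∃ s : L, (s = 1 ∨ s = -1) ∧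
      φ v ^ 2 = s * M.g v ^ M.expo v k ∧ M.σ a (φ v) = (-1) ^ M.expo v k * φ v) :
    Even (∑ v ∈ realIdx.filter (fun v => dot a v = 0), M.expo v k) := by
  obtain ⟨s, hs, h⟩ := M.sq_biquadNorm ha hu hk
  set S := realIdx.filter (fun v => dot a v = 0) with hS
  set x := k * M.σ a k with hx
  have hxσ : M.σ a x = x := by rw [hx, map_mul, M.σ_σ, mul_comm]
  have hsp : ∀ v : Vec, ∃ s : L, (s = 1 ∨ s = -1) ∧
      (v ∈ S → φ v ^ 2 = s * M.g v ^ M.expo v k) := by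
    intro v
    by_cases hv : v ∈ S
    · have hv' := Finset.mem_filter.1 hv
      obtain ⟨s, hs, h, -⟩ := hφ v hv'.1 hv'.2
      exact ⟨s, hs, fun _ => h⟩
    · exact ⟨1, Or.inl rfl, fun h => absurd h hv⟩
  choose t ht htφ using hsp
  set Φ := ∏ v ∈ S, φ v with hΦ
  have hΦ2 : Φ ^ 2 = (∏ v ∈ S, t v) * M.unitProd S (fun v => M.expo v k) := by
    unfold unitProd
    rw [hΦ, ← Finset.prod_pow, ← Finset.prod_mul_distrib]
    exact Finset.prod_congr rfl fun v hv => htφ v hv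
  have hσΦ : M.σ a Φ = (-1) ^ (∑ v ∈ S, M.expo v k) * Φ := by
    rw [zpow_sum (neg_ne_zero.2 one_ne_zero), hΦ, map_prod, ← Finset.prod_mul_distrib]
    refine Finset.prod_congr rfl fun v hv => ?_
    have hv' := Finset.mem_filter.1 hv
    obtain ⟨s, -, -, h⟩ := hφ v hv'.1 hv'.2
    exact h
  have hT : ∏ v ∈ S, t v = 1 ∨ ∏ v ∈ S, t v = -1 := pm_one_prod _ _ fun v _ => ht v
  set T := ∏ v ∈ S, t v
  have hUP := (M.isU_unitProd S (fun v => M.expo v k)).1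
  have hT0 : T ≠ 0 := by rcases hT with h | h <;> rw [h] <;> simp
  have hΦ0 : Φ ≠ 0 := by
    intro h0
    rw [h0] at hΦ2
    exact mul_ne_zero hT0 hUP (by rw [← hΦ2]; ring)
  -- The squares of x and Φ agree up to sign, so x/Φ is a fourth root of unity, fixed by σ a because
  -- a is a real index. As x is fixed too, so is Φ; but σ a multiplies Φ by -1 to the sum of the
  -- exponents.
  have hω : (x * Φ⁻¹) ^ 2 = 1 ∨ (x * Φ⁻¹) ^ 2 = -1 := by
    have : (x * Φ⁻¹) ^ 2 = s * T := by
      rw [mul_pow, h, inv_pow, hΦ2]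
      field_simp
      linear_combination -s * sq_pm_one hT
    rw [this]
    exact pm_one_mul hs hT
  have hωσ : M.σ a (x * Φ⁻¹) = x * Φ⁻¹ := by
    have hi : M.σ a (M.r e₀) = M.r e₀ := M.σ_r_zero (by
      have := (mem_realIdx.1 ha).1
      simp [dot, this])
    rcases hω with h | h
    · rcases sq_eq_one_iff.1 h with h | h <;> rw [h] <;> simp
    · rcases M.eq_of_sq_eq_neg_one h with h | h <;> rw [h]
      · exact hi
      · rw [map_neg, hi]
  have hx0 : x ≠ 0 := (hu.mul (hu.map (M.σ a))).1
  have hΦσ : M.σ a Φ = Φ := by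
    rw [map_mul, hxσ, map_inv₀] at hωσ
    exact inv_injective (mul_left_cancel₀ hx0 hωσ)
  rw [hΦσ] at hσΦ
  apply neg_one_zpow_eq_one (L := L)
  apply mul_right_cancel₀ hΦ0
  rw [← hσΦ, one_mul]

/-- A real element, up to sign, has a real square root as soon as it has a square root. -/
lemma exists_real_sqrt {x α : L} (hα : M.σ e₀ α = α) (h : x ^ 2 = α) :
    ∃ y s : L, (s = 1 ∨ s = -1) ∧ M.σ e₀ y = y ∧ y ^ 2 = s * α := by
  have h1 : (M.σ e₀ x) ^ 2 = x ^ 2 := by rw [← map_pow, h, hα]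
  rcases sq_eq_sq_iff_eq_or_eq_neg.1 h1 with h2 | h2
  · exact ⟨x, 1, Or.inl rfl, h2, by rw [h, one_mul]⟩
  · refine ⟨M.r e₀ * x, -1, Or.inr rfl, ?_, ?_⟩
    · rw [map_mul, h2, M.σ_r_one (by decide)]; ring
    · rw [mul_pow, M.r_e₀_sq, h]

/-- An element all of whose products with its conjugates have suitable square roots is a rational
number times a square. -/
theorem exists_fixed_mul_sq {α : L} (hα0 : α ≠ 0)
    (hα : ∀ a, ∃ γ, M.σ a γ = γ ∧ γ ^ 2 = α * M.σ a α) :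
    ∃ (t : ℚ) (β : L), α = t * β ^ 2 := by
  -- One involution at a time: if γ² = α·σ_b α, then α((γ + α)/α)² = α + 2γ + σ_b α is fixed by b
  -- and has the same class as α modulo squares. The hypothesis on square roots passes to the new
  -- element.
  have step : ∀ (S : Set Vec) (b : Vec) (α : L), α ≠ 0 →
      (∀ a, ∃ γ, M.σ a γ = γ ∧ γ ^ 2 = α * M.σ a α) → M.FixBy S α →
      ∃ β : L, β ≠ 0 ∧ M.FixBy (insert b S) (α * β ^ 2) ∧
        (∀ a, ∃ γ, M.σ a γ = γ ∧ γ ^ 2 = (α * β ^ 2) * M.σ a (α * β ^ 2)) := by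
    intro S b α hα0 hα hS
    obtain ⟨γ, hγ, hγ2⟩ : ∃ γ, M.σ b γ = γ ∧ γ ^ 2 = α * M.σ b α ∧ γ + α ≠ 0 := by
      obtain ⟨γ, h1, h2⟩ := hα b
      -- The multiplier must not vanish; if it does, the opposite root -γ is used.
      by_cases h3 : γ + α = 0
      · refine ⟨-γ, by rw [map_neg, h1], by rw [neg_sq, h2], fun h4 => ?_⟩
        have : (2 : L) * α = 0 := by linear_combination h3 + h4
        exact hα0 ((mul_eq_zero.1 this).resolve_left two_ne_zero)
      · exact ⟨γ, h1, h2, h3⟩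
    obtain ⟨hγ2, hγα⟩ := hγ2
    -- For a in S the root attached to b + a is ±γ. So γ is fixed by b + a and by b, hence by a.
    have hγS : M.FixBy S γ := by
      intro a ha
      obtain ⟨γ', h1, h2⟩ := hα (b + a)
      rw [M.σ_add, hS a ha, ← hγ2] at h2
      have h3 : M.σ (b + a) γ = γ := by
        rcases sq_eq_sq_iff_eq_or_eq_neg.1 h2 with h | h
        · rwa [h] at h1
        · rw [h, map_neg] at h1
          exact neg_injective h1
      rw [add_comm, M.σ_add, hγ] at h3
      exact h3
    have hσα0 : M.σ b α ≠ 0 := (map_ne_zero (M.σ b)).2 hα0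
    have hval : α * ((γ + α) / α) ^ 2 = α + 2 * γ + M.σ b α := by
      field_simp
      linear_combination hγ2
    refine ⟨(γ + α) / α, div_ne_zero hγα hα0, ?_, ?_⟩
    · rw [hval]
      rintro a (rfl | ha)
      · rw [map_add, map_add, map_mul, map_ofNat, hγ, M.σ_σ]; ring
      · rw [map_add, map_add, map_mul, map_ofNat, hγS a ha, M.σ_comm, hS a ha]
    · intro a
      obtain ⟨γ', h1, h2⟩ := hα a
      refine ⟨γ' * (((γ + α) / α) * M.σ a ((γ + α) / α)), ?_, ?_⟩
      · rw [map_mul, h1, map_mul, M.σ_σ, mul_comm (M.σ a ((γ + α) / α))]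
      · rw [mul_pow, h2, map_mul, map_pow]; ring
  obtain ⟨β0, h0, hf0, hn0⟩ := step ∅ e₀ α hα0 hα (fun a ha => ha.elim)
  have hne0 := mul_ne_zero hα0 (pow_ne_zero 2 h0)
  obtain ⟨β1, h1, hf1, hn1⟩ := step _ e₁ _ hne0 hn0 hf0
  have hne1 := mul_ne_zero hne0 (pow_ne_zero 2 h1)
  obtain ⟨β2, h2, hf2, hn2⟩ := step _ e₂ _ hne1 hn1 hf1
  have hne2 := mul_ne_zero hne1 (pow_ne_zero 2 h2)
  obtain ⟨β3, h3, hf3, hn3⟩ := step _ e₃ _ hne2 hn2 hf2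
  obtain ⟨t, ht⟩ := M.exists_rat _ (M.fixBy_all (hf3 e₀ (by simp)) (hf3 e₁ (by simp))
    (hf3 e₂ (by simp)) (hf3 e₃ (by simp)))
  refine ⟨t, (β0 * β1 * β2 * β3)⁻¹, ?_⟩
  rw [← ht]
  field_simp

end Frame
-- Norm equations and the square classes of fundamental units
namespace Frame

variable {L : Type*} [Field L] [CharZero L] {p q : ℕ} (M : Frame L p q)

section Legendre

lemma p_ne_q (M : Frame L p q) : p ≠ q := by
  have := M.p_mod
  have := M.q_mod
  omega

/-- The supplementary laws for q ≡ 5 mod 8. The norm equations below are refuted by reducing them to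
this fact. -/
lemma not_sq_two (M : Frame L p q) (x : ZMod q) : x ^ 2 ≠ 2 ∧ x ^ 2 ≠ -2 := by
  have : Fact q.Prime := ⟨M.prime_q⟩
  have hq := M.q_mod
  constructor
  · intro h
    have := (ZMod.exists_sq_eq_two_iff (p := q) (by omega)).1 ⟨x, by rw [← h, sq]⟩
    omega
  · intro h
    have := (ZMod.exists_sq_eq_neg_two_iff (p := q) (by omega)).1 ⟨x, by rw [← h, sq]⟩
    omega

lemma two_ne_zero_q (M : Frame L p q) : (2 : ZMod q) ≠ 0 := by
  intro h
  exact (M.not_sq_two 0).1 (by rw [h]; ring)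

/-- Quadratic reciprocity for `p` and `q`. -/
lemma exists_sq_eq_p (M : Frame L p q) {y z s : ZMod p} (hs : s = 1 ∨ s = -1) (hy : y ≠ 0)
    (h : (q : ZMod p) * z ^ 2 = s * y ^ 2) : ∃ c : ZMod q, (p : ZMod q) = c ^ 2 := by
  have : Fact p.Prime := ⟨M.prime_p⟩
  have : Fact q.Prime := ⟨M.prime_q⟩
  have hp := M.p_mod
  have hq := M.q_mod
  -- Since -1 is a square modulo p, the sign s does not matter.
  obtain ⟨j, hj⟩ := ZMod.exists_sq_eq_neg_one_iff.2 (show p % 4 ≠ 3 by omega)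
  obtain ⟨i, hi⟩ : ∃ i : ZMod p, s = i ^ 2 := by
    rcases hs with rfl | rfl
    · exact ⟨1, by ring⟩
    · exact ⟨j, by rw [hj, sq]⟩
  have hs0 : s ≠ 0 := by rcases hs with rfl | rfl <;> simp
  have hz : z ≠ 0 := by
    rintro rfl
    refine mul_ne_zero hs0 (pow_ne_zero 2 hy) ?_
    rw [← h]; ring
  have hsq : IsSquare (q : ZMod p) := ⟨i * y / z, by field_simp; rw [h, hi]⟩
  obtain ⟨c, hc⟩ := (ZMod.exists_sq_eq_prime_iff_of_mod_four_eq_one (p := p) (q := q) (by omega)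
    (by omega)).1 hsq
  exact ⟨c, by rw [hc, sq]⟩

lemma q_dvd_of_sq (M : Frame L p q) {A : ℤ} (h : (q : ℤ) ∣ A ^ 2) : (q : ℤ) ∣ A :=
  (Nat.prime_iff_prime_int.1 M.prime_q).dvd_of_dvd_pow h

lemma p_ne_zero_q (M : Frame L p q) : (p : ZMod q) ≠ 0 := by
  intro h
  rw [ZMod.natCast_eq_zero_iff] at h
  exact M.p_ne_q ((Nat.prime_dvd_prime_iff_eq M.prime_q M.prime_p).1 h).symm

lemma cast_pm_one {n : ℕ} {s : ℤ} (hs : s = 1 ∨ s = -1) : (s : ZMod n) = 1 ∨ (s : ZMod n) = -1 := by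
  rcases hs with rfl | rfl <;> simp

/-- No element of norm `±2` up to a divisor `m` of the discriminant prime to `q`. -/
lemma no_norm_two (M : Frame L p q) {A B m s : ℤ} (hs : s = 1 ∨ s = -1)
    (h : A ^ 2 - m * q * B ^ 2 = 4 * (s * 2)) : False := by
  have : Fact q.Prime := ⟨M.prime_q⟩
  have h1 := congrArg (Int.cast : ℤ → ZMod q) h
  push_cast at h1
  rw [ZMod.natCast_self] at h1
  have h2 := M.two_ne_zero_q
  have h3 : ((A : ZMod q) / 2) ^ 2 = s * 2 := by
    field_simp
    linear_combination h1
  rcases cast_pm_one (n := q) hs with h4 | h4 <;> rw [h4] at h3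
  · exact (M.not_sq_two _).1 (by rw [h3]; ring)
  · exact (M.not_sq_two _).2 (by rw [h3]; ring)

/-- Here q divides A; after cancelling q, reduction modulo q gives B² = ∓2. -/
lemma no_norm_half (M : Frame L p q) {A B m s : ℤ} (hm : (m : ZMod q) ≠ 0) (hs : s = 1 ∨ s = -1)
    (h : A ^ 2 - 2 * m * q * B ^ 2 = 4 * (s * (m * q))) : False := by
  have : Fact q.Prime := ⟨M.prime_q⟩
  have hq0 : (q : ℤ) ≠ 0 := by exact_mod_cast M.prime_q.ne_zero
  obtain ⟨A', rfl⟩ := M.q_dvd_of_sq (A := A) ⟨2 * m * B ^ 2 + 4 * (s * m), by linear_combination h⟩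
  have h' : q * A' ^ 2 - 2 * m * B ^ 2 = 4 * (s * m) := by
    apply mul_left_cancel₀ hq0
    linear_combination h
  have h1 := congrArg (Int.cast : ℤ → ZMod q) h'
  push_cast at h1
  rw [ZMod.natCast_self] at h1
  have h2 := M.two_ne_zero_q
  have h3 : (B : ZMod q) ^ 2 = -(s * 2) := by
    apply mul_left_cancel₀ (mul_ne_zero h2 hm)
    linear_combination -h1
  rcases cast_pm_one (n := q) hs with h4 | h4 <;> rw [h4] at h3
  · exact (M.not_sq_two _).2 (by rw [h3]; ring)
  · exact (M.not_sq_two _).1 (by rw [h3]; ring)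

lemma two_ne_zero_p (M : Frame L p q) : (2 : ZMod p) ≠ 0 := by
  intro h
  have h' : ((2 : ℕ) : ZMod p) = 0 := by exact_mod_cast h
  rw [ZMod.natCast_eq_zero_iff] at h'
  have := (Nat.prime_dvd_prime_iff_eq M.prime_p Nat.prime_two).1 h'
  have := M.p_mod
  omega

/-- Cancelling q leaves q·A'² - 2p·B² = ±4. Modulo p this makes q a square, so p is a square modulo
q by reciprocity; modulo q the equation then makes ±2 a square. -/
lemma no_norm_q (M : Frame L p q) {A B s : ℤ} (hs : s = 1 ∨ s = -1)
    (h : A ^ 2 - 2 * p * q * B ^ 2 = 4 * (s * q)) : False := by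
  have : Fact p.Prime := ⟨M.prime_p⟩
  have : Fact q.Prime := ⟨M.prime_q⟩
  have hq0 : (q : ℤ) ≠ 0 := by exact_mod_cast M.prime_q.ne_zero
  obtain ⟨A', rfl⟩ := M.q_dvd_of_sq (A := A) ⟨2 * p * B ^ 2 + 4 * s, by linear_combination h⟩
  have h' : q * A' ^ 2 - 2 * p * B ^ 2 = 4 * s := by
    apply mul_left_cancel₀ hq0
    linear_combination h
  have h1 := congrArg (Int.cast : ℤ → ZMod p) h'
  push_cast at h1
  rw [ZMod.natCast_self] at h1
  obtain ⟨c, hc⟩ := M.exists_sq_eq_p (y := 2) (z := (A' : ZMod p)) (cast_pm_one hs)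
    M.two_ne_zero_p (by linear_combination h1)
  have h3 := congrArg (Int.cast : ℤ → ZMod q) h'
  push_cast at h3
  rw [ZMod.natCast_self, hc] at h3
  have h2 := M.two_ne_zero_q
  have h4 : (c * B) ^ 2 = -(s * 2) := by
    apply mul_left_cancel₀ h2
    linear_combination -h3
  rcases cast_pm_one (n := q) hs with h5 | h5 <;> rw [h5] at h4
  · exact (M.not_sq_two _).2 (by rw [h4]; ring)
  · exact (M.not_sq_two _).1 (by rw [h4]; ring)

/-- Cancelling p leaves p·A'² - 2q·B² = ±8. Again q is a square modulo p, hence p is one modulo q,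
and ±2 would be a square modulo q. -/
lemma no_norm_two_p (M : Frame L p q) {A B s : ℤ} (hs : s = 1 ∨ s = -1)
    (h : A ^ 2 - 2 * p * q * B ^ 2 = 4 * (s * (2 * p))) : False := by
  have : Fact p.Prime := ⟨M.prime_p⟩
  have : Fact q.Prime := ⟨M.prime_q⟩
  have hp0 : (p : ℤ) ≠ 0 := by exact_mod_cast M.prime_p.ne_zero
  obtain ⟨A', rfl⟩ : (p : ℤ) ∣ A := (Nat.prime_iff_prime_int.1 M.prime_p).dvd_of_dvd_pow
    (n := 2) ⟨2 * q * B ^ 2 + 8 * s, by linear_combination h⟩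
  have h' : p * A' ^ 2 - 2 * q * B ^ 2 = 8 * s := by
    apply mul_left_cancel₀ hp0
    linear_combination h
  have h1 := congrArg (Int.cast : ℤ → ZMod p) h'
  push_cast at h1
  rw [ZMod.natCast_self] at h1
  obtain ⟨c, hc⟩ := M.exists_sq_eq_p (y := 2) (z := (B : ZMod p)) (s := ((-s : ℤ) : ZMod p))
    (cast_pm_one (by omega)) M.two_ne_zero_p (by
      apply mul_left_cancel₀ M.two_ne_zero_p
      push_cast
      linear_combination -h1)
  have h3 := congrArg (Int.cast : ℤ → ZMod q) h'
  push_cast at h3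
  rw [ZMod.natCast_self, hc] at h3
  have h2 := M.two_ne_zero_q
  have h4 : (c * A' / 2) ^ 2 = s * 2 := by
    field_simp
    linear_combination h3
  rcases cast_pm_one (n := q) hs with h5 | h5 <;> rw [h5] at h4
  · exact (M.not_sq_two _).1 (by rw [h4]; ring)
  · exact (M.not_sq_two _).2 (by rw [h4]; ring)

end Legendre

lemma exists_disc_eq (M : Frame L p q) {n : ℤ} (hn : Squarefree n)
    (h : ∀ l : ℕ, l.Prime → (l : ℤ) ∣ n → l = 2 ∨ l = p ∨ l = q) :
    ∃ w : Vec, w.1 = 0 ∧ (n = disc p q w ∨ n = -disc p q w) := by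
  have hdvd : n.natAbs ∣ 2 * p * q := by
    rw [← Nat.prod_primeFactors_of_squarefree (Int.squarefree_natAbs.2 hn)]
    refine Finset.prod_primes_dvd _ (fun l hl => (Nat.prime_of_mem_primeFactors hl).prime)
      fun l hl => ?_
    rcases h l (Nat.prime_of_mem_primeFactors hl)
      (Int.natCast_dvd.2 (Nat.dvd_of_mem_primeFactors hl)) with rfl | rfl | rfl
    · exact ⟨p * q, by ring⟩
    · exact ⟨2 * q, by ring⟩
    · exact ⟨2 * p, by ring⟩
  obtain ⟨a, c, ha, hc, hac⟩ := (Nat.dvd_mul).1 hdvd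
  obtain ⟨a, b, ha, hb, hab⟩ := (Nat.dvd_mul).1 ha
  have key : ∀ m d : ℕ, m.Prime → d ∣ m → ∃ x : ZMod 2, (d : ℤ) = (m : ℤ) ^ x.val := by
    intro m d hm hd
    rcases (Nat.dvd_prime hm).1 hd with rfl | rfl
    · exact ⟨0, by simp⟩
    · exact ⟨1, by simp [ZMod.val_one]⟩
  obtain ⟨x, hx⟩ := key 2 a Nat.prime_two ha
  obtain ⟨y, hy⟩ := key p b M.prime_p hb
  obtain ⟨z, hz⟩ := key q c M.prime_q hc
  refine ⟨(0, x, y, z), rfl, ?_⟩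
  have : disc p q (0, x, y, z) = n.natAbs := by
    rw [← hac, ← hab]
    push_cast
    rw [hx, hy, hz]
    simp [disc]
  rw [this]
  omega

lemma dvd_disc (v : Vec) : (v.2.1 = 1 → ((2 : ℕ) : ℤ) ∣ disc p q v) ∧
    (v.2.2.1 = 1 → (p : ℤ) ∣ disc p q v) ∧ (v.2.2.2 = 1 → (q : ℤ) ∣ disc p q v) := by
  unfold disc
  refine ⟨fun h => ?_, fun h => ?_, fun h => ?_⟩ <;> rw [h, ZMod.val_one, pow_one]
  · push_cast
    exact ((dvd_mul_left _ _).mul_right _).mul_right _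
  · exact (dvd_mul_left _ _).mul_right _
  · exact dvd_mul_left _ _

/-- Divisibility of indices. -/
def Sub (w v : Vec) : Prop :=
  (w.2.1 = 1 → v.2.1 = 1) ∧ (w.2.2.1 = 1 → v.2.2.1 = 1) ∧ (w.2.2.2 = 1 → v.2.2.2 = 1)

instance (w v : Vec) : Decidable (Sub w v) := inferInstanceAs (Decidable (_ ∧ _ ∧ _))

lemma disc_mod_four (M : Frame L p q) {v : Vec} (hv : v.1 = 0) (hv2 : v.2.1 = 0) :
    ∃ k, disc p q v = 4 * k + 1 := by
  have hp := M.p_mod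
  have hq := M.q_mod
  have key : ∀ (m : ℕ) (x : ZMod 2), m % 4 = 1 → (m : ℤ) ^ x.val ≡ 1 [ZMOD 4] := by
    intro m x hm
    have : (m : ℤ) ≡ 1 [ZMOD 4] := by
      unfold Int.ModEq
      omega
    simpa using this.pow x.val
  have h := (key p v.2.2.1 (by omega)).mul (key q v.2.2.2 (by omega))
  have : disc p q v = (p : ℤ) ^ v.2.2.1.val * (q : ℤ) ^ v.2.2.2.val := by
    simp [disc, hv, hv2]
  rw [← this] at h
  unfold Int.ModEq at h
  exact ⟨disc p q v / 4, by omega⟩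

/-- A fundamental unit of norm `1` is, up to sign, a square times a proper divisor of the
discriminant. -/
theorem exists_sqrt_of_nrm_one {v : Vec} (hv : v ∈ realIdx) (hn : M.nrm v = 1) :
    ∃ w : Vec, w.1 = 0 ∧ w ≠ 0 ∧ w ≠ v ∧ Sub w v ∧ ∃ β s : L, M.FixBy (stab v) β ∧
      (s = 1 ∨ s = -1) ∧ (M.r w * β) ^ 2 = s * M.g v := by
  obtain ⟨hv1, hv0⟩ := mem_realIdx.1 hv
  obtain ⟨π, hπ⟩ := exists_dot_eq_one hv0
  have hg := M.g_mul_σ hπ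
  rw [hn, Int.cast_one] at hg
  have hgU := M.isU_g v
  have hgF := M.g_fixBy v
  have hg1 : 1 + M.g v ≠ 0 := by
    intro h
    obtain ⟨-, -, ⟨y, hy, hgy⟩, -⟩ := M.g_spec hv
    have := congrArg M.ι h
    rw [map_add, map_one, hgy, map_zero] at this
    have : (1 : ℝ) + y = 0 := by exact_mod_cast this
    linarith
  obtain ⟨c, b, h1, h2⟩ := M.exists_coords hπ hgF
  -- Norm 1 means that the conjugate of g is its inverse, so (1 + g)² = g(2 + Tr g) and g is
  -- rational up to squares.
  have hsq : (1 + M.g v) ^ 2 = M.g v * ((2 + 2 * c : ℚ) : L) := by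
    push_cast
    have : (2 * c : L) = M.g v + M.σ π (M.g v) := by rw [h2]; conv_rhs => rw [h1]
                                                     ring
    rw [this]
    linear_combination -hg
  have ht : ((2 + 2 * c : ℚ) : L) ≠ 0 := by
    intro h
    rw [h, mul_zero] at hsq
    exact hg1 (pow_eq_zero_iff two_ne_zero |>.1 hsq)
  obtain ⟨n, hnsq, γ, hγ, hgγ, hnl⟩ := M.exists_squarefree (S := stab v) (α := M.g v)
    (β := 1 + M.g v) (t := (2 + 2 * c)⁻¹) hgU (FixBy.one.add hgF) (by
      rw [hsq, Rat.cast_inv, mul_comm (M.g v), inv_mul_cancel_left₀ ht])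
  have hprime : ∀ l : ℕ, l.Prime → (l : ℤ) ∣ n →
      (l = 2 ∧ v.2.1 = 1) ∨ (l = p ∧ v.2.2.1 = 1) ∨ (l = q ∧ v.2.2.2 = 1) := by
    intro l hl hln
    by_cases hd : (l : ℤ) ∣ disc p q v
    · exact M.eq_of_prime_dvd_disc hl hd
    · exfalso
      refine hnl l hl ?_ hln
      by_cases hl2 : l = 2
      · subst hl2
        rcases zmod_two_cases v.2.1 with h | h
        · obtain ⟨k, hk⟩ := M.disc_mod_four hv1 h
          exact M.unram_stab_two hv0 hk
        · exact absurd ((dvd_disc v).1 h) hd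
      · exact M.unram_stab hv0 hl hl2 hd
  obtain ⟨w, hw, hwn⟩ := M.exists_disc_eq hnsq fun l hl hln => by
    rcases hprime l hl hln with h | h | h
    · exact Or.inl h.1
    · exact Or.inr (Or.inl h.1)
    · exact Or.inr (Or.inr h.1)
  have hdn : ∀ l : ℤ, l ∣ disc p q w → l ∣ n := by
    intro l hl
    rcases hwn with h | h <;> rw [h]
    · exact hl
    · exact (dvd_neg).2 hl
  have hp := M.p_mod
  have hq := M.q_mod
  have hsub : Sub w v := by
    refine ⟨fun h => ?_, fun h => ?_, fun h => ?_⟩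
    · rcases hprime 2 Nat.prime_two (hdn _ ((dvd_disc w).1 h)) with h | h | h
      · exact h.2
      · omega
      · omega
    · rcases hprime p M.prime_p (hdn _ ((dvd_disc w).2.1 h)) with h | h | h
      · omega
      · exact h.2
      · omega
    · rcases hprime q M.prime_q (hdn _ ((dvd_disc w).2.2 h)) with h | h | h
      · omega
      · omega
      · exact h.2
  obtain ⟨s, hs, hsg⟩ : ∃ s : L, (s = 1 ∨ s = -1) ∧ (M.r w * γ) ^ 2 = s * M.g v := by
    rcases hwn with h | h
    · refine ⟨1, Or.inl rfl, ?_⟩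
      rw [mul_pow, M.r_sq, hgγ, h, one_mul]
    · refine ⟨-1, Or.inr rfl, ?_⟩
      rw [mul_pow, M.r_sq, hgγ, h]; push_cast; ring
  -- If `r w` lay in ℚ(r v), as for w = 0 and w = v, then ±g would be the square of a unit of that
  -- field, which a fundamental unit is not.
  have hnf : ¬ M.FixBy (stab v) (M.r w) := by
    intro hf
    have hU : IsU (M.r w * γ) := by
      apply IsU.of_sq
      rw [hsg]
      rcases hs with rfl | rfl
      · rw [one_mul]; exact hgU
      · rw [neg_one_mul]; exact hgU.neg
    obtain ⟨m, hm⟩ := (M.g_spec hv).2.2.2 _ (hf.mul hγ) hU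
    have h3 : M.g v ^ (2 * m) = s * M.g v ^ (1 : ℤ) := by
      rw [zpow_one, ← hsg, mul_comm 2 m, zpow_mul]
      rcases hm with h | h <;> rw [h]
      · norm_cast
      · rw [neg_sq]; norm_cast
    have := M.g_zpow_inj hv hs h3
    omega
  refine ⟨w, hw, ?_, ?_, hsub, γ, s, hγ, hs, hsg⟩
  · rintro rfl
    exact hnf fun a _ => M.σ_r_zero (by simp [dot])
  · rintro rfl
    exact hnf (M.fixBy_r w)

lemma squarefree_of_dvd (M : Frame L p q) {d : ℕ} (hd : d ∣ 2 * p * q) : Squarefree (d : ℤ) :=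
  Int.squarefree_natCast.2
    (Squarefree.squarefree_of_dvd hd (squarefree_two_mul_mul M.prime_p M.prime_q M.p_mod M.q_mod))

/-- The norm equation satisfied by a square root of a multiple of a unit. -/
lemma exists_norm_eq {v w : Vec} (hv0 : v ≠ 0) (hD : Squarefree (disc p q v))
    (hn : M.nrm v = 1) {β s : L} (hβ : M.FixBy (stab v) β) (hs : s = 1 ∨ s = -1)
    (h : (M.r w * β) ^ 2 = s * M.g v) :
    ∃ A B e : ℤ, (e = 1 ∨ e = -1) ∧ A ^ 2 - disc p q v * B ^ 2 = 4 * (e * disc p q w) := by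
  obtain ⟨π, hπ⟩ := exists_dot_eq_one hv0
  have hg := M.g_mul_σ hπ
  rw [hn, Int.cast_one] at hg
  -- This z has square ±disc(w)·g, so its norm is ±disc(w). It is integral, and the equation is the
  -- norm of z = (A ± B·r v)/2.
  set z : L := disc p q w * β with hz
  have hz2 : z ^ 2 = disc p q w * (s * M.g v) := by
    rw [← h, hz, ← M.r_sq w]; ring
  have hzF : M.FixBy (stab v) z := (M.fixBy_int _ _).mul hβ
  have hsI : IsIntegral ℤ s := by
    rcases hs with rfl | rfl
    · exact isIntegral_one
    · exact isIntegral_one.neg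
  have hzI : IsIntegral ℤ z := by
    apply IsIntegral.of_pow two_pos
    rw [hz2]
    exact (isIntegral_intCast _).mul (hsI.mul (M.isU_g v).2.1)
  obtain ⟨c, b, h1, h2⟩ := M.exists_coords hπ hzF
  obtain ⟨A, hA⟩ := M.trace_int hπ hzF hzI
  have hAc : 2 * c = A := by
    have : ((2 * c : ℚ) : L) = ((A : ℚ) : L) := by
      rw [h2] at hA
      rw [h1] at hA
      push_cast
      rw [← hA]; ring
    exact_mod_cast this
  have hsσ : M.σ π s = s := by rcases hs with rfl | rfl <;> simp
  have hN : (z * M.σ π z) ^ 2 = (disc p q w : L) ^ 2 := by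
    rw [mul_pow, ← map_pow, hz2, map_mul, map_mul, hsσ, map_intCast]
    have : s ^ 2 = 1 := sq_pm_one hs
    linear_combination (disc p q w : L) ^ 2 * s ^ 2 * hg + (disc p q w : L) ^ 2 * this
  obtain ⟨e, he, hNe⟩ : ∃ e : ℤ, (e = 1 ∨ e = -1) ∧ z * M.σ π z = ((e * disc p q w : ℤ) : L) := by
    rcases sq_eq_sq_iff_eq_or_eq_neg.1 hN with h | h
    · exact ⟨1, Or.inl rfl, by rw [h]; push_cast; ring⟩
    · exact ⟨-1, Or.inr rfl, by rw [h]; push_cast; ring⟩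
  have hcb : c ^ 2 - b ^ 2 * disc p q v = e * disc p q w := by
    have : ((c ^ 2 - b ^ 2 * disc p q v : ℚ) : L) = ((e * disc p q w : ℚ) : L) := by
      have h3 : z * M.σ π z = (c : L) ^ 2 - b ^ 2 * disc p q v := by
        rw [h2, ← M.r_sq v]
        conv_lhs => rw [h1]
        ring
      push_cast
      rw [← h3, hNe]; push_cast; ring
    exact_mod_cast this
  -- The integer 2b·disc has a square divisible by the squarefree disc, so 2b is itself an integer.
  have hm2 : (2 * b * disc p q v) ^ 2 =
      (((A ^ 2 - 4 * (e * disc p q w)) * disc p q v : ℤ) : ℚ) := by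
    push_cast
    rw [← hAc]
    linear_combination (-4 * disc p q v : ℚ) * hcb
  obtain ⟨m, hm⟩ := rat_int_of_sq hm2
  rw [hm] at hm2
  have hm2' : m ^ 2 = (A ^ 2 - 4 * (e * disc p q w)) * disc p q v := by exact_mod_cast hm2
  obtain ⟨B, rfl⟩ := (hD.dvd_pow_iff_dvd two_ne_zero).1 ⟨_, hm2'.trans (mul_comm _ _)⟩
  refine ⟨A, B, e, he, ?_⟩
  apply mul_left_cancel₀ (M.disc_ne_zero v)
  linear_combination -hm2'

/-- A prime discriminant has no proper divisor of the kind that `exists_sqrt_of_nrm_one` provides.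
-/
lemma nrm_of_prime {v : Vec} (hv : v = e₁ ∨ v = e₂ ∨ v = e₃) : M.nrm v = -1 := by
  rcases M.nrm_pm_one v with h | h
  · exfalso
    have hR : v ∈ realIdx := by rcases hv with rfl | rfl | rfl <;> decide
    obtain ⟨w, h1, h2, h3, h4, -⟩ := M.exists_sqrt_of_nrm_one hR h
    have key : ∀ v ∈ ({e₁, e₂, e₃} : Finset Vec), ∀ w : Vec,
      ¬ (w.1 = 0 ∧ w ≠ 0 ∧ w ≠ v ∧ Sub w v) := by decide
    exact key v (by simpa using hv) w ⟨h1, h2, h3, h4⟩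
  · exact h

/-- Norm 1 would solve the norm equation for ℚ(√(2q)) with ±2 or ±q, and either makes 2 or -2 a
square modulo q. -/
lemma nrm_two_q : M.nrm (0, 1, 0, 1) = -1 := by
  rcases M.nrm_pm_one (0, 1, 0, 1) with h | h
  · exfalso
    obtain ⟨w, h1, h2, h3, h4, β, s, hβ, hs, hβg⟩ := M.exists_sqrt_of_nrm_one (by decide) h
    have key : ∀ w : Vec, w.1 = 0 ∧ w ≠ 0 ∧ w ≠ (0, 1, 0, 1) ∧ Sub w (0, 1, 0, 1) →
      w = e₁ ∨ w = e₃ := by decide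
    have hd : disc p q (0, 1, 0, 1) = 2 * q := by simp [disc, ZMod.val_one]
    obtain ⟨A, B, e, he, hAB⟩ := M.exists_norm_eq (by decide) (by
      rw [hd]
      have := M.squarefree_of_dvd (d := 2 * q) ⟨p, by ring⟩
      exact_mod_cast this) h hβ hs hβg
    rw [hd] at hAB
    rcases key w ⟨h1, h2, h3, h4⟩ with rfl | rfl
    · rw [disc_e₁] at hAB
      exact M.no_norm_two he hAB
    · rw [disc_e₃] at hAB
      have : Fact q.Prime := ⟨M.prime_q⟩
      exact M.no_norm_half (A := A) (B := B) (m := 1) (by simp) he (by linear_combination hAB)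
  · exact h

/-- The possible square classes of the fundamental unit of `ℚ(√(2pq))`. -/
lemma sqrt_two_p_q (h : M.nrm (0, 1, 1, 1) = 1) :
    ∃ w : Vec, (w = e₂ ∨ w = (0, 1, 0, 1)) ∧ ∃ β s : L, M.FixBy (stab (0, 1, 1, 1)) β ∧
      (s = 1 ∨ s = -1) ∧ (M.r w * β) ^ 2 = s * M.g (0, 1, 1, 1) := by
  obtain ⟨w, h1, h2, h3, h4, β, s, hβ, hs, hβg⟩ := M.exists_sqrt_of_nrm_one (by decide) h
  refine ⟨w, ?_, β, s, hβ, hs, hβg⟩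
  have key : ∀ w : Vec, w.1 = 0 ∧ w ≠ 0 ∧ w ≠ (0, 1, 1, 1) →
    w = e₁ ∨ w = e₂ ∨ w = e₃ ∨ w = (0, 1, 1, 0) ∨ w = (0, 1, 0, 1) ∨ w = (0, 0, 1, 1) := by decide
  have hd : disc p q (0, 1, 1, 1) = 2 * p * q := by simp [disc, ZMod.val_one]
  obtain ⟨A, B, e, he, hAB⟩ := M.exists_norm_eq (by decide) (by
    rw [hd]
    have := M.squarefree_of_dvd (d := 2 * p * q) dvd_rfl
    exact_mod_cast this) h hβ hs hβg
  rw [hd] at hAB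
  -- The survivors p and 2q are the same class, their product 2pq being a square in ℚ(√(2pq)).
  rcases key w ⟨h1, h2, h3⟩ with rfl | rfl | rfl | rfl | rfl | rfl
  · rw [disc_e₁] at hAB
    exact (M.no_norm_two he hAB).elim
  · exact Or.inl rfl
  · rw [disc_e₃] at hAB
    exact (M.no_norm_q he hAB).elim
  · have hd' : disc p q (0, 1, 1, 0) = 2 * p := by simp [disc, ZMod.val_one]
    rw [hd'] at hAB
    exact (M.no_norm_two_p he hAB).elim
  · exact Or.inr rfl
  · have hd' : disc p q (0, 0, 1, 1) = p * q := by simp [disc, ZMod.val_one]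
    rw [hd'] at hAB
    exact (M.no_norm_half (m := p) (by simpa using M.p_ne_zero_q) he hAB).elim

end Frame

/-! ### One parity decides all: the exponents at 2p, pq, 2pq -/

-- In the Fano plane of real indices, a is the line through u and v, and c vanishes at its third
-- point only. So `even_line` isolates any two exponents.
set_option synthInstance.maxSize 1000 in
lemma exists_line {u v : Vec} (hu : u ∈ realIdx) (hv : v ∈ realIdx) (huv : u ≠ v) :
    ∃ a ∈ realIdx, ∃ c ∈ Frame.realAut,
      ∀ w ∈ realIdx, ((dot c w = 1 ∧ dot a w = 0) ↔ (w = u ∨ w = v)) := by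
  have key : ∀ u ∈ realIdx, ∀ v ∈ realIdx, u ≠ v → ∃ a ∈ realIdx, ∃ c ∈ Frame.realAut,
      ∀ w ∈ realIdx, ((dot c w = 1 ∧ dot a w = 0) ↔ (w = u ∨ w = v)) := by
    unfold realIdx Frame.realAut; decide
  exact key u hu v hv huv

/-- The indices of the fields whose fundamental unit may have norm `1`. -/
def ramIdx : Finset Vec := {(0, 1, 1, 0), (0, 0, 1, 1), (0, 1, 1, 1)}

/-- The indices of the automorphisms defining the lines that meet `ramIdx` in two elements. -/
def lineIdx : Finset Vec := {(0, 0, 1, 1), (0, 1, 1, 0), (0, 1, 1, 1)}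

lemma ramIdx_subset : ramIdx ⊆ realIdx := by decide

lemma lineIdx_subset : lineIdx ⊆ realIdx := by decide

/-- The Hamming relation expressing an index through `√2`, `√p`, `√q`. -/
def suppIdx (v : Vec) : Finset Vec := insert v (({e₁, e₂, e₃} : Finset Vec).filter (fun w => Frame.Sub w v))

namespace Frame

variable {L : Type*} [Field L] [CharZero L] {p q : ℕ} (M : Frame L p q)

lemma mem_ramIdx_of_nrm {v : Vec} (hv : v ∈ realIdx) (h : M.nrm v = 1) : v ∈ ramIdx := by
  have key : ∀ v ∈ realIdx, v ∈ ramIdx ∨ v = (0, 1, 0, 1) ∨ v = e₁ ∨ v = e₂ ∨ v = e₃ := by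
    decide
  rcases key v hv with h1 | h1 | h1
  · exact h1
  · rw [h1, M.nrm_two_q] at h; norm_num at h
  · rw [M.nrm_of_prime h1] at h; norm_num at h

/-- Parity condition on a pair of exponents. -/
lemma even_pair {u v : Vec} (hu : u ∈ realIdx) (hv : v ∈ realIdx) (huv : u ≠ v) {k : L}
    (hk : IsU k) (hk' : M.σ e₀ k = k) :
    Even ((if M.nrm u = -1 then M.expo u k else 0) + (if M.nrm v = -1 then M.expo v k else 0)) := by
  obtain ⟨a, ha, c, -, hac⟩ := exists_line hu hv huv
  have h := M.even_line ha hk hk' c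
  rw [← Finset.sum_filter, Finset.filter_filter] at h
  have : realIdx.filter (fun w => (dot c w = 1 ∧ M.nrm w = -1) ∧ dot a w = 0) =
      ({u, v} : Finset Vec).filter (fun w => M.nrm w = -1) := by
    ext w
    simp only [Finset.mem_filter, Finset.mem_insert, Finset.mem_singleton]
    constructor
    · rintro ⟨hw, ⟨h1, h2⟩, h3⟩
      exact ⟨(hac w hw).1 ⟨h1, h3⟩, h2⟩
    · rintro ⟨hw, h2⟩
      have hwR : w ∈ realIdx := by rcases hw with rfl | rfl <;> assumption
      have := (hac w hwR).2 hw
      exact ⟨hwR, ⟨this.1, h2⟩, this.2⟩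
  rw [this, Finset.sum_filter, Finset.sum_pair huv] at h
  exact h

/-- In `even_pair` the index of norm 1 drops out. -/
lemma even_of_nrm {u v : Vec} (hu : u ∈ realIdx) (hv : v ∈ realIdx) (hnu : M.nrm u = -1)
    (hnv : M.nrm v = 1) {k : L} (hk : IsU k) (hk' : M.σ e₀ k = k) : Even (M.expo u k) := by
  have huv : u ≠ v := by rintro rfl; rw [hnu] at hnv; norm_num at hnv
  have h := M.even_pair hu hv huv hk hk'
  rw [if_pos hnu, if_neg (by rw [hnv]; norm_num), add_zero] at h
  exact h

set_option synthInstance.maxSize 1000 in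
/-- Square roots of fundamental units of norm `1`. -/
lemma exists_sqrt_g {v : Vec} (hv : v ∈ realIdx) (hn : M.nrm v = 1) :
    ∃ h s : L, (s = 1 ∨ s = -1) ∧ h ^ 2 = s * M.g v ∧ M.σ e₀ h = h ∧
      ∀ a ∈ lineIdx, dot a v = 0 → M.σ a h = -h := by
  have hmem := M.mem_ramIdx_of_nrm hv hn
  -- The root is `r w` times an element fixed by the stabilizer of v, so its sign under a is that of
  -- `r w`. For 2p and pq every proper divisor has sign -1; for 2pq the norm equations are needed to
  -- restrict w to p and 2q.
  obtain ⟨w, hw1, hwl, β, s, hβ, hs, hβg⟩ : ∃ w : Vec, w.1 = 0 ∧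
      (∀ a ∈ lineIdx, dot a v = 0 → dot a w = 1) ∧ ∃ β s : L, M.FixBy (stab v) β ∧
      (s = 1 ∨ s = -1) ∧ (M.r w * β) ^ 2 = s * M.g v := by
    by_cases h2pq : v = (0, 1, 1, 1)
    · subst h2pq
      obtain ⟨w, hw, h⟩ := M.sqrt_two_p_q hn
      refine ⟨w, ?_, ?_, h⟩
      · rcases hw with rfl | rfl <;> rfl
      · rcases hw with rfl | rfl <;> decide
    · obtain ⟨w, h1, h2, h3, h4, h⟩ := M.exists_sqrt_of_nrm_one hv hn
      refine ⟨w, h1, ?_, h⟩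
      have key : ∀ v ∈ ramIdx, v ≠ (0, 1, 1, 1) → ∀ w : Vec, (w.1 = 0 ∧ w ≠ 0 ∧ w ≠ v ∧ Sub w v) →
        ∀ a ∈ lineIdx, dot a v = 0 → dot a w = 1 := by decide
      exact key v hmem h2pq w ⟨h1, h2, h3, h4⟩
  refine ⟨M.r w * β, s, hs, hβg, ?_, fun a ha hav => ?_⟩
  · rw [map_mul, M.σ_r_zero (by simp [dot, hw1]), hβ e₀ (by
      simp [stab, dot, (mem_realIdx.1 hv).1])]
  · rw [map_mul, M.σ_r_one (hwl a ha hav), hβ a hav, neg_mul]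

/-- Supplies the roots required by `even_line_of_sqrt`. An even exponent is halved; an odd one
occurs only at norm 1, by `even_of_nrm`, where `exists_sqrt_g` gives a root that a negates. -/
lemma even_line_ram {a : Vec} (ha : a ∈ lineIdx) {v : Vec} (hv : v ∈ realIdx) (hn : M.nrm v = 1)
    {k : L} (hk : IsU k) (hk' : M.σ e₀ k = k) :
    Even (∑ w ∈ realIdx.filter (fun w => dot a w = 0), M.expo w k) := by
  have hφ : ∀ w : Vec, ∃ φ : L, w ∈ realIdx → dot a w = 0 → ∃ s : L, (s = 1 ∨ s = -1) ∧
      φ ^ 2 = s * M.g w ^ M.expo w k ∧ M.σ a φ = (-1) ^ M.expo w k * φ := by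
    intro w
    by_cases hw : w ∈ realIdx
    swap
    · exact ⟨0, fun h => absurd h hw⟩
    rcases Int.even_or_odd' (M.expo w k) with ⟨m, hm | hm⟩
    · refine ⟨M.g w ^ m, fun _ haw => ⟨1, Or.inl rfl, ?_, ?_⟩⟩
      · rw [hm, one_mul, mul_comm 2 m, zpow_mul]; norm_cast
      · rw [map_zpow₀, M.σ_g haw, hm, zpow_mul]; norm_num
    · have hnw : M.nrm w = 1 := by
        rcases M.nrm_pm_one w with h | h
        · exact h
        · have := M.even_of_nrm hw hv h hn hk hk'
          rw [hm] at this
          exact absurd this (by simp)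
      obtain ⟨h, s, hs, h1, -, h2⟩ := M.exists_sqrt_g hw hnw
      refine ⟨M.g w ^ m * h, fun _ haw => ⟨s, hs, ?_, ?_⟩⟩
      · have hg0 := (M.isU_g w).1
        rw [mul_pow, h1, hm, zpow_add₀ hg0, zpow_one, mul_comm 2 m, zpow_mul]
        norm_cast
        ring
      · rw [map_mul, map_zpow₀, M.σ_g haw, h2 a ha haw, hm,
          zpow_add₀ (neg_ne_zero.2 one_ne_zero), zpow_mul]
        norm_num
  choose φ hφ using hφ
  exact M.even_line_of_sqrt (lineIdx_subset ha) hk hk' φ hφ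

/-- The third index on the line through u and w lies outside `ramIdx`, so it has norm -1 and an even
exponent. The even sum over the line then carries the parity from u to w. -/
lemma even_ram_of_nrm_one {u v w : Vec} (hu : u ∈ ramIdx) (hw : w ∈ ramIdx) (hv : v ∈ realIdx)
    (hn : M.nrm v = 1) {k : L} (hk : IsU k) (hk' : M.σ e₀ k = k) (h : Even (M.expo u k)) :
    Even (M.expo w k) := by
  by_cases huw : u = w
  · rwa [← huw]
  have key : ∀ u ∈ ramIdx, ∀ w ∈ ramIdx, u ≠ w → ∃ a ∈ lineIdx, ∃ x ∈ realIdx, x ∉ ramIdx ∧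
      realIdx.filter (fun w => dot a w = 0) = {u, w, x} := by unfold realIdx; decide
  obtain ⟨a, ha, x, hx, hxr, hS⟩ := key u hu w hw huw
  have h1 := M.even_line_ram ha hv hn hk hk'
  have hux : u ≠ x := by rintro rfl; exact hxr hu
  have hwx : w ≠ x := by rintro rfl; exact hxr hw
  rw [hS, Finset.sum_insert (by simp [huw, hux]), Finset.sum_pair hwx] at h1
  have h2 : Even (M.expo x k) := by
    rcases M.nrm_pm_one x with h | h
    · exact absurd (M.mem_ramIdx_of_nrm hx h) hxr
    · exact M.even_of_nrm hx hv h hn hk hk'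
  have h3 := (Int.even_add.1 h1).1 h
  exact (Int.even_add.1 h3).2 h2

/-- All exponents of a real unit are even if one of those indexed by `ramIdx` is. -/
theorem even_expo_of_even {u : Vec} (hu : u ∈ ramIdx) {k : L} (hk : IsU k) (hk' : M.σ e₀ k = k)
    (h : Even (M.expo u k)) : ∀ v ∈ realIdx, Even (M.expo v k) := by
  intro v hv
  by_cases hex : ∃ w ∈ realIdx, M.nrm w = 1
  · obtain ⟨w, hw, hnw⟩ := hex
    rcases M.nrm_pm_one v with hnv | hnv
    · exact M.even_ram_of_nrm_one hu (M.mem_ramIdx_of_nrm hv hnv) hw hnw hk hk' h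
    · exact M.even_of_nrm hv hw hnv hnw hk hk'
  -- When all norms are -1, `even_pair` equates the parities of any two exponents.
  · push Not at hex
    have hall : ∀ w ∈ realIdx, M.nrm w = -1 := fun w hw =>
      (M.nrm_pm_one w).resolve_left (hex w hw)
    by_cases huv : u = v
    · rwa [← huv]
    · have := M.even_pair (ramIdx_subset hu) hv huv hk hk'
      rw [if_pos (hall _ (ramIdx_subset hu)), if_pos (hall v hv)] at this
      exact (Int.even_add.1 this).1 h

/-- All exponents of a real unit are even if the norms are not all equal. -/
theorem even_expo_of_nrm {u w : Vec} (hu : u ∈ ramIdx) (hw : w ∈ ramIdx) (hnu : M.nrm u = -1)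
    (hnw : M.nrm w = 1) {k : L} (hk : IsU k) (hk' : M.σ e₀ k = k) :
    ∀ v ∈ realIdx, Even (M.expo v k) :=
  M.even_expo_of_even hu hk hk'
    (M.even_of_nrm (ramIdx_subset hu) (ramIdx_subset hw) hnu hnw hk hk')

/-- The indices of the nontrivial products of `√2`, `√p`, `√q`. -/
def compIdx : Finset Vec := {(0, 1, 1, 0), (0, 1, 0, 1), (0, 0, 1, 1), (0, 1, 1, 1)}

set_option synthInstance.maxSize 1000 in
/-- A product of fundamental units that is a square has even exponents if the exponents at
composite indices are even. -/
lemma even_of_even_comp {x s : L} (hx : M.σ e₀ x = x) (hs : s = 1 ∨ s = -1) {b : Vec → ℤ}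
    (h : x ^ 2 = s * M.unitProd realIdx b) (hb : ∀ v ∈ compIdx, Even (b v)) :
    ∀ v ∈ realIdx, Even (b v) := by
  have key2 : ∀ v ∈ realIdx, v ∉ compIdx → (v = e₁ ∨ v = e₂ ∨ v = e₃) := by decide
  have key3 : ∀ v ∈ realIdx, v ∉ compIdx → dot v v = 1 ∧
      ∀ w ∈ realIdx, dot v w = 1 → w = v ∨ w ∈ compIdx := by decide
  intro v hv
  by_cases hvc : v ∈ compIdx
  · exact hb v hvc
  have hnv := M.nrm_of_prime (key2 v hv hvc)
  -- Take the prime index v itself as automorphism: besides v, of norm -1, it moves only composite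
  -- indices.
  have h1 := M.even_of_sq hx hs h v
  rw [← Finset.add_sum_erase (a := v) _ _ (by
    simp only [Finset.mem_filter]; exact ⟨hv, (key3 v hv hvc).1, hnv⟩)] at h1
  refine (Int.even_add.1 h1).2 ?_
  refine Finset.sum_induction _ Even (fun _ _ => Even.add) (by simp) fun w hw => ?_
  simp only [Finset.mem_erase, Finset.mem_filter] at hw
  rcases (key3 v hv hvc).2 w hw.2.1 hw.2.2.1 with h | h
  · exact absurd h hw.1
  · exact hb w h

/-- A product of fundamental units of norm `-1` whose conjugates have the same sign is a square in
the real subfield, up to sign. -/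
lemma exists_sqrt_prod {S : Finset Vec} (hn : ∀ v ∈ S, M.nrm v = -1)
    (hS : ∀ a : Vec, Even (S.filter (fun v => dot a v = 1)).card) :
    ∃ k s : L, (s = 1 ∨ s = -1) ∧ M.σ e₀ k = k ∧ k ^ 2 = s * ∏ v ∈ S, M.g v := by
  set α := ∏ v ∈ S, M.g v with hα
  have hαU : IsU α := IsU.prod _ _ fun v _ => M.isU_g v
  have hατ : M.σ e₀ α = α := by
    rw [hα, map_prod]; exact Finset.prod_congr rfl fun v _ => M.σ_e₀_g v
  -- In α·σ_a α the factors fixed by a give a square, and the others an even number of norms -1.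
  obtain ⟨t, β, htβ⟩ := M.exists_fixed_mul_sq hαU.1 fun a => by
    refine ⟨∏ v ∈ S.filter (fun v => dot a v = 0), M.g v, ?_, ?_⟩
    · rw [map_prod]
      exact Finset.prod_congr rfl fun v hv => M.σ_g (Finset.mem_filter.1 hv).2
    · have h1 : (1 : L) = ∏ v ∈ S.filter (fun v => dot a v = 1), (-1 : L) := by
        rw [Finset.prod_const, (hS a).neg_one_pow]
      rw [hα, map_prod, ← Finset.prod_mul_distrib, ← mul_one (_ ^ 2), h1, ← Finset.prod_pow,
        Finset.prod_filter, Finset.prod_filter, ← Finset.prod_mul_distrib]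
      refine Finset.prod_congr rfl fun v hv => ?_
      rcases zmod_two_cases (dot a v) with h | h
      · rw [M.σ_g h, h]; simp [sq]
      · rw [M.g_mul_σ h, h, hn v hv]; simp
  -- Only 2, p, q can divide n, and ± any product of them has a square root in L.
  obtain ⟨n, hnsq, γ, -, hαγ, hnl⟩ := M.exists_squarefree (S := ∅) hαU
    (fun a ha => ha.elim) htβ
  obtain ⟨w, -, hw⟩ := M.exists_disc_eq hnsq fun l hl hln => by
    by_contra hne
    push Not at hne
    exact hnl l hl (M.unram_empty hl hne.1 hne.2.1 hne.2.2) hln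
  obtain ⟨s, hs, hsx⟩ : ∃ s : L, (s = 1 ∨ s = -1) ∧ (M.r w * γ) ^ 2 = s * α := by
    rcases hw with h | h
    · exact ⟨1, Or.inl rfl, by rw [mul_pow, M.r_sq, hαγ, h, one_mul]⟩
    · refine ⟨-1, Or.inr rfl, ?_⟩
      rw [mul_pow, M.r_sq, hαγ, h]; push_cast; ring
  have hsτ : M.σ e₀ (s * α) = s * α := by
    rw [map_mul, hατ]; rcases hs with rfl | rfl <;> simp
  obtain ⟨y, s', hs', hy, hy2⟩ := M.exists_real_sqrt hsτ hsx
  exact ⟨y, s' * s, pm_one_mul hs' hs, hy, by rw [hy2]; ring⟩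

/-- Real units whose squares are independent products of fundamental units. -/
lemma exists_unit_comp {v : Vec} (hv : v ∈ compIdx) :
    ∃ k : L, IsU k ∧ M.σ e₀ k = k ∧ ∃ b : Vec → ℤ, (∀ w ∈ realIdx, M.expo w k = 2 * b w) ∧
      b v = 1 ∧ ∀ w ∈ compIdx, w ≠ v → b w = 0 := by
  have hcR : compIdx ⊆ realIdx := by decide
  obtain ⟨S, hSR, hvS, hSc, k, s, hs, hk, hk2⟩ : ∃ S ⊆ realIdx, v ∈ S ∧
      (∀ w ∈ compIdx, w ∈ S → w = v) ∧ ∃ k s : L, (s = 1 ∨ s = -1) ∧ M.σ e₀ k = k ∧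
      k ^ 2 = s * ∏ v ∈ S, M.g v := by
    rcases M.nrm_pm_one v with hn | hn
    · obtain ⟨h, s, hs, h1, h2, -⟩ := M.exists_sqrt_g (hcR hv) hn
      refine ⟨{v}, by simpa using hcR hv, Finset.mem_singleton_self v,
        fun w _ hw => Finset.mem_singleton.1 hw, h, s, hs, h2, ?_⟩
      rw [Finset.prod_singleton, h1]
    -- The index v is the sum of its prime indices, so every automorphism negates an even number of
    -- square roots attached to `suppIdx v`.
    · have key : ∀ v ∈ compIdx, suppIdx v ⊆ realIdx ∧ (∀ w ∈ compIdx, w ∈ suppIdx v → w = v) ∧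
        ∀ a : Vec, Even ((suppIdx v).filter (fun w => dot a w = 1)).card := by decide
      obtain ⟨h1, h2, h3⟩ := key v hv
      refine ⟨suppIdx v, h1, Finset.mem_insert_self _ _, h2, M.exists_sqrt_prod ?_ h3⟩
      intro w hw
      rcases Finset.mem_insert.1 hw with rfl | hw
      · exact hn
      · exact M.nrm_of_prime (by simpa using (Finset.mem_filter.1 hw).1)
  have hkU : IsU k := by
    apply IsU.of_sq
    rw [hk2]
    have : IsU (∏ v ∈ S, M.g v) := IsU.prod _ _ fun v _ => M.isU_g v
    rcases hs with rfl | rfl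
    · rwa [one_mul]
    · rw [neg_one_mul]; exact this.neg
  refine ⟨k, hkU, hk, fun w => if w ∈ S then 1 else 0, fun w hw => ?_, if_pos hvS,
    fun w hw hwv => if_neg fun h => hwv (hSc w hw h)⟩
  have h1 : k ^ (2 : ℤ) = s * M.unitProd S (fun _ => 1) := by
    unfold unitProd
    simp only [zpow_one]
    rw [← hk2]; norm_cast
  have h2 := congrArg (M.expo w) h1
  have hsU : IsU s := by rcases hs with rfl | rfl; exacts [IsU.one, IsU.one.neg]
  have hsτ : M.σ e₀ s = s := by rcases hs with rfl | rfl <;> simp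
  rw [M.expo_zpow hw hkU hk, M.expo_mul hw hsU hsτ (M.isU_unitProd _ _) (M.σ_e₀_unitProd _ _),
    M.expo_pm_one hw hs, M.expo_unitProd hw hSR] at h2
  simp only at h2 ⊢
  split_ifs at h2 ⊢ <;> omega

end Frame

/-! ### The index as a product of three layers -/

section Units

variable {L : Type*} [Field L]

lemma isU_coe (u : (𝓞 L)ˣ) : IsU ((u : 𝓞 L) : L) := by
  have h : ((u : 𝓞 L) : L) * (((u⁻¹ : (𝓞 L)ˣ) : 𝓞 L) : L) = 1 := by
    rw [← map_mul, Units.mul_inv, map_one]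
  refine ⟨left_ne_zero_of_mul_eq_one h, (u : 𝓞 L).2, ?_⟩
  rw [inv_eq_of_mul_eq_one_right h]
  exact ((u⁻¹ : (𝓞 L)ˣ) : 𝓞 L).2

lemma IsU.exists_unit {x : L} (hx : IsU x) : ∃ u : (𝓞 L)ˣ, ((u : 𝓞 L) : L) = x := by
  refine ⟨⟨⟨x, hx.2.1⟩, ⟨x⁻¹, hx.2.2⟩, ?_, ?_⟩, rfl⟩
  · exact NumberField.RingOfIntegers.ext (mul_inv_cancel₀ hx.1)
  · exact NumberField.RingOfIntegers.ext (inv_mul_cancel₀ hx.1)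

lemma coe_unit_mul (u v : (𝓞 L)ˣ) :
    (((u * v : (𝓞 L)ˣ) : 𝓞 L) : L) = ((u : 𝓞 L) : L) * ((v : 𝓞 L) : L) :=
  map_mul (algebraMap (𝓞 L) L) _ _

lemma coe_unit_inv (u : (𝓞 L)ˣ) : (((u⁻¹ : (𝓞 L)ˣ) : 𝓞 L) : L) = ((u : 𝓞 L) : L)⁻¹ := by
  apply eq_inv_of_mul_eq_one_left
  rw [← coe_unit_mul, inv_mul_cancel]
  exact map_one (algebraMap (𝓞 L) L)

lemma coe_unit_injective {u v : (𝓞 L)ˣ} (h : ((u : 𝓞 L) : L) = ((v : 𝓞 L) : L)) : u = v := by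
  apply Units.ext
  exact NumberField.RingOfIntegers.ext h

end Units

namespace Frame

variable {L : Type*} [Field L] [CharZero L] {p q : ℕ} (M : Frame L p q)

/-- The units of the real subfield. -/
def realUnits : Subgroup (𝓞 L)ˣ where
  carrier := {u | M.σ e₀ ((u : 𝓞 L) : L) = ((u : 𝓞 L) : L)}
  mul_mem' := by
    intro u v hu hv
    simp only [Set.mem_ofPred_eq] at hu hv ⊢
    rw [coe_unit_mul, map_mul, hu, hv]
  one_mem' := by simp
  inv_mem' := by
    intro u hu
    simp only [Set.mem_ofPred_eq] at hu ⊢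
    rw [coe_unit_inv, map_inv₀, hu]

lemma mem_realUnits {u : (𝓞 L)ˣ} :
    u ∈ M.realUnits ↔ M.σ e₀ ((u : 𝓞 L) : L) = ((u : 𝓞 L) : L) := Iff.rfl

/-- The subgroup of units generated by `√-1` and the fundamental units. -/
def IsQuadraticUnits (P : Subgroup (𝓞 L)ˣ) : Prop :=
  ∀ u : (𝓞 L)ˣ, u ∈ P ↔ ∃ (j : ℕ) (b : Vec → ℤ),
    ((u : 𝓞 L) : L) = M.r e₀ ^ j * M.unitProd realIdx b

variable {M} {P : Subgroup (𝓞 L)ˣ}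

/-- If a power of √-1 times a product of fundamental units is real, the power is ±1 and the
exponents are four times those of the product. The converse is `eq_unitProd`. -/
lemma mem_inf_iff (hP : M.IsQuadraticUnits P) {u : (𝓞 L)ˣ} (hu : u ∈ M.realUnits) :
    u ∈ P ↔ ∀ v ∈ realIdx, (4 : ℤ) ∣ M.expo v ((u : 𝓞 L) : L) := by
  rw [mem_realUnits] at hu
  constructor
  · intro h v hv
    obtain ⟨j, b, hjb⟩ := (hP u).1 h
    have hU := M.isU_unitProd realIdx b
    have hτ := M.σ_e₀_unitProd realIdx b
    have h1 : M.σ e₀ (M.r e₀ ^ j) = M.r e₀ ^ j := by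
      rw [hjb, map_mul, hτ] at hu
      exact mul_right_cancel₀ hU.1 hu
    have h2 : (M.r e₀ ^ j) ^ 2 = 1 ∨ (M.r e₀ ^ j) ^ 2 = -1 := by
      rw [← pow_mul, mul_comm, pow_mul, M.r_e₀_sq]
      exact neg_one_pow_eq_or L j
    have h3 := M.pm_one_of_sq h2 h1
    rw [hjb, M.expo_mul hv (M.isU_i.pow j) h1 hU hτ, M.expo_pm_one hv h3,
      M.expo_unitProd hv (Finset.Subset.refl _), if_pos hv, zero_add]
    exact dvd_mul_right _ _
  · intro h
    obtain ⟨s, hs, hsu⟩ := M.eq_unitProd (isU_coe u) hu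
      (b := fun v => M.expo v ((u : 𝓞 L) : L) / 4) fun v hv => (Int.mul_ediv_cancel' (h v hv)).symm
    refine (hP u).2 ?_
    rcases hs with rfl | rfl
    · exact ⟨0, _, by rw [pow_zero]; exact hsu⟩
    · exact ⟨2, _, by rw [M.r_e₀_sq]; exact hsu⟩

/-- For u = ζ^j·k with k real the condition reads (ζ⁴)^j = 1: j is even and ζ^j is a power of √-1.
-/
lemma mem_sup_iff (hP : M.IsQuadraticUnits P) (u : (𝓞 L)ˣ) :
    u ∈ P ⊔ M.realUnits ↔ ((u : 𝓞 L) : L) ^ 2 = (M.σ e₀ ((u : 𝓞 L) : L)) ^ 2 := by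
  constructor
  · intro h
    obtain ⟨x, hx, y, hy, rfl⟩ := Subgroup.mem_sup.1 h
    obtain ⟨j, b, hjb⟩ := (hP x).1 hx
    rw [mem_realUnits] at hy
    rw [coe_unit_mul, map_mul, hy, hjb, map_mul, M.σ_e₀_unitProd, map_pow,
      M.σ_r_one (a := e₀) (v := e₀) (by decide)]
    have : (-M.r e₀) ^ 2 = M.r e₀ ^ 2 := neg_sq _
    rw [mul_pow, mul_pow, mul_pow, mul_pow, ← pow_mul, ← pow_mul, mul_comm j, pow_mul, pow_mul, this]
  · intro h
    obtain ⟨j, k, hk, hk', hjk⟩ := M.exists_real_unit (isU_coe u)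
    have hζ := M.ζ_ne_zero
    have h4 : (M.ζ ^ 4) ^ j = 1 := by
      rw [hjk, map_mul, hk', map_pow, M.σ_ζ] at h
      have hk0 := hk.1
      have h5 : (M.ζ ^ j) ^ 2 = ((M.ζ⁻¹) ^ j) ^ 2 := by
        rw [mul_pow, mul_pow] at h
        exact mul_right_cancel₀ (pow_ne_zero 2 hk0) h
      have h6 : (M.ζ ^ j) ^ 2 * (M.ζ ^ j) ^ 2 = 1 := by
        nth_rewrite 2 [h5]
        rw [← mul_pow, ← mul_pow, mul_inv_cancel₀ hζ, one_pow, one_pow]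
      rw [← h6]; ring
    rw [M.ζ_pow_four] at h4
    have hj : Even j := by
      have : ((-1 : L)) ^ (j : ℤ) = 1 := by exact_mod_cast h4
      exact_mod_cast neg_one_zpow_eq_one this
    obtain ⟨l, rfl⟩ := hj
    rw [← two_mul, pow_mul, M.ζ_sq] at hjk
    obtain ⟨k', rfl⟩ := hk.exists_unit
    obtain ⟨w, hw⟩ := (M.isU_i.pow l).exists_unit
    have : u = w * k' := coe_unit_injective (by rw [coe_unit_mul, hw, hjk])
    rw [this]
    refine Subgroup.mul_mem_sup ((hP w).2 ⟨l, 0, ?_⟩) hk'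
    rw [hw]; simp [unitProd]

/-- The squares of a unit and of its conjugate agree up to sign, and multiplication by ζ flips that
sign. -/
lemma index_sup (hP : M.IsQuadraticUnits P) : (P ⊔ M.realUnits).index = 2 := by
  rw [Subgroup.index_eq_two_iff]
  obtain ⟨z, hz⟩ := M.isU_ζ.exists_unit
  refine ⟨z, fun b => ?_⟩
  rw [mem_sup_iff hP, mem_sup_iff hP, coe_unit_mul, map_mul, hz, M.σ_ζ]
  obtain ⟨j, k, hk, hk', hjk⟩ := M.exists_real_unit (isU_coe b)
  set x := ((b : 𝓞 L) : L) with hx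
  have hζ := M.ζ_ne_zero
  have hζ4 := M.ζ_pow_four
  have hσ0 : M.σ e₀ x ≠ 0 := ((isU_coe b).map (M.σ e₀)).1
  have h1 : x ^ 2 = (M.ζ ^ 4) ^ j * (M.σ e₀ x) ^ 2 := by
    rw [hjk, map_mul, hk', map_pow, M.σ_ζ, inv_pow]
    field_simp
    ring
  rw [hζ4] at h1
  have hinv : (M.ζ⁻¹) ^ 2 = - M.ζ ^ 2 := by
    field_simp
    linear_combination hζ4
  have hA : (x * M.ζ) ^ 2 = (M.σ e₀ x * M.ζ⁻¹) ^ 2 ↔ x ^ 2 = -(M.σ e₀ x) ^ 2 := by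
    rw [mul_pow, mul_pow, hinv]
    constructor
    · intro h
      apply mul_right_cancel₀ (pow_ne_zero 2 hζ)
      linear_combination h
    · intro h
      rw [h]; ring
  rw [hA]
  have hne : (M.σ e₀ x) ^ 2 ≠ -(M.σ e₀ x) ^ 2 := fun h => by
    have h2 : (2 : L) * (M.σ e₀ x) ^ 2 = 0 := by linear_combination h
    rcases mul_eq_zero.1 h2 with h | h
    · exact two_ne_zero h
    · exact pow_ne_zero 2 hσ0 h
  rcases neg_one_pow_eq_or L j with h | h <;> rw [h] at h1
  · rw [one_mul] at h1
    exact Or.inr ⟨h1, by rw [h1]; exact hne⟩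
  · rw [neg_one_mul] at h1
    exact Or.inl ⟨h1, by rw [h1]; exact hne.symm⟩

variable (M)

lemma expo_mul_units {v : Vec} (hv : v ∈ realIdx) (x y : M.realUnits) :
    M.expo v (((x * y : M.realUnits) : (𝓞 L)ˣ) : 𝓞 L) =
      M.expo v ((x : (𝓞 L)ˣ) : 𝓞 L) + M.expo v ((y : (𝓞 L)ˣ) : 𝓞 L) := by
  rw [Subgroup.coe_mul, coe_unit_mul]
  exact M.expo_mul hv (isU_coe _) x.2 (isU_coe _) y.2

/-- The parity of the exponents of a real unit. -/
noncomputable def parity : M.realUnits →* Multiplicative (ZMod 2) :=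
  MonoidHom.mk' (fun k => Multiplicative.ofAdd
    ((M.expo (0, 1, 1, 1) ((k : (𝓞 L)ˣ) : 𝓞 L) : ℤ) : ZMod 2)) fun x y => by
      rw [M.expo_mul_units (by decide), Int.cast_add, ofAdd_add]

/-- The single exponent at 2pq suffices, by `even_expo_of_even`. -/
lemma mem_ker_parity (k : M.realUnits) :
    k ∈ M.parity.ker ↔ ∀ v ∈ realIdx, Even (M.expo v ((k : (𝓞 L)ˣ) : 𝓞 L)) := by
  have h1 : k ∈ M.parity.ker ↔ Even (M.expo (0, 1, 1, 1) ((k : (𝓞 L)ˣ) : 𝓞 L)) := by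
    rw [MonoidHom.mem_ker]
    change Multiplicative.ofAdd _ = 1 ↔ _
    rw [ofAdd_eq_one, ZMod.intCast_zmod_eq_zero_iff_dvd, even_iff_two_dvd]
    rfl
  rw [h1]
  exact ⟨fun h => M.even_expo_of_even (by decide) (isU_coe _) k.2 h, fun h => h _ (by decide)⟩

/-- The exponents at composite indices of half a real unit of even exponents. -/
noncomputable def halfExpo : M.parity.ker →* Multiplicative Vec :=
  MonoidHom.mk' (fun k => Multiplicative.ofAdd
    (((M.expo (0, 1, 1, 0) (((k : M.realUnits) : (𝓞 L)ˣ) : 𝓞 L) / 2 : ℤ) : ZMod 2),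
      ((M.expo (0, 1, 0, 1) (((k : M.realUnits) : (𝓞 L)ˣ) : 𝓞 L) / 2 : ℤ) : ZMod 2),
      ((M.expo (0, 0, 1, 1) (((k : M.realUnits) : (𝓞 L)ˣ) : 𝓞 L) / 2 : ℤ) : ZMod 2),
      ((M.expo (0, 1, 1, 1) (((k : M.realUnits) : (𝓞 L)ˣ) : 𝓞 L) / 2 : ℤ) : ZMod 2))) fun x y => by
    have key : ∀ v ∈ realIdx,
        ((M.expo v ((((x * y : M.parity.ker) : M.realUnits) : (𝓞 L)ˣ) : 𝓞 L) / 2 : ℤ) : ZMod 2) =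
        ((M.expo v (((x : M.realUnits) : (𝓞 L)ˣ) : 𝓞 L) / 2 : ℤ) : ZMod 2) +
        ((M.expo v (((y : M.realUnits) : (𝓞 L)ˣ) : 𝓞 L) / 2 : ℤ) : ZMod 2) := by
      intro v hv
      rw [Subgroup.coe_mul, M.expo_mul_units hv,
        Int.add_ediv_of_dvd_left ((M.mem_ker_parity x).1 x.2 v hv).two_dvd, Int.cast_add]
    rw [← ofAdd_add, key _ (by decide), key _ (by decide), key _ (by decide), key _ (by decide)]
    rfl

lemma halfExpo_surjective : Function.Surjective M.halfExpo := by
  have hex : ∀ v ∈ compIdx, ∃ k : M.parity.ker, ∃ b : Vec → ℤ,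
      (∀ w ∈ realIdx, M.expo w (((k : M.realUnits) : (𝓞 L)ˣ) : 𝓞 L) / 2 = b w) ∧
      b v = 1 ∧ ∀ w ∈ compIdx, w ≠ v → b w = 0 := by
    intro v hv
    obtain ⟨k, hk, hk', b, hb, h1, h2⟩ := M.exists_unit_comp hv
    obtain ⟨u, rfl⟩ := hk.exists_unit
    refine ⟨⟨⟨u, hk'⟩, (M.mem_ker_parity _).2 fun w hw => ⟨b w, ?_⟩⟩, b, fun w hw => ?_, h1, h2⟩
    · rw [hb w hw]; ring
    · rw [hb w hw]; simp
  rw [← MonoidHom.range_eq_top, Subgroup.eq_top_iff']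
  have hgen : ∀ v ∈ ({(1, 0, 0, 0), (0, 1, 0, 0), (0, 0, 1, 0), (0, 0, 0, 1)} : Finset Vec),
      Multiplicative.ofAdd v ∈ M.halfExpo.range := by
    intro v hv
    simp only [Finset.mem_insert, Finset.mem_singleton] at hv
    have hR : compIdx ⊆ realIdx := by decide
    have hval : ∀ u ∈ compIdx, ∃ k : M.parity.ker, M.halfExpo k = Multiplicative.ofAdd
        ((if (0, 1, 1, 0) = u then 1 else 0, if (0, 1, 0, 1) = u then 1 else 0,
          if (0, 0, 1, 1) = u then 1 else 0, if (0, 1, 1, 1) = u then 1 else 0) : Vec) := by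
      intro u hu
      obtain ⟨k, b, hb, h1, h2⟩ := hex u hu
      refine ⟨k, ?_⟩
      have hc : ∀ w ∈ compIdx,
          ((M.expo w (((k : M.realUnits) : (𝓞 L)ˣ) : 𝓞 L) / 2 : ℤ) : ZMod 2) =
            if w = u then 1 else 0 := by
        intro w hw
        rw [hb w (hR hw)]
        split_ifs with h
        · rw [h, h1]; simp
        · rw [h2 w hw h]; simp
      change Multiplicative.ofAdd _ = _
      rw [hc _ (by decide), hc _ (by decide), hc _ (by decide), hc _ (by decide)]
    rcases hv with rfl | rfl | rfl | rfl
    · obtain ⟨k, hk⟩ := hval (0, 1, 1, 0) (by decide)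
      exact ⟨k, hk⟩
    · obtain ⟨k, hk⟩ := hval (0, 1, 0, 1) (by decide)
      exact ⟨k, hk⟩
    · obtain ⟨k, hk⟩ := hval (0, 0, 1, 1) (by decide)
      exact ⟨k, hk⟩
    · obtain ⟨k, hk⟩ := hval (0, 1, 1, 1) (by decide)
      exact ⟨k, hk⟩
  intro x
  have hx : x = Multiplicative.ofAdd ((x.toAdd.1, 0, 0, 0) : Vec) *
      Multiplicative.ofAdd ((0, x.toAdd.2.1, 0, 0) : Vec) *
      Multiplicative.ofAdd ((0, 0, x.toAdd.2.2.1, 0) : Vec) *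
      Multiplicative.ofAdd ((0, 0, 0, x.toAdd.2.2.2) : Vec) := by
    rw [← ofAdd_add, ← ofAdd_add, ← ofAdd_add]
    apply Multiplicative.toAdd.injective
    ext <;> simp
  have h0 : Multiplicative.ofAdd (0 : Vec) ∈ M.halfExpo.range := one_mem _
  rw [hx]
  refine mul_mem (mul_mem (mul_mem ?_ ?_) ?_) ?_
  · rcases zmod_two_cases x.toAdd.1 with h | h <;> rw [h]
    · exact h0
    · exact hgen _ (by decide)
  · rcases zmod_two_cases x.toAdd.2.1 with h | h <;> rw [h]
    · exact h0
    · exact hgen _ (by decide)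
  · rcases zmod_two_cases x.toAdd.2.2.1 with h | h <;> rw [h]
    · exact h0
    · exact hgen _ (by decide)
  · rcases zmod_two_cases x.toAdd.2.2.2 with h | h <;> rw [h]
    · exact h0
    · exact hgen _ (by decide)

/-- Up to sign x² is the product of the g_v to the halved exponents, so evenness at the four
composite indices spreads to the prime ones by `even_of_even_comp`. -/
lemma mem_ker_halfExpo (k : M.parity.ker) :
    k ∈ M.halfExpo.ker ↔
      ∀ v ∈ realIdx, (4 : ℤ) ∣ M.expo v (((k : M.realUnits) : (𝓞 L)ˣ) : 𝓞 L) := by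
  have hpar := (M.mem_ker_parity k).1 k.2
  have hhalf : ∀ v ∈ realIdx, (4 : ℤ) ∣ M.expo v (((k : M.realUnits) : (𝓞 L)ˣ) : 𝓞 L) ↔
      Even (M.expo v (((k : M.realUnits) : (𝓞 L)ˣ) : 𝓞 L) / 2) := by
    intro v hv
    have := (hpar v hv).two_dvd
    rw [even_iff_two_dvd]
    omega
  have h1 : k ∈ M.halfExpo.ker ↔
      ∀ v ∈ compIdx, Even (M.expo v (((k : M.realUnits) : (𝓞 L)ˣ) : 𝓞 L) / 2) := by
    rw [MonoidHom.mem_ker]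
    change Multiplicative.ofAdd _ = 1 ↔ _
    rw [ofAdd_eq_one]
    simp only [Prod.mk_eq_zero, ZMod.intCast_zmod_eq_zero_iff_dvd, compIdx, Finset.mem_insert,
      Finset.mem_singleton, forall_eq_or_imp, forall_eq, even_iff_two_dvd]
    rfl
  rw [h1]
  have hcR : compIdx ⊆ realIdx := by decide
  refine ⟨fun h => ?_, fun h v hv => (hhalf v (hcR hv)).1 (h v (hcR hv))⟩
  set x : L := ((((k : M.realUnits) : (𝓞 L)ˣ) : 𝓞 L) : L) with hx
  have hxU : IsU x := isU_coe _
  have hxτ : M.σ e₀ x = x := k.1.2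
  obtain ⟨s, hs, hsq⟩ := M.eq_unitProd (x := x ^ (2 : ℤ)) (hxU.zpow 2)
    (by rw [map_zpow₀, hxτ]) (b := fun v => M.expo v x / 2) fun v hv => by
      rw [M.expo_zpow hv hxU hxτ]
      have := (hpar v hv).two_dvd
      omega
  have := M.even_of_even_comp hxτ hs (by rw [← hsq]; norm_cast) h
  exact fun v hv => (hhalf v hv).2 (this v hv)

/-- The unit index of a multiquadratic field. -/
theorem index_eq (hP : M.IsQuadraticUnits P) : P.index = 32 * M.parity.ker.index := by
  -- The top layer P·E_{L⁺} ⊂ E_L contributes 2. The quotient P·E_{L⁺}/P is E_{L⁺}/(P ∩ E_{L⁺}),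
  -- which is split by the kernel of `parity`; the lower piece contributes 16.
  have h1 : P.relIndex (P ⊔ M.realUnits) * (P ⊔ M.realUnits).index = P.index :=
    Subgroup.relIndex_mul_index le_sup_left
  rw [index_sup hP, Subgroup.relIndex_sup_left] at h1
  have hle : P.subgroupOf M.realUnits ≤ M.parity.ker := by
    intro k hk
    rw [mem_ker_parity]
    intro v hv
    have := (mem_inf_iff hP k.2).1 (Subgroup.mem_subgroupOf.1 hk) v hv
    rw [even_iff_two_dvd]
    exact Dvd.dvd.trans (by norm_num) this
  have h2 := Subgroup.relIndex_mul_index hle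
  have h3 : (P.subgroupOf M.realUnits).subgroupOf M.parity.ker = M.halfExpo.ker := by
    ext k
    rw [Subgroup.mem_subgroupOf, Subgroup.mem_subgroupOf, mem_ker_halfExpo,
      mem_inf_iff hP k.1.2]
  have h4 : M.halfExpo.ker.index = 16 := by
    rw [Subgroup.index_ker, MonoidHom.range_eq_top.2 M.halfExpo_surjective,
      Subgroup.card_top]
    simp
  have h5 : (P.subgroupOf M.realUnits).relIndex M.parity.ker = 16 := by
    rw [← h4, ← h3]; rfl
  have h6 : P.relIndex M.realUnits = (P.subgroupOf M.realUnits).index := rfl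
  rw [h6, ← h2, h5] at h1
  omega

lemma index_parity : M.parity.ker.index = 1 ∨ M.parity.ker.index = 2 := by
  rw [Subgroup.index_ker]
  have h := Subgroup.card_subgroup_dvd_card M.parity.range
  have h2 : Nat.card (Multiplicative (ZMod 2)) = 2 := by simp
  rw [h2] at h
  exact (Nat.dvd_prime Nat.prime_two).1 h

lemma index_parity_of_nrm {u w : Vec} (hu : u ∈ ramIdx) (hw : w ∈ ramIdx) (hnu : M.nrm u = -1)
    (hnw : M.nrm w = 1) : M.parity.ker.index = 1 := by
  rw [Subgroup.index_eq_one, Subgroup.eq_top_iff']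
  exact fun k => (M.mem_ker_parity k).2 (M.even_expo_of_nrm hu hw hnu hnw (isU_coe _) k.2)

end Frame

/-! ### Construction of the frame on the concrete field -/

/-- Being a square makes disc positive; it is also squarefree, so it equals 1 and all its exponents
vanish. -/
lemma disc_eq_sq_imp {p q : ℕ} (hp : p.Prime) (hq : q.Prime) (hp8 : p % 8 = 1)
    (hq8 : q % 8 = 5) {v : Vec} {c : ℚ} (h : c ^ 2 = (disc p q v : ℤ)) : v = 0 := by
  obtain ⟨m, rfl⟩ := rat_int_of_sq h
  have hm : m ^ 2 = disc p q v := by exact_mod_cast h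
  have hp0 := hp.pos
  have hq0 := hq.pos
  have hv1 : v.1 = 0 := by
    rcases zmod_two_cases v.1 with h1 | h1
    · exact h1
    · exfalso
      have : disc p q v < 0 := by
        unfold disc
        rw [h1, ZMod.val_one, pow_one, mul_assoc, mul_assoc, neg_one_mul, neg_lt_zero]
        positivity
      rw [← hm] at this
      exact absurd this (not_lt.2 (sq_nonneg m))
  have hval : disc p q v =
      ((2 ^ v.2.1.val * p ^ v.2.2.1.val * q ^ v.2.2.2.val : ℕ) : ℤ) := by
    simp [disc, hv1]
  have hle : ∀ x : ZMod 2, x.val ≤ 1 := by decide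
  have hpow : ∀ (l : ℕ) (x : ZMod 2), l ^ x.val ∣ l := fun l x => by
    simpa using pow_dvd_pow l (hle x)
  have hsq : Squarefree (disc p q v) := by
    rw [hval]
    exact Int.squarefree_natCast.2 (Squarefree.squarefree_of_dvd
      (mul_dvd_mul (mul_dvd_mul (hpow 2 _) (hpow p _)) (hpow q _))
      (squarefree_two_mul_mul hp hq hp8 hq8))
  have hu : IsUnit m := hsq m ⟨1, by rw [← hm]; ring⟩
  have h1 : disc p q v = 1 := by
    rw [← hm]
    rcases Int.isUnit_iff.1 hu with rfl | rfl <;> rfl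
  rw [h1] at hval
  have hval' : 2 ^ v.2.1.val * p ^ v.2.2.1.val * q ^ v.2.2.2.val = 1 := by exact_mod_cast hval.symm
  have hz : ∀ (l : ℕ) (x : ZMod 2), 1 < l → l ^ x.val = 1 → x = 0 := by
    intro l x hl hx
    rcases zmod_two_cases x with h | h
    · exact h
    · rw [h, ZMod.val_one, pow_one] at hx; omega
  rw [mul_eq_one, mul_eq_one] at hval'
  ext1
  · exact hv1
  ext1
  · exact hz 2 _ (by norm_num) hval'.1.1
  ext1
  · exact hz p _ hp.one_lt hval'.1.2
  · exact hz q _ hq.one_lt hval'.2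

section Construction

variable (p q : ℕ)

/-- The generators of the multiquadratic field. -/
noncomputable def gens : Fin 4 → ℂ :=
  ![Complex.I, ((√2 : ℝ) : ℂ), ((√(p : ℝ) : ℝ) : ℂ), ((√(q : ℝ) : ℝ) : ℂ)]

/-- The squares of the generators. -/
def gensSq : Fin 4 → ℤ := ![-1, 2, p, q]

lemma range_gens : Set.range (gens p q) =
    {Complex.I, ((√2 : ℝ) : ℂ), ((√(p : ℝ) : ℝ) : ℂ), ((√(q : ℝ) : ℝ) : ℂ)} := by
  ext x
  simp only [gens, Set.mem_range, Fin.exists_fin_succ, Set.mem_insert_iff, Set.mem_singleton_iff]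
  simp [eq_comm]

lemma gens_mem (j : Fin 4) : gens p q j ∈ fieldL p q := by
  apply IntermediateField.subset_adjoin
  rw [← range_gens]
  exact Set.mem_range_self j

/-- The generators, as elements of the field. -/
noncomputable def gen (j : Fin 4) : fieldL p q := ⟨gens p q j, gens_mem p q j⟩

lemma gens_sq (j : Fin 4) : gens p q j ^ 2 = (gensSq p q j : ℂ) := by
  have h : ∀ x : ℕ, ((√(x : ℝ) : ℝ) : ℂ) ^ 2 = x := fun x => by
    rw [← Complex.ofReal_pow, Real.sq_sqrt (Nat.cast_nonneg x)]; simp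
  fin_cases j
  · simp [gens, gensSq]
  · simpa [gens, gensSq] using h 2
  · simpa [gens, gensSq] using h p
  · simpa [gens, gensSq] using h q

lemma gen_sq (j : Fin 4) : gen p q j ^ 2 = (gensSq p q j : fieldL p q) := by
  apply Subtype.ext
  have := gens_sq p q j
  simpa [gen] using this

variable {p q}

lemma gen_ne_zero (hp : p.Prime) (hq : q.Prime) (j : Fin 4) : gen p q j ≠ 0 := by
  intro h
  have h1 := gen_sq p q j
  rw [h, zero_pow two_ne_zero] at h1
  have h2 : gensSq p q j = 0 := by exact_mod_cast h1.symm
  have := hp.ne_zero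
  have := hq.ne_zero
  fin_cases j <;> simp [gensSq] at h2 <;> omega

instance isGalois_fieldL : IsGalois ℚ (fieldL p q) := by
  have hs : ∀ x ∈ ({Complex.I, ((√2 : ℝ) : ℂ), ((√(p : ℝ) : ℝ) : ℂ), ((√(q : ℝ) : ℝ) : ℂ)} : Set ℂ),
      IsIntegral ℚ x ∧ ((minpoly ℚ x).map (algebraMap ℚ (fieldL p q))).Splits := by
    intro x hx
    rw [← range_gens] at hx
    obtain ⟨j, rfl⟩ := hx
    have hroot : Polynomial.aeval (gens p q j)
        (Polynomial.X ^ 2 - Polynomial.C (gensSq p q j : ℚ)) = 0 := by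
      simp [gens_sq]
    have hmonic : (Polynomial.X ^ 2 - Polynomial.C (gensSq p q j : ℚ)).Monic :=
      Polynomial.monic_X_pow_sub_C _ two_ne_zero
    refine ⟨⟨_, hmonic, hroot⟩, ?_⟩
    refine Polynomial.Splits.of_dvd (g := (Polynomial.X ^ 2 - Polynomial.C (gensSq p q j : ℚ)).map
      (algebraMap ℚ (fieldL p q))) ?_ ?_ (Polynomial.map_dvd _ (minpoly.dvd ℚ _ hroot))
    · have : (Polynomial.X ^ 2 - Polynomial.C (gensSq p q j : ℚ)).map (algebraMap ℚ (fieldL p q)) =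
          (Polynomial.X - Polynomial.C (gen p q j)) * (Polynomial.X - Polynomial.C (-gen p q j)) := by
        have h := congrArg Polynomial.C (gen_sq p q j)
        simp only [Polynomial.map_sub, Polynomial.map_pow, Polynomial.map_X,
          map_pow, map_neg, map_intCast, Polynomial.map_intCast] at h ⊢
        rw [← h]
        ring
      rw [this]
      exact (Polynomial.Splits.X_sub_C _).mul (Polynomial.Splits.X_sub_C _)
    · exact (hmonic.map _).ne_zero
  have hint : ∀ x : fieldL p q, IsIntegral ℚ x := fun x => by
    have halg : Algebra.IsAlgebraic ℚ (fieldL p q) :=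
      IntermediateField.isAlgebraic_adjoin fun x hx => (hs x hx).1
    exact (halg.isAlgebraic x).isIntegral
  have hn : Normal ℚ (fieldL p q) := normal_iff.2 fun x => ⟨hint x, by
    have := IntermediateField.splits_of_mem_adjoin ℚ ℂ (L := fieldL p q) hs x.2
    rwa [show minpoly ℚ (x : ℂ) = minpoly ℚ x from
      minpoly.algebraMap_eq (algebraMap (fieldL p q) ℂ).injective x] at this⟩
  exact ⟨⟩

instance finiteDimensional_fieldL : FiniteDimensional ℚ (fieldL p q) := by
  apply IntermediateField.finiteDimensional_adjoin
  intro x hx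
  rw [← range_gens] at hx
  obtain ⟨j, rfl⟩ := hx
  exact ⟨_, Polynomial.monic_X_pow_sub_C (gensSq p q j : ℚ) two_ne_zero, by
    rw [← Polynomial.aeval_def]; simp [gens_sq]⟩

lemma algEquiv_ext {σ τ : fieldL p q ≃ₐ[ℚ] fieldL p q}
    (h : ∀ j, σ (gen p q j) = τ (gen p q j)) : σ = τ := by
  have : (σ : fieldL p q →ₐ[ℚ] fieldL p q) = τ := by
    refine IntermediateField.algHom_ext_of_eq_adjoin _ rfl fun x hx => ?_
    have hx' := hx
    rw [← range_gens] at hx'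
    obtain ⟨j, rfl⟩ := hx'
    exact h j
  ext x
  exact congrArg Subtype.val (DFunLike.congr_fun this x)

/-- The sign vector of an automorphism. -/
noncomputable def signs (σ : fieldL p q ≃ₐ[ℚ] fieldL p q) (j : Fin 4) : ZMod 2 :=
  open scoped Classical in if σ (gen p q j) = gen p q j then 0 else 1

lemma apply_gen (σ : fieldL p q ≃ₐ[ℚ] fieldL p q) (j : Fin 4) :
    σ (gen p q j) = (sgn (signs σ j) : fieldL p q) * gen p q j := by
  unfold signs
  split_ifs with h
  · simp [h]
  · have h1 : σ (gen p q j) ^ 2 = gen p q j ^ 2 := by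
      rw [← map_pow, gen_sq, map_intCast]
    rcases sq_eq_sq_iff_eq_or_eq_neg.1 h1 with h2 | h2
    · exact absurd h2 h
    · simp [h2]

lemma sgn_mul_injective {F : Type*} [Field F] [CharZero F] {x y : ZMod 2} {z : F} (hz : z ≠ 0)
    (h : (sgn x : F) * z = (sgn y : F) * z) : x = y := by
  have h1 : sgn x = sgn y := by exact_mod_cast mul_right_cancel₀ hz h
  have key : ∀ x y : ZMod 2, sgn x = sgn y → x = y := by decide
  exact key _ _ h1

lemma sgn_add (x y : ZMod 2) : sgn (x + y) = sgn x * sgn y := by revert x y; decide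

lemma signs_mul (hp : p.Prime) (hq : q.Prime) (σ τ : fieldL p q ≃ₐ[ℚ] fieldL p q) :
    signs (σ * τ) = signs σ + signs τ := by
  funext j
  refine sgn_mul_injective (gen_ne_zero hp hq j) ?_
  rw [← apply_gen, AlgEquiv.mul_apply, apply_gen τ, map_mul, map_intCast, apply_gen σ,
    Pi.add_apply, sgn_add]
  push_cast; ring

/-- The coordinates of an index. -/
def coords (v : Vec) : Fin 4 → ZMod 2 := ![v.1, v.2.1, v.2.2.1, v.2.2.2]

/-- The square roots in the field. -/
noncomputable def root (p q : ℕ) (v : Vec) : fieldL p q :=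
  gen p q 0 ^ v.1.val * gen p q 1 ^ v.2.1.val * gen p q 2 ^ v.2.2.1.val * gen p q 3 ^ v.2.2.2.val

lemma root_sq (v : Vec) : root p q v ^ 2 = (disc p q v : fieldL p q) := by
  have h : root p q v ^ 2 = (gen p q 0 ^ 2) ^ v.1.val * (gen p q 1 ^ 2) ^ v.2.1.val *
      (gen p q 2 ^ 2) ^ v.2.2.1.val * (gen p q 3 ^ 2) ^ v.2.2.2.val := by
    unfold root; ring
  rw [h]
  simp only [gen_sq]
  simp [disc, gensSq]

lemma apply_root (σ : fieldL p q ≃ₐ[ℚ] fieldL p q) (v : Vec) :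
    σ (root p q v) = (sgn (∑ j, signs σ j * coords v j) : fieldL p q) * root p q v := by
  have h : ∀ (j : Fin 4) (x : ZMod 2), σ (gen p q j ^ x.val) =
      (sgn (signs σ j * x) : fieldL p q) * gen p q j ^ x.val := by
    intro j x
    rcases zmod_two_cases x with rfl | rfl
    · simp
    · simp only [ZMod.val_one, pow_one, mul_one]
      exact apply_gen σ j
  unfold root
  rw [map_mul, map_mul, map_mul, h, h, h, h, Fin.sum_univ_four, sgn_add, sgn_add, sgn_add]
  simp only [coords]
  push_cast
  ring

lemma fixed_rat {x : fieldL p q} (h : ∀ σ : fieldL p q ≃ₐ[ℚ] fieldL p q, σ x = x) :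
    ∃ c : ℚ, x = c := by
  have := (IsGalois.mem_bot_iff_fixed x).2 h
  rw [IntermediateField.mem_bot] at this
  obtain ⟨c, hc⟩ := this
  exact ⟨c, by rw [← hc]; simp⟩

/-- Every sign vector comes from an automorphism. -/
lemma signs_surjective (hp : p.Prime) (hq : q.Prime) (hp8 : p % 8 = 1) (hq8 : q % 8 = 5) :
    Function.Surjective (signs (p := p) (q := q)) := by
  let f : Additive (fieldL p q ≃ₐ[ℚ] fieldL p q) →+ (Fin 4 → ZMod 2) :=
    AddMonoidHom.mk' (fun σ => signs σ.toMul) fun σ τ => signs_mul hp hq σ.toMul τ.toMul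
  let W : Submodule (ZMod 2) (Fin 4 → ZMod 2) := AddSubgroup.toZModSubmodule 2 f.range
  by_contra hns
  have hW : W < ⊤ := by
    rw [lt_top_iff_ne_top]
    intro hW
    apply hns
    intro s
    have : s ∈ W := by rw [hW]; trivial
    obtain ⟨σ, hσ⟩ := this
    exact ⟨σ.toMul, hσ⟩
  -- A proper subspace of sign vectors is killed by a nonzero functional, that is, by pairing with
  -- some v ≠ 0. Then `root p q v` is fixed by the whole Galois group, hence rational, although its
  -- square is not a rational square.
  obtain ⟨φ, hφ0, hφ⟩ := W.exists_le_ker_of_lt_top hW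
  set v : Vec := (φ (Pi.single 0 1), φ (Pi.single 1 1), φ (Pi.single 2 1), φ (Pi.single 3 1)) with hv
  have hφv : ∀ s, φ s = ∑ j, s j * coords v j := by
    intro s
    have h1 : s = ∑ j, s j • (Pi.single j 1 : Fin 4 → ZMod 2) := by
      funext i
      fin_cases i <;> simp [Fin.sum_univ_four]
    conv_lhs => rw [h1]
    rw [map_sum]
    refine Finset.sum_congr rfl fun j _ => ?_
    rw [map_smul, smul_eq_mul]
    congr 1
    fin_cases j <;> rfl
  have hfix : ∀ σ : fieldL p q ≃ₐ[ℚ] fieldL p q, σ (root p q v) = root p q v := by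
    intro σ
    have h1 : signs σ ∈ W := ⟨Additive.ofMul σ, rfl⟩
    have h2 : φ (signs σ) = 0 := hφ h1
    rw [apply_root, ← hφv, h2]
    simp
  obtain ⟨c, hc⟩ := fixed_rat hfix
  have h3 := root_sq (p := p) (q := q) v
  rw [hc] at h3
  have h4 : c ^ 2 = (disc p q v : ℤ) := by exact_mod_cast h3
  have h5 := disc_eq_sq_imp hp hq hp8 hq8 h4
  apply hφ0
  refine LinearMap.ext fun s => ?_
  rw [hφv, h5]
  simp [coords, Fin.sum_univ_four]

lemma sqrt_pow_val (m : ℕ) (x : ZMod 2) : √(m : ℝ) ^ x.val = √((m : ℝ) ^ x.val) := by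
  rcases zmod_two_cases x with rfl | rfl <;> simp [ZMod.val_one]

lemma val_root {v : Vec} (hv : v.1 = 0) :
    ((root p q v : fieldL p q) : ℂ) = ((√(disc p q v : ℝ) : ℝ) : ℂ) := by
  have h2 := sqrt_pow_val 2 v.2.1
  have hp := sqrt_pow_val p v.2.2.1
  have hq := sqrt_pow_val q v.2.2.2
  have h : √(disc p q v : ℝ) = √2 ^ v.2.1.val * √(p : ℝ) ^ v.2.2.1.val *
      √(q : ℝ) ^ v.2.2.2.val := by
    rw [hp, hq]
    have : (2 : ℝ) = ((2 : ℕ) : ℝ) := by norm_num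
    rw [this, h2, ← Real.sqrt_mul (by positivity), ← Real.sqrt_mul (by positivity)]
    simp [disc, hv]
  rw [h]
  simp [root, gen, gens, hv]

/-- The multiquadratic field with its square roots and its automorphisms. -/
noncomputable def frame (hp : p.Prime) (hq : q.Prime) (hp8 : p % 8 = 1) (hq8 : q % 8 = 5) :
    Frame (fieldL p q) p q :=
  have hex := signs_surjective hp hq hp8 hq8
  let s : Vec → (fieldL p q ≃ₐ[ℚ] fieldL p q) := fun a => (hex (coords a)).choose
  have hs : ∀ a, signs (s a) = coords a := fun a => (hex (coords a)).choose_spec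
  have hadd : ∀ a b, s (a + b) = s a * s b := fun a b => algEquiv_ext fun j => by
    rw [apply_gen, apply_gen, signs_mul hp hq, hs, hs, hs]
    congr 4
    simp only [coords]
    fin_cases j <;> rfl
  have hzero : s 0 = 1 := by
    have := hadd 0 0
    rw [add_zero] at this
    exact left_eq_mul.1 this
  { prime_p := hp
    prime_q := hq
    p_mod := hp8
    q_mod := hq8
    r := root p q
    σ := fun a => (s a).toRingEquiv
    σ_zero := fun x => by rw [hzero]; rfl
    σ_add := fun a b x => by rw [hadd]; rfl
    σ_r := fun a v => by
      have := apply_root (s a) v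
      rw [hs] at this
      simp only [Fin.sum_univ_four, coords] at this
      exact this
    r_sq := root_sq
    exists_rat := fun x hx => fixed_rat fun σ => by
      have : σ = s (signs σ 0, signs σ 1, signs σ 2, signs σ 3) := algEquiv_ext fun j => by
        rw [apply_gen, apply_gen, hs]
        congr 3
        fin_cases j <;> rfl
      rw [this]
      exact hx _
    ι := (algebraMap (fieldL p q) ℂ)
    ι_r := fun v hv => val_root hv }

end Construction

/-! ### Quadratic subfields and the product of their unit groups -/

section Quadratic

open Module

lemma finrank_adjoin_sqrt {F : Type*} [Field F] [Algebra ℚ F] {x : F} {d : ℚ}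
    (hx : x ^ 2 = algebraMap ℚ F d) (hd : ¬ IsSquare d) :
    finrank ℚ (IntermediateField.adjoin ℚ {x}) = 2 := by
  have hm := Polynomial.monic_X_pow_sub_C d two_ne_zero
  have hirr : Irreducible (Polynomial.X ^ 2 - Polynomial.C d) :=
    X_pow_sub_C_irreducible_of_prime Nat.prime_two fun b hb => hd ⟨b, by rw [← hb, sq]⟩
  have hroot : Polynomial.aeval x (Polynomial.X ^ 2 - Polynomial.C d) = 0 := by simp [hx]
  rw [IntermediateField.adjoin.finrank ⟨_, hm, hroot⟩,
    ← minpoly.eq_of_irreducible_of_monic hirr hroot hm, Polynomial.natDegree_X_pow_sub_C]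

variable {K : Type*} [Field K] [Algebra ℚ K]

lemma linearIndependent_one {y : K} (hy : ∀ c : ℚ, algebraMap ℚ K c ≠ y) :
    LinearIndependent ℚ ![1, y] :=
  (LinearIndependent.pair_iff' one_ne_zero).2 fun a h => hy a (by rw [← h, Algebra.smul_def, mul_one])

lemma exists_coords_of_finrank (h : finrank ℚ K = 2) {y : K} (hy : ∀ c : ℚ, algebraMap ℚ K c ≠ y)
    (x : K) : ∃ a b : ℚ, x = algebraMap ℚ K a + algebraMap ℚ K b * y := by
  have : FiniteDimensional ℚ K := finite_of_finrank_eq_succ h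
  have hs := (linearIndependent_one hy).span_eq_top_of_card_eq_finrank' (by simp [h])
  have hx : x ∈ Submodule.span ℚ (Set.range ![1, y]) := by rw [hs]; trivial
  rw [Matrix.range_cons, Matrix.range_cons, Matrix.range_empty, Set.union_empty,
    Set.singleton_union, Submodule.mem_span_pair] at hx
  obtain ⟨a, b, hab⟩ := hx
  exact ⟨a, b, by rw [← hab, Algebra.smul_def, Algebra.smul_def, mul_one]⟩

lemma norm_quadratic (h : finrank ℚ K = 2) {y : K} (hy : ∀ c : ℚ, algebraMap ℚ K c ≠ y) {d : ℚ}
    (hd : y ^ 2 = algebraMap ℚ K d) (a b : ℚ) :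
    Algebra.norm ℚ (algebraMap ℚ K a + algebraMap ℚ K b * y) = a ^ 2 - b ^ 2 * d := by
  have : FiniteDimensional ℚ K := finite_of_finrank_eq_succ h
  obtain ⟨B, hB⟩ : ∃ B : Basis (Fin 2) ℚ K, ∀ j, B j = ![1, y] j :=
    ⟨basisOfLinearIndependentOfCardEqFinrank (linearIndependent_one hy) (by simp [h]),
      fun j => by simp⟩
  have h0 : (algebraMap ℚ K a + algebraMap ℚ K b * y) * B 0 = a • B 0 + b • B 1 := by
    rw [hB, hB, Algebra.smul_def, Algebra.smul_def]
    simp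
  have h1 : (algebraMap ℚ K a + algebraMap ℚ K b * y) * B 1 = (b * d) • B 0 + a • B 1 := by
    rw [hB, hB, Algebra.smul_def, Algebra.smul_def, map_mul, ← hd]
    simp
    ring
  rw [Algebra.norm_eq_matrix_det B, Matrix.det_fin_two]
  simp only [Algebra.leftMulMatrix_eq_repr_mul, h0, h1, map_add, map_smul, Basis.repr_self,
    Finsupp.add_apply, Finsupp.smul_apply, smul_eq_mul]
  simp
  ring

/-- A quadratic field is generated by a square root. -/
lemma exists_sqrt_of_finrank (h : finrank ℚ K = 2) :
    ∃ δ : K, (∀ c : ℚ, algebraMap ℚ K c ≠ δ) ∧ ∃ D : ℚ, δ ^ 2 = algebraMap ℚ K D := by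
  have hex : ∃ y : K, ∀ c : ℚ, algebraMap ℚ K c ≠ y := by
    by_contra! hcon
    have : (⊥ : Subalgebra ℚ K) = ⊤ := by
      rw [eq_top_iff]
      exact fun y _ => hcon y
    have h1 := Subalgebra.finrank_bot (F := ℚ) (E := K)
    rw [this, subalgebra_top_finrank_eq_submodule_top_finrank, finrank_top, h] at h1
    omega
  obtain ⟨y, hy⟩ := hex
  obtain ⟨a, b, hab⟩ := exists_coords_of_finrank h hy (y ^ 2)
  -- Completing the square in y² = a + by.
  refine ⟨2 * y - algebraMap ℚ K b, fun c hc => hy ((c + b) / 2) ?_, 4 * a + b ^ 2, ?_⟩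
  · rw [map_div₀, map_add, hc, map_ofNat]
    have : CharZero K := algebraRat.charZero K
    field_simp
    ring
  · rw [map_add, map_mul, map_pow, map_ofNat]
    linear_combination 4 * hab

end Quadratic

section UnitsImage

variable {L : Type*} [Field L] [Algebra ℚ L]

variable (L) in
/-- The image of the units of a subfield. -/
abbrev unitsImage (k : IntermediateField ℚ L) : Subgroup (𝓞 L)ˣ :=
  (Units.map (algebraMap (𝓞 k) (𝓞 L)).toMonoidHom).range

lemma coe_mem_unitsImage {k : IntermediateField ℚ L} {x : (𝓞 L)ˣ} (hx : x ∈ unitsImage L k) :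
    ((x : 𝓞 L) : L) ∈ k := by
  obtain ⟨w, rfl⟩ := hx
  exact ((w : 𝓞 k) : k).2

lemma exists_mem_unitsImage {k : IntermediateField ℚ L} {x : L} (hxk : x ∈ k) (hxU : IsU x) :
    ∃ w ∈ unitsImage L k, ((w : 𝓞 L) : L) = x := by
  have hU : IsU (⟨x, hxk⟩ : k) := by
    refine ⟨fun h => hxU.1 (congrArg Subtype.val h), ?_, ?_⟩
    · exact (isIntegral_algebraMap_iff (A := k) (B := L) (algebraMap k L).injective).1 hxU.2.1
    · refine (isIntegral_algebraMap_iff (A := k) (B := L) (algebraMap k L).injective).1 ?_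
      rw [map_inv₀]
      exact hxU.2.2
  obtain ⟨w, hw⟩ := hU.exists_unit
  exact ⟨Units.map (algebraMap (𝓞 k) (𝓞 L)).toMonoidHom w, ⟨w, rfl⟩, congrArg Subtype.val hw⟩

end UnitsImage

namespace Frame

variable {L : Type*} [Field L] [CharZero L] {p q : ℕ} (M : Frame L p q)

/-- A non-rational element with rational square is a rational multiple of some `r v`. -/
lemma exists_eq_mul_r {δ : L} {D : ℚ} (hδ : δ ^ 2 = D) (hirr : ∀ c : ℚ, (c : L) ≠ δ) :
    ∃ v : Vec, v ≠ 0 ∧ ∃ c : ℚ, δ = c * M.r v := by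
  classical
  -- Each automorphism changes δ by a sign. Reading off the signs at the four generators gives v
  -- such that δ/(r v) is fixed by everything.
  let χ : Vec → ZMod 2 := fun a => if M.σ a δ = δ then 0 else 1
  have hχ : ∀ a, M.σ a δ = (sgn (χ a) : L) * δ := by
    intro a
    have h1 : M.σ a δ ^ 2 = δ ^ 2 := by rw [← map_pow, hδ, map_ratCast]
    by_cases h : M.σ a δ = δ
    · simp [χ, h]
    · rcases sq_eq_sq_iff_eq_or_eq_neg.1 h1 with h2 | h2
      · exact absurd h2 h
      · simp only [χ, if_neg h, sgn_one]
        rw [h2]; simp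
  set v : Vec := (χ e₀, χ e₁, χ e₂, χ e₃) with hv
  have hr := M.r_ne_zero v
  have hsq : ∀ x : ZMod 2, (sgn x : L) ≠ 0 := fun x hx => by
    have := sgn_mul_self x
    have hx' : sgn x = 0 := by exact_mod_cast hx
    rw [hx'] at this
    exact absurd this (by norm_num)
  have hfix : ∀ a, dot a v = χ a → M.σ a (δ * (M.r v)⁻¹) = δ * (M.r v)⁻¹ := by
    intro a ha
    have := hsq (χ a)
    rw [map_mul, map_inv₀, hχ, M.σ_r, ha]
    field_simp
  obtain ⟨c, hc⟩ := M.exists_rat _ (M.fixBy_all (hfix e₀ (by simp [dot, hv]))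
    (hfix e₁ (by simp [dot, hv])) (hfix e₂ (by simp [dot, hv])) (hfix e₃ (by simp [dot, hv])))
  have hδc : δ = c * M.r v := by rw [← hc]; field_simp
  refine ⟨v, fun hv0 => ?_, c, hδc⟩
  obtain ⟨b, hb⟩ := M.exists_rat (M.r v) fun a => M.σ_r_zero (by rw [hv0]; simp [dot])
  exact hirr (c * b) (by rw [hδc, hb]; push_cast; rfl)

lemma unitProd_single {v : Vec} (hv : v ∈ realIdx) (n : ℤ) :
    M.unitProd realIdx (Pi.single v n) = M.g v ^ n := by
  unfold unitProd
  rw [Finset.prod_eq_single v]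
  · simp
  · intro w _ hw
    simp [Pi.single_eq_of_ne hw]
  · exact fun h => absurd hv h

lemma unitProd_add (b c : Vec → ℤ) :
    M.unitProd realIdx (b + c) = M.unitProd realIdx b * M.unitProd realIdx c := by
  unfold unitProd
  rw [← Finset.prod_mul_distrib]
  exact Finset.prod_congr rfl fun v _ => by rw [Pi.add_apply, zpow_add₀ (M.isU_g v).1]

/-- Units of imaginary quadratic subfields are powers of `√-1`. -/
lemma imaginary_unit_eq {v : Vec} (hv : v.1 = 1) {x : L} (hx : M.FixBy (stab v) x) (hu : IsU x) :
    ∃ j : ℕ, x = M.r e₀ ^ j := by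
  have hπ : dot e₀ v = 1 := by simp [dot, hv]
  have hn : x * M.σ e₀ x = 1 := by
    rcases M.norm_pm_one hπ hx hu with h | h
    · exact h
    · exfalso
      obtain ⟨c, b, h1, h2⟩ := M.exists_coords hπ hx
      have h3 : ((c ^ 2 - b ^ 2 * disc p q v : ℚ) : L) = ((-1 : ℚ) : L) := by
        rw [h2, h1] at h
        push_cast
        rw [← M.r_sq v]
        linear_combination h
      have h4 : c ^ 2 - b ^ 2 * (disc p q v : ℚ) = -1 := Rat.cast_injective h3
      have h5 : disc p q v ≤ 0 := by
        unfold disc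
        rw [hv, ZMod.val_one, pow_one, mul_assoc, mul_assoc, neg_one_mul, neg_nonpos]
        positivity
      have h6 : (disc p q v : ℚ) ≤ 0 := by exact_mod_cast h5
      nlinarith [sq_nonneg c, mul_nonneg (sq_nonneg b) (neg_nonneg.2 h6)]
  rcases M.imaginary_unit hv hx hu hn with h | h
  · rcases mul_self_eq_one_iff.1 ((sq x).symm.trans h) with h | h
    · exact ⟨0, by rw [h, pow_zero]⟩
    · exact ⟨2, by rw [h, M.r_e₀_sq]⟩
  · rcases M.eq_of_sq_eq_neg_one h with h | h
    · exact ⟨1, by rw [h, pow_one]⟩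
    · exact ⟨3, by rw [h, pow_succ, M.r_e₀_sq, neg_one_mul]⟩

variable [Algebra ℚ L]

lemma exists_fixBy_of_finrank (k : IntermediateField ℚ L) (hk : Module.finrank ℚ k = 2) :
    ∃ v : Vec, v ≠ 0 ∧ ∀ x ∈ k, M.FixBy (stab v) x := by
  obtain ⟨δ, hδ, D, hD⟩ := @exists_sqrt_of_finrank k _ k.algebra' hk
  obtain ⟨v, hv, c, hc⟩ := M.exists_eq_mul_r (δ := (δ : L)) (D := D)
    (by simpa using congrArg (algebraMap k L) hD)
    (fun c hc => hδ c (Subtype.ext (by simpa using hc)))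
  refine ⟨v, hv, fun x hx => ?_⟩
  obtain ⟨a, b, hab⟩ := @exists_coords_of_finrank k _ k.algebra' hk _ hδ ⟨x, hx⟩
  have hx' : x = (a : L) + (b : L) * (c * M.r v) := by
    rw [← hc]
    simpa using congrArg (algebraMap k L) hab
  rw [hx']
  exact (FixBy.rat a).add ((FixBy.rat b).mul ((FixBy.rat c).mul (M.fixBy_r v)))

lemma finrank_adjoin_r {v : Vec} (hv : v ≠ 0) :
    Module.finrank ℚ (IntermediateField.adjoin ℚ {M.r v}) = 2 := by
  refine finrank_adjoin_sqrt (d := disc p q v) (by rw [M.r_sq]; simp) ?_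
  rw [Rat.isSquare_intCast_iff]
  exact M.not_isSquare_disc hv

lemma mem_adjoin_r {v : Vec} (hv : v ≠ 0) {x : L} (hx : M.FixBy (stab v) x) :
    x ∈ IntermediateField.adjoin ℚ {M.r v} := by
  obtain ⟨π, hπ⟩ := exists_dot_eq_one hv
  obtain ⟨c, b, h, -⟩ := M.exists_coords hπ hx
  rw [h]
  have hr := IntermediateField.mem_adjoin_simple_self ℚ (M.r v)
  have hq : ∀ c : ℚ, (c : L) ∈ IntermediateField.adjoin ℚ {M.r v} := fun c => by
    simp
  exact add_mem (hq c) (mul_mem (hq b) hr)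

/-- Every quadratic subfield is some ℚ(r v). Its units are ±g_v^n if it is real and powers of √-1 if
it is imaginary, and -1 is the square of √-1. -/
theorem isQuadraticUnits_iSup : M.IsQuadraticUnits
    (⨆ k : {k : IntermediateField ℚ L // Module.finrank ℚ k = 2},
      (Units.map (algebraMap (𝓞 k.1) (𝓞 L)).toMonoidHom).range) := by
  change M.IsQuadraticUnits
    (⨆ k : {k : IntermediateField ℚ L // Module.finrank ℚ k = 2}, unitsImage L k.1)
  obtain ⟨P, hP⟩ : ∃ P, P =
    ⨆ k : {k : IntermediateField ℚ L // Module.finrank ℚ k = 2}, unitsImage L k.1 := ⟨_, rfl⟩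
  have hle : ∀ k : IntermediateField ℚ L, Module.finrank ℚ k = 2 → unitsImage L k ≤ P :=
    fun k hk => hP ▸ le_iSup (fun k : {k : IntermediateField ℚ L // Module.finrank ℚ k = 2} =>
      unitsImage L k.1) ⟨k, hk⟩
  rw [← hP]
  intro u
  constructor
  · intro hu
    rw [hP] at hu
    refine Subgroup.iSup_induction _ (C := fun u : (𝓞 L)ˣ => ∃ (j : ℕ) (b : Vec → ℤ),
      ((u : 𝓞 L) : L) = M.r e₀ ^ j * M.unitProd realIdx b) hu ?_ ?_ ?_
    · rintro ⟨k, hk⟩ w hw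
      obtain ⟨v, hv, hfix⟩ := M.exists_fixBy_of_finrank k hk
      have hxF := hfix _ (coe_mem_unitsImage hw)
      have hxU : IsU ((w : 𝓞 L) : L) := isU_coe w
      rcases zmod_two_cases v.1 with hv1 | hv1
      · have hvR := mem_realIdx.2 ⟨hv1, hv⟩
        obtain ⟨n, hn | hn⟩ := (M.g_spec hvR).2.2.2 _ hxF hxU
        · exact ⟨0, Pi.single v n, by rw [M.unitProd_single hvR, hn, pow_zero, one_mul]⟩
        · exact ⟨2, Pi.single v n, by rw [M.unitProd_single hvR, hn, M.r_e₀_sq, neg_one_mul]⟩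
      · obtain ⟨j, hj⟩ := M.imaginary_unit_eq hv1 hxF hxU
        exact ⟨j, 0, by rw [hj]; simp [unitProd]⟩
    · exact ⟨0, 0, by simp [unitProd]⟩
    · rintro x y ⟨j, b, h⟩ ⟨j', b', h'⟩
      exact ⟨j + j', b + b', by rw [coe_unit_mul, h, h', unitProd_add, pow_add]; ring⟩
  · rintro ⟨j, b, h⟩
    have hquad : ∀ v ≠ 0, ∀ x, M.FixBy (stab v) x → IsU x →
        ∃ w ∈ P, ((w : 𝓞 L) : L) = x := by
      intro v hv x hx hxU
      obtain ⟨w, hw, hwx⟩ := exists_mem_unitsImage (M.mem_adjoin_r hv hx) hxU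
      exact ⟨w, hle _ (M.finrank_adjoin_r hv) hw, hwx⟩
    have hprod : ∀ S : Finset Vec, S ⊆ realIdx →
        ∃ w ∈ P, ((w : 𝓞 L) : L) = M.unitProd S b := by
      intro S hS
      induction S using Finset.induction_on with
      | empty => exact ⟨1, one_mem _, by simp [unitProd]⟩
      | insert v S hvS ih =>
        obtain ⟨w, hwP, hw⟩ := ih fun x hx => hS (Finset.mem_insert_of_mem hx)
        have hv := mem_realIdx.1 (hS (Finset.mem_insert_self v S))
        obtain ⟨w', hwP', hw'⟩ := hquad v hv.2 _ ((M.g_fixBy v).zpow (b v))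
          ((M.isU_g v).zpow (b v))
        refine ⟨w' * w, mul_mem hwP' hwP, ?_⟩
        unfold unitProd at hw ⊢
        rw [Finset.prod_insert hvS, coe_unit_mul, hw, hw']
    obtain ⟨w, hwP, hw⟩ := hprod realIdx (Finset.Subset.refl _)
    obtain ⟨w', hwP', hw'⟩ := hquad e₀ (by decide) _ ((M.fixBy_r e₀).pow j) (M.isU_i.pow j)
    have : u = w' * w := coe_unit_injective (by rw [coe_unit_mul, hw, hw', h])
    rw [this]
    exact mul_mem hwP' hwP

end Frame

/-! ### The fundamental units of the statement inside the frame -/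

lemma isU_map_iff {L F : Type*} [Field L] [Field F] (f : L →+* F) {x : L} :
    IsU (f x) ↔ IsU x := by
  have h : ∀ y : L, IsIntegral ℤ (f y) ↔ IsIntegral ℤ y := fun y =>
    isIntegral_algHom_iff f.toIntAlgHom f.injective
  unfold IsU
  rw [← map_inv₀, h, h, map_ne_zero]

/-- The number dc is an integer whose square is divisible by the squarefree d, so d divides it. -/
lemma rat_int_of_squarefree_mul_sq {c : ℚ} {d n : ℤ} (hd : Squarefree d) (h : d * c ^ 2 = n) :
    ∃ m : ℤ, c = m := by
  have hd0 : (d : ℚ) ≠ 0 := by exact_mod_cast hd.ne_zero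
  obtain ⟨k, hk⟩ := rat_int_of_sq (c := d * c) (n := d * n) (by push_cast; rw [← h]; ring)
  have h1 : k ^ 2 = d * n := by
    have : (k : ℚ) ^ 2 = d * n := by rw [← hk, ← h]; ring
    exact_mod_cast this
  obtain ⟨m, rfl⟩ := (hd.dvd_pow_iff_dvd two_ne_zero).1 (Dvd.intro _ h1.symm)
  exact ⟨m, mul_left_cancel₀ hd0 (by rw [hk]; push_cast; rfl)⟩

section QSqrt

variable {d : ℕ}

lemma sqrt_mem_QSqrt (d : ℕ) : √(d : ℝ) ∈ QSqrt d :=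
  IntermediateField.mem_adjoin_simple_self ℚ _

lemma coe_ne_sqrt (hd : ¬ IsSquare d) (c : ℚ) :
    algebraMap ℚ (QSqrt d) c ≠ ⟨√(d : ℝ), sqrt_mem_QSqrt d⟩ := by
  intro h
  exact irrational_sqrt_natCast_iff.2 hd ⟨c, by simpa using congrArg Subtype.val h⟩

lemma finrank_QSqrt (hd : ¬ IsSquare d) : Module.finrank ℚ (QSqrt d) = 2 :=
  finrank_adjoin_sqrt (d := d) (by rw [Real.sq_sqrt (Nat.cast_nonneg d)]; simp)
    (by rwa [Rat.isSquare_natCast_iff])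

lemma exists_coords_QSqrt (hd : ¬ IsSquare d) (x : QSqrt d) :
    ∃ c b : ℚ, (x : ℝ) = c + b * √(d : ℝ) := by
  obtain ⟨c, b, h⟩ := @exists_coords_of_finrank (QSqrt d) _ (QSqrt d).algebra' (finrank_QSqrt hd) _
    (coe_ne_sqrt hd) x
  exact ⟨c, b, by simpa using congrArg Subtype.val h⟩

lemma unitNorm_eq (hd : ¬ IsSquare d) {u : (𝓞 (QSqrt d))ˣ} {c b : ℚ}
    (h : toReal u = c + b * √(d : ℝ)) : unitNorm u = c ^ 2 - b ^ 2 * d := by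
  have hs : (⟨√(d : ℝ), sqrt_mem_QSqrt d⟩ : QSqrt d) ^ 2 = algebraMap ℚ (QSqrt d) (d : ℚ) := by
    apply Subtype.ext
    simp
  have := @norm_quadratic (QSqrt d) _ (QSqrt d).algebra' (finrank_QSqrt hd) _ (coe_ne_sqrt hd) _
    hs c b
  rw [← this]
  unfold unitNorm
  congr 1
  apply Subtype.ext
  simpa [toReal] using h

lemma exists_unit_QSqrt {x : ℝ} (hx : x ∈ QSqrt d) (hu : IsU x) :
    ∃ u : (𝓞 (QSqrt d))ˣ, toReal u = x := by
  have hU : IsU (⟨x, hx⟩ : QSqrt d) := (isU_map_iff (algebraMap (QSqrt d) ℝ)).1 hu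
  obtain ⟨u, h⟩ := hU.exists_unit
  exact ⟨u, congrArg Subtype.val h⟩

lemma isU_toReal (u : (𝓞 (QSqrt d))ˣ) : IsU (toReal u) :=
  (isU_coe u).map (algebraMap (QSqrt d) ℝ)

end QSqrt

namespace Frame

variable {L : Type*} [Field L] [CharZero L] {p q : ℕ} (M : Frame L p q)

lemma not_isSquare_of_disc {v : Vec} (hv : v ∈ realIdx) {d : ℕ} (hd : disc p q v = d) (M : Frame L p q) :
    ¬ IsSquare d := by
  have := M.not_isSquare_disc (mem_realIdx.1 hv).2
  rw [hd] at this
  exact fun h => this (Int.isSquare_natCast_iff.2 h)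

/-- The fundamental unit of `ℚ(√d)` is the generator of the units in the frame. -/
lemma fundamental_eq {v : Vec} (hv : v ∈ realIdx) {d : ℕ} (hd : disc p q v = d)
    {ε : (𝓞 (QSqrt d))ˣ} (hε : IsFundamentalUnit d ε) : M.ι (M.g v) = toReal ε := by
  have hsq := not_isSquare_of_disc hv hd M
  have hιr : M.ι (M.r v) = ((√(d : ℝ) : ℝ) : ℂ) := by
    rw [M.ι_r v (mem_realIdx.1 hv).1, hd]; simp
  obtain ⟨hgF, hgU, ⟨G, hG1, hG⟩, hgen⟩ := M.g_spec hv
  obtain ⟨π, hπ⟩ := exists_dot_eq_one (mem_realIdx.1 hv).2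
  have hle : toReal ε ≤ G := by
    obtain ⟨c, b, hcb, -⟩ := M.exists_coords hπ hgF
    have hGcb : G = c + b * √(d : ℝ) := by
      rw [hcb, map_add, map_mul, map_ratCast, map_ratCast, hιr] at hG
      exact_mod_cast hG.symm
    have hmem : G ∈ QSqrt d := by
      rw [hGcb]
      have hq : ∀ c : ℚ, (c : ℝ) ∈ QSqrt d := fun c => by simp
      exact add_mem (hq c) (mul_mem (hq b) (sqrt_mem_QSqrt d))
    have hGU : IsU G := by
      refine (isU_map_iff Complex.ofRealHom).1 ?_
      rw [Complex.ofRealHom_eq_coe, ← hG]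
      exact hgU.map M.ι
    obtain ⟨u, rfl⟩ := exists_unit_QSqrt hmem hGU
    exact hε.2 u hG1
  obtain ⟨c, b, hcb⟩ := exists_coords_QSqrt hsq ((ε : 𝓞 (QSqrt d)) : QSqrt d)
  have hιy : M.ι (c + b * M.r v) = toReal ε := by
    rw [map_add, map_mul, map_ratCast, map_ratCast, hιr]
    unfold toReal
    rw [hcb]
    push_cast
    rfl
  have hyU : IsU ((c : L) + b * M.r v) := by
    refine (isU_map_iff M.ι).1 ?_
    rw [hιy]
    exact (isU_toReal ε).map Complex.ofRealHom
  have hyF : M.FixBy (stab v) ((c : L) + b * M.r v) :=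
    (FixBy.rat c).add ((FixBy.rat b).mul (M.fixBy_r v))
  have hpos : ∀ n : ℤ, 0 < G ^ n := fun n => zpow_pos (by linarith) n
  -- Conversely ε is a power G^n, and ε > 1 forces n ≥ 1, hence G ≤ ε.
  obtain ⟨n, hn⟩ := hgen _ hyF hyU
  have hGn : toReal ε = G ^ n := by
    rcases hn with hn | hn
    · rw [hn, map_zpow₀, hG] at hιy
      exact_mod_cast hιy.symm
    · rw [hn, map_neg, map_zpow₀, hG] at hιy
      have h1 : -G ^ n = toReal ε := by exact_mod_cast hιy
      have := hε.1
      have := hpos n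
      linarith
  have h1 : 1 ≤ n := by
    by_contra hlt
    have h2 : G ^ n ≤ G ^ (0 : ℤ) := zpow_le_zpow_right₀ hG1.le (by omega)
    rw [zpow_zero, ← hGn] at h2
    exact absurd hε.1 (not_lt.2 h2)
  have h2 : G ^ (1 : ℤ) ≤ G ^ n := zpow_le_zpow_right₀ hG1.le h1
  rw [zpow_one, ← hGn] at h2
  rw [hG, le_antisymm h2 hle]

/-- The coordinates of the fundamental unit. -/
lemma fundamental_coords {v : Vec} (hv : v ∈ realIdx) {d : ℕ} (hd : disc p q v = d)
    {ε : (𝓞 (QSqrt d))ˣ} (hε : IsFundamentalUnit d ε) :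
    ∃ c b : ℚ, toReal ε = c + b * √(d : ℝ) ∧ c ^ 2 - b ^ 2 * d = M.nrm v ∧
      ∃ t : ℤ, 2 * c = t := by
  have hι := M.fundamental_eq hv hd hε
  obtain ⟨π, hπ⟩ := exists_dot_eq_one (mem_realIdx.1 hv).2
  obtain ⟨c, b, h1, h2⟩ := M.exists_coords hπ (M.g_fixBy v)
  obtain ⟨t, ht⟩ := M.trace_int hπ (M.g_fixBy v) (M.isU_g v).2.1
  refine ⟨c, b, ?_, ?_, t, ?_⟩
  · rw [h1, map_add, map_mul, map_ratCast, map_ratCast, M.ι_r v (mem_realIdx.1 hv).1, hd] at hι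
    have : ((c + b * √(d : ℝ) : ℝ) : ℂ) = (toReal ε : ℂ) := by
      rw [← hι]; simp
    exact_mod_cast this.symm
  · have h3 := M.g_mul_σ hπ
    rw [h2, h1] at h3
    have h4 : M.r v ^ 2 = (d : L) := by rw [M.r_sq, hd]; simp
    have : ((c ^ 2 - b ^ 2 * d : ℚ) : L) = ((M.nrm v : ℚ) : L) := by
      push_cast
      rw [← h3, ← h4]
      ring
    exact_mod_cast this
  · have : ((2 * c : ℚ) : L) = ((t : ℚ) : L) := by
      push_cast
      rw [← ht, h2, h1]
      ring
    exact_mod_cast this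

lemma unitNorm_fundamental {v : Vec} (hv : v ∈ realIdx) {d : ℕ} (hd : disc p q v = d)
    {ε : (𝓞 (QSqrt d))ˣ} (hε : IsFundamentalUnit d ε) : unitNorm ε = M.nrm v := by
  obtain ⟨c, b, h1, h2, -⟩ := M.fundamental_coords hv hd hε
  rw [unitNorm_eq (not_isSquare_of_disc hv hd M) h1, h2]

lemma disc_last : disc p q (0, 1, 1, 1) = (2 * p * q : ℕ) := by
  simp [disc, ZMod.val_one]

/-- If the fundamental unit `x + y√(2pq)` has norm `1`, then `x ± 1` is not a square. -/
lemma exists_not_pmOneSquare (hn : M.nrm (0, 1, 1, 1) = 1) {ε : (𝓞 (QSqrt (2 * p * q)))ˣ}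
    (hε : IsFundamentalUnit (2 * p * q) ε) :
    ∃ x y : ℤ, toReal ε = (x : ℝ) + (y : ℝ) * √((2 * p * q : ℕ) : ℝ) ∧ ¬ PMOneSquare x := by
  have hsf : Squarefree ((2 * p * q : ℕ) : ℤ) :=
    Int.squarefree_natCast.2 (squarefree_two_mul_mul M.prime_p M.prime_q M.p_mod M.q_mod)
  obtain ⟨c, b, h1, h2, t, ht⟩ := M.fundamental_coords (by decide) disc_last hε
  rw [hn] at h2
  obtain ⟨B, hB⟩ := rat_int_of_squarefree_mul_sq (c := 2 * b) (n := t ^ 2 - 4) hsf (by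
    push_cast at h2 ⊢
    rw [← ht]
    linear_combination -4 * h2)
  have h3 : t ^ 2 - 2 * p * q * B ^ 2 = 4 := by
    have : (t : ℚ) ^ 2 - 2 * p * q * B ^ 2 = 4 := by
      rw [← ht, ← hB]
      push_cast at h2
      linear_combination 4 * h2
    exact_mod_cast this
  have hp2 : (p : ℤ) % 2 = 1 := by have := M.p_mod; omega
  have hq2 : (q : ℤ) % 2 = 1 := by have := M.q_mod; omega
  -- The coordinates are integers because 2pq is even while pq is odd: t² - 2pqB² = 4 makes t even
  -- and then B even.
  have hte : Even t := by
    have : Even (t ^ 2) := ⟨p * q * B ^ 2 + 2, by linear_combination h3⟩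
    exact (Int.even_pow' two_ne_zero).1 this
  obtain ⟨x, rfl⟩ := hte
  have hBe : Even B := by
    have h4 : Even (p * q * B ^ 2 : ℤ) := ⟨x ^ 2 - 1, by linarith [h3]⟩
    rw [Int.even_mul, Int.even_mul] at h4
    rcases h4 with (h4 | h4) | h4
    · rw [Int.even_iff] at h4; omega
    · rw [Int.even_iff] at h4; omega
    · exact (Int.even_pow' two_ne_zero).1 h4
  obtain ⟨y, rfl⟩ := hBe
  have hcx : c = x := by push_cast at ht; linarith
  have hby : b = y := by push_cast at hB; linarith
  have hpell : x ^ 2 - 2 * p * q * y ^ 2 = 1 := by linarith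
  rw [hcx, hby] at h1
  refine ⟨x, y, by simpa using h1, ?_⟩
  -- If x + s = m², then x² - 1 = m²(m² - 2s) = 2pq·y². For m ≠ 0 this gives m² - 2s = 2pq·z², so 2s
  -- = ±2 would be a square modulo q; m = 0 gives y = 0 and ε = ±1.
  have key : ∀ (m : ℕ) (s : ℤ), (s = 1 ∨ s = -1) → x + s = (m : ℤ) ^ 2 → False := by
    intro m s hs hm
    have hs2 : s ^ 2 = 1 := by rcases hs with rfl | rfl <;> norm_num
    have hx : x = m ^ 2 - s := by linarith
    have hprod : (m : ℤ) ^ 2 * (m ^ 2 - 2 * s) = 2 * p * q * y ^ 2 := by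
      rw [hx] at hpell
      linear_combination hpell - hs2
    rcases eq_or_ne m 0 with rfl | hm0
    · have hp0 := M.prime_p.ne_zero
      have hq0 := M.prime_q.ne_zero
      have hy : y = 0 := by
        simpa [hp0, hq0] using hprod.symm
      have h5 : toReal ε = -s := by rw [h1, hx, hy]; simp
      have := hε.1
      rw [h5] at this
      rcases hs with rfl | rfl
      · norm_num at this
      · norm_num at this
    · have hm0' : (m : ℚ) ≠ 0 := by exact_mod_cast hm0
      have hprod' : (m : ℚ) ^ 2 * (m ^ 2 - 2 * s) = 2 * p * q * y ^ 2 := by exact_mod_cast hprod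
      obtain ⟨z, hz⟩ := rat_int_of_squarefree_mul_sq (c := y / m) (n := m ^ 2 - 2 * s) hsf (by
        push_cast
        field_simp
        linear_combination -hprod')
      have hyz : y = z * m := by
        have : (y : ℚ) = z * m := by rw [← hz]; field_simp
        exact_mod_cast this
      have h6 : (m : ℤ) ^ 2 - 2 * s = 2 * p * q * z ^ 2 := by
        have hm1 : (m : ℤ) ^ 2 ≠ 0 := by positivity
        apply mul_left_cancel₀ hm1
        rw [hprod, hyz]; ring
      have h7 := congrArg (Int.cast : ℤ → ZMod q) h6
      push_cast at h7
      rw [ZMod.natCast_self, mul_zero, zero_mul] at h7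
      rcases hs with rfl | rfl
      · exact (M.not_sq_two _).1 (by push_cast at h7; linear_combination h7)
      · exact (M.not_sq_two _).2 (by push_cast at h7; linear_combination h7)
  rintro (⟨m, hm⟩ | ⟨m, hm⟩)
  · exact key m 1 (Or.inl rfl) hm
  · exact key m (-1) (Or.inr rfl) (by rw [← hm]; ring)

end Frame
end Multiquadratic

/-! ### Conclusion -/

theorem corollary5p3 (p₁ p₂ : ℕ) (hp₁ : p₁.Prime) (hp₂ : p₂.Prime)
    (h₁ : p₁ % 8 = 1) (h₂ : p₂ % 8 = 5) :
    ∃ δ : ℕ, (δ = 0 ∨ δ = 1) ∧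
      Multiquadratic.unitIndex (Multiquadratic.fieldL p₁ p₂) = 2 ^ (5 + δ) ∧
      -- the fundamental units `ε_{2p₁}`, `ε_{2p₂}`, `ε_{p₁p₂}`, `ε_{2p₁p₂}`
      ∀ (ε₁ : (𝓞 (Multiquadratic.QSqrt (2 * p₁)))ˣ)
        (ε₂ : (𝓞 (Multiquadratic.QSqrt (2 * p₂)))ˣ)
        (ε₃ : (𝓞 (Multiquadratic.QSqrt (p₁ * p₂)))ˣ)
        (ε₄ : (𝓞 (Multiquadratic.QSqrt (2 * p₁ * p₂)))ˣ),
        Multiquadratic.IsFundamentalUnit (2 * p₁) ε₁ →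
        Multiquadratic.IsFundamentalUnit (2 * p₂) ε₂ →
        Multiquadratic.IsFundamentalUnit (p₁ * p₂) ε₃ →
        Multiquadratic.IsFundamentalUnit (2 * p₁ * p₂) ε₄ →
        ∀ n₁ n₂ n₃ n₄ : ℚ,
          n₁ = Multiquadratic.unitNorm ε₁ → n₂ = Multiquadratic.unitNorm ε₂ →
          n₃ = Multiquadratic.unitNorm ε₃ → n₄ = Multiquadratic.unitNorm ε₄ →
          -- none of C1, C2, C3 holds, neither as it stands nor with `p₁`, `p₂` interchanged
          -- (C1 and C2 are symmetric in `n₁`, `n₂`)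
          ¬ Multiquadratic.C1 n₁ n₂ n₃ n₄ →
          ¬ Multiquadratic.C2 n₁ n₂ n₃ n₄ (2 * p₁ * p₂) ε₄ →
          ¬ Multiquadratic.C3 n₁ n₂ n₃ n₄ (2 * p₁ * p₂) ε₄ →
          ¬ Multiquadratic.C3 n₂ n₁ n₃ n₄ (2 * p₁ * p₂) ε₄ →
          δ = 0 := by
  classical
  let M := Multiquadratic.frame hp₁ hp₂ h₁ h₂
  have hindex : Multiquadratic.unitIndex (Multiquadratic.fieldL p₁ p₂) =
      32 * M.parity.ker.index := M.index_eq M.isQuadraticUnits_iSup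
  refine ⟨if M.parity.ker.index = 1 then 0 else 1, ?_, ?_, ?_⟩
  · split_ifs <;> simp
  · rw [hindex]
    rcases M.index_parity with h | h <;> simp [h]
  · intro ε₁ ε₂ ε₃ ε₄ hε₁ hε₂ hε₃ hε₄ n₁ n₂ n₃ n₄ hn₁ hn₂ hn₃ hn₄ hC1 _ _ hC3
    rw [if_pos]
    by_contra hne
    rw [M.unitNorm_fundamental (v := (0, 1, 1, 0)) (by decide)
      (by simp [Multiquadratic.disc, ZMod.val_one]) hε₁] at hn₁
    rw [M.unitNorm_fundamental (v := (0, 1, 0, 1)) (by decide)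
      (by simp [Multiquadratic.disc, ZMod.val_one]) hε₂, M.nrm_two_q] at hn₂
    rw [M.unitNorm_fundamental (v := (0, 0, 1, 1)) (by decide)
      (by simp [Multiquadratic.disc, ZMod.val_one]) hε₃] at hn₃
    rw [M.unitNorm_fundamental (v := (0, 1, 1, 1)) (by decide)
      Multiquadratic.Frame.disc_last hε₄] at hn₄
    -- If δ ≠ 0, the norms at 2p, pq and 2pq coincide.
    have hall : ∀ u ∈ Multiquadratic.ramIdx, ∀ w ∈ Multiquadratic.ramIdx,
        M.nrm u = -1 → M.nrm w = -1 := by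
      intro u hu w hw hu'
      rcases M.nrm_pm_one w with h | h
      · exact absurd (M.index_parity_of_nrm hu hw hu' h) hne
      · exact h
    have hm₁ : ((0, 1, 1, 0) : Multiquadratic.Vec) ∈ Multiquadratic.ramIdx := by decide
    have hm₃ : ((0, 0, 1, 1) : Multiquadratic.Vec) ∈ Multiquadratic.ramIdx := by decide
    have hm₄ : ((0, 1, 1, 1) : Multiquadratic.Vec) ∈ Multiquadratic.ramIdx := by decide
    rcases M.nrm_pm_one (0, 1, 1, 0) with h | h
    -- All three norms are 1 while n₂ = -1: this is C3 with the two primes interchanged.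
    · have hpos : ∀ w ∈ Multiquadratic.ramIdx, M.nrm w = 1 := by
        intro w hw
        rcases M.nrm_pm_one w with h' | h'
        · exact h'
        · have := hall w hw _ hm₁ h'
          rw [h] at this
          exact absurd this (by norm_num)
      rw [h] at hn₁
      rw [hpos _ hm₃] at hn₃
      rw [hpos _ hm₄] at hn₄
      refine hC3 ⟨by rw [hn₂]; norm_num, by rw [hn₁]; norm_num, by rw [hn₃]; norm_num,
        by rw [hn₄]; norm_num, M.exists_not_pmOneSquare (hpos _ hm₄) hε₄⟩
    -- All three norms are -1, as is n₂: this is C1.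
    · rw [h] at hn₁
      rw [hall _ hm₁ _ hm₃ h] at hn₃
      rw [hall _ hm₁ _ hm₄ h] at hn₄
      exact hC1 ⟨by rw [hn₁, hn₂], by rw [hn₂, hn₃], by rw [hn₃, hn₄]⟩
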